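/- A *cone* in $\mathbb{R}^n$ is *rational polyhedral* if it is generated, using nonnegative real coefficients, by finitely many vectors of $\mathbb{Z}^n$, and *strictly convex* if it contains no line. A *ray* is a half-line $\mathbb{R}_{\ge 0}v$ with $0 \ne v \in \mathbb{Z}^n$. A *fan* in $\mathbb{R}^n$ is a finite nonempty set $\Sigma$ of strictly convex rational polyhedral cones that contains every face of each of its cones and in which the intersection of any two cones is a face of both; $\Sigma(1)$ denotes its set of one-dimensional cones. Given a set $R$ of rays, a fan $\Sigma$ is *maximal with respect to $R$* if it is maximal, for inclusion of sets of cones, among all fans $\Sigma'$ with $\Sigma'(1) \subseteq R$ (not every ray of $R$ need occur in $\Sigma$). A fan is *complete* if the union of its cones is $\mathbb{R}^n$, *projective* if it is the normal fan of a rational polytope (the convex hull of finitely many points of $\mathbb{Q}^n$), and *simplicial* if each of its cones $\sigma$ is generated by $\dim \sigma$ vectors. **Theorem.** For every $n \ge 3$ there is a finite set $R$ of rays in $\mathbb{R}^n$ such that every fan in $\mathbb{R}^n$ that is maximal with respect to $R$ is complete, and such that among the fans maximal with respect to $R$ there occur a projective simplicial one, a projective non-simplicial one, a non-projective simplicial one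 and a non-projective non-simplicial one. -/

import Mathlib

open scoped Matrix

noncomputable section

namespace ToricFan

/-- The real vector with the given integer coordinates. -/
def intVec {n : ℕ} (v : Fin n → ℤ) : Fin n → ℝ := fun i => (v i : ℝ)

/-- The real vector with the given rational coordinates. -/
def ratVec {n : ℕ} (v : Fin n → ℚ) : Fin n → ℝ := fun i => (v i : ℝ)

/-- The dimension of a cone: the dimension of its linear span. -/
def coneDim {n : ℕ} (σ : PointedCone ℝ (Fin n → ℝ)) : ℕ :=
  Module.finrank ℝ (Submodule.span ℝ (σ : Set (Fin n → ℝ)))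

/-- A rational polyhedral cone: generated by finitely many lattice vectors. -/
def IsRationalPolyhedral {n : ℕ} (σ : PointedCone ℝ (Fin n → ℝ)) : Prop :=
  ∃ s : Set (Fin n → ℤ), s.Finite ∧ σ = PointedCone.hull ℝ (intVec '' s)

/-- A (rational) ray: the half-line generated by a nonzero lattice vector. -/
def IsRay {n : ℕ} (ρ : PointedCone ℝ (Fin n → ℝ)) : Prop :=
  ∃ v : Fin n → ℤ, v ≠ 0 ∧ ρ = PointedCone.hull ℝ {intVec v}

/-- A fan in `ℝⁿ`: a finite nonempty collection of strictly convex rational polyhedral cones,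
closed under taking faces, in which any two cones meet in a common face. -/
structure IsFan {n : ℕ} (S : Set (PointedCone ℝ (Fin n → ℝ))) : Prop where
  finite : S.Finite
  nonempty : S.Nonempty
  rational : ∀ σ ∈ S, IsRationalPolyhedral σ
  strictlyConvex : ∀ σ ∈ S, (σ : ConvexCone ℝ (Fin n → ℝ)).Salient
  face_mem : ∀ σ ∈ S, ∀ τ : PointedCone ℝ (Fin n → ℝ), τ.IsFaceOf σ → τ ∈ S
  inter_face : ∀ σ ∈ S, ∀ τ ∈ S, (σ ⊓ τ).IsFaceOf σ ∧ (σ ⊓ τ).IsFaceOf τ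

/-- `S(1)`, the rays of a fan: its one-dimensional cones. -/
def fanRays {n : ℕ} (S : Set (PointedCone ℝ (Fin n → ℝ))) :
    Set (PointedCone ℝ (Fin n → ℝ)) :=
  {σ ∈ S | coneDim σ = 1}

/-- A fan that is maximal, for inclusion of sets of cones, among all fans whose rays
belong to `R`. -/
def IsMaximalFan {n : ℕ} (R S : Set (PointedCone ℝ (Fin n → ℝ))) : Prop :=
  Maximal (fun S' => IsFan S' ∧ fanRays S' ⊆ R) S

/-- The cones of the collection cover `ℝⁿ`. -/
def IsComplete {n : ℕ} (S : Set (PointedCone ℝ (Fin n → ℝ))) : Prop :=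
  ⋃ σ ∈ S, (σ : Set (Fin n → ℝ)) = Set.univ

/-- Every cone of the collection is simplicial, that is, generated by linearly independent
vectors. -/
def IsSimplicial {n : ℕ} (S : Set (PointedCone ℝ (Fin n → ℝ))) : Prop :=
  ∀ σ ∈ S, σ.IsSimplicial

/-- A rational polytope: the convex hull of finitely many rational points. -/
def IsRationalPolytope {n : ℕ} (P : Set (Fin n → ℝ)) : Prop :=
  ∃ s : Set (Fin n → ℚ), s.Finite ∧ P = convexHull ℝ (ratVec '' s)

/-- The (inner) normal cone of `P` along `F`: the vectors `u` for which the linear form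
`⟨·, u⟩` attains its minimum over `P` at every point of `F`. -/
def normalCone {n : ℕ} (P F : Set (Fin n → ℝ)) : PointedCone ℝ (Fin n → ℝ) where
  carrier := {u | ∀ p ∈ F, ∀ q ∈ P, p ⬝ᵥ u ≤ q ⬝ᵥ u}
  zero_mem' := by
    intro p _ q _
    simp
  add_mem' := by
    intro u v hu hv p hp q hq
    rw [dotProduct_add, dotProduct_add]
    exact add_le_add (hu p hp q hq) (hv p hp q hq)
  smul_mem' := by
    intro c u hu p hp q hq
    change p ⬝ᵥ ((c : ℝ) • u) ≤ q ⬝ᵥ ((c : ℝ) • u)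
    rw [dotProduct_smul, dotProduct_smul]
    exact mul_le_mul_of_nonneg_left (hu p hp q hq) c.2

/-- The normal fan of a polytope: the normal cones of its nonempty faces. -/
def normalFan {n : ℕ} (P : Set (Fin n → ℝ)) : Set (PointedCone ℝ (Fin n → ℝ)) :=
  {σ | ∃ F : Set (Fin n → ℝ), IsExposed ℝ P F ∧ F.Nonempty ∧ σ = normalCone P F}

/-- A projective fan: the normal fan of a rational polytope. -/
def IsProjective {n : ℕ} (S : Set (PointedCone ℝ (Fin n → ℝ))) : Prop :=
  ∃ P : Set (Fin n → ℝ), IsRationalPolytope P ∧ S = normalFan P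

end ToricFan

end

/-! The heart is a fact about dimension three: if the rays in `R` positively span ℝ³, every fan
maximal with respect to `R` is complete (`IsSaturated.isComplete`). A few cones can then be
prescribed to force non-projectivity or non-simpliciality, and the rest of the fan need not be
constructed.

If the support of a fan is not convex, some segment leaves it, which gives a chord: two points of
the support with none of the support between them. A maximal fan has no chord. First, no triangle of
vertices has its interior disjoint from the support, since a smallest such triangle could be added
(`IsSaturated.not_emptyTriangle`). A chord from a vertex, turned about it both ways until a vertex
is met, produces such a triangle (`IsSaturated.not_isChord_of_isVertex`). If neither end is a
vertex, each lies inside a two-dimensional cone, and either a chord from a vertex arises or the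
positions of the two cones contradict each other (`IsSaturated.coord_eq_zero`,
`IsSaturated.not_isChord`). Only simplicial cones are ever added, so the argument also covers fans
that are maximal merely among simplicial fans; being complete, these are maximal among all fans.

For n = 3, `R` consists of the rays of the fan of (ℙ¹)³, the rays of the normal fan of a square
pyramid, and the rays through the vertices of a triangular prism. The first two fans are the
projective examples. Cyclically chosen diagonals of the sides of the prism exclude a strictly convex
support function (`IsTwisted.not_isProjective`). A maximal simplicial extension of these diagonals,
and a maximal extension of the diagonals together with the non-simplicial cone of the pyramid, are
the other two.

Higher dimensions follow by products with the fan of ℙ¹: a fan with rays in `suspRays R` lies in the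
suspension of its slice (`subset_susp_slice`), so its completeness reduces to that of a maximal fan
one dimension lower, and all four kinds survive suspension. -/

namespace ToricFan

/-! ### Finitely generated cones and their faces. -/

section Cones

variable {V : Type*} [AddCommGroup V] [Module ℝ V]

theorem mem_hull_singleton {a x : V} :
    x ∈ PointedCone.hull ℝ {a} ↔ ∃ α : ℝ, 0 ≤ α ∧ x = α • a := by
  constructor
  · intro h
    obtain ⟨c, rfl⟩ := Submodule.mem_span_singleton.1 h
    exact ⟨c.1, c.2, rfl⟩
  · rintro ⟨α, hα, rfl⟩
    exact PointedCone.smul_mem _ hα (PointedCone.subset_hull rfl)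

theorem mem_hull_pair {a b x : V} :
    x ∈ PointedCone.hull ℝ {a, b} ↔ ∃ α β : ℝ, 0 ≤ α ∧ 0 ≤ β ∧ x = α • a + β • b := by
  constructor
  · intro h
    obtain ⟨c, d, rfl⟩ := Submodule.mem_span_pair.1 h
    exact ⟨c.1, d.1, c.2, d.2, rfl⟩
  · rintro ⟨α, β, hα, hβ, rfl⟩
    exact add_mem (PointedCone.smul_mem _ hα (PointedCone.subset_hull (by simp)))
      (PointedCone.smul_mem _ hβ (PointedCone.subset_hull (by simp)))

theorem mem_hull_triple {a b c x : V} :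
    x ∈ PointedCone.hull ℝ {a, b, c} ↔
      ∃ α β γ : ℝ, 0 ≤ α ∧ 0 ≤ β ∧ 0 ≤ γ ∧ x = α • a + β • b + γ • c := by
  constructor
  · intro h
    obtain ⟨α, β, γ, rfl⟩ := Submodule.mem_span_triple.1 h
    exact ⟨α.1, β.1, γ.1, α.2, β.2, γ.2, rfl⟩
  · rintro ⟨α, β, γ, hα, hβ, hγ, rfl⟩
    exact add_mem (add_mem (PointedCone.smul_mem _ hα (PointedCone.subset_hull (by simp)))
      (PointedCone.smul_mem _ hβ (PointedCone.subset_hull (by simp))))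
      (PointedCone.smul_mem _ hγ (PointedCone.subset_hull (by simp)))

theorem mem_hull_range {ι : Type*} [Fintype ι] {g : ι → V} {x : V} :
    x ∈ PointedCone.hull ℝ (Set.range g) ↔ ∃ c : ι → ℝ, (∀ i, 0 ≤ c i) ∧ x = ∑ i, c i • g i := by
  constructor
  · intro h
    obtain ⟨c, rfl⟩ := (Submodule.mem_span_range_iff_exists_fun _).1 h
    exact ⟨fun i => (c i).1, fun i => (c i).2, rfl⟩
  · rintro ⟨c, hc, rfl⟩
    exact sum_mem fun i _ => PointedCone.smul_mem _ (hc i) (PointedCone.subset_hull ⟨i, rfl⟩)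

/-- Every face of a finitely generated cone is generated by the generators that it contains. -/
theorem isFaceOf_eq_hull {F C : PointedCone ℝ V} (hF : F.IsFaceOf C) {G : Set V}
    (hC : C = PointedCone.hull ℝ G) : F = PointedCone.hull ℝ (G ∩ F) := by
  apply le_antisymm
  · have key : ∀ x ∈ PointedCone.hull ℝ G, x ∈ F → x ∈ PointedCone.hull ℝ (G ∩ F) := by
      intro x hx
      induction hx using Submodule.span_induction with
      | mem x hx => exact fun h => PointedCone.subset_hull ⟨hx, h⟩
      | zero => exact fun _ => zero_mem _
      | add x y hx hy ihx ihy =>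
        intro h
        have := (PointedCone.IsFaceOf.add_mem_iff_mem hF (hC ▸ hx) (hC ▸ hy)).1 h
        exact add_mem (ihx this.1) (ihy this.2)
      | smul a x hx ih =>
        intro h
        rcases eq_or_lt_of_le a.2 with h0 | h0
        · have : a = 0 := Subtype.ext h0.symm
          simp [this]
        · exact Submodule.smul_mem _ _ (ih ((PointedCone.smul_mem_iff F h0).1 h))
    intro x hx
    exact key x (hC ▸ hF.le hx) hx
  · exact Submodule.span_le.2 Set.inter_subset_right

theorem isFaceOf_of_add_mem {F C : PointedCone ℝ V} (h : F ≤ C)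
    (h2 : ∀ x ∈ C, ∀ y ∈ C, x + y ∈ F → x ∈ F) : F.IsFaceOf C :=
  PointedCone.IsFaceOf.of_mem_of_add_mem_left h fun hx hy hxy => h2 _ hx _ hy hxy

theorem eq_zero_of_salient {C : PointedCone ℝ V} (hC : (C : ConvexCone ℝ V).Salient) {x : V}
    (hx : x ∈ C) (hx' : -x ∈ C) : x = 0 := by
  by_contra h
  exact hC x hx h hx'

theorem isFaceOf_bot {C : PointedCone ℝ V} (hC : (C : ConvexCone ℝ V).Salient) :
    (⊥ : PointedCone ℝ V).IsFaceOf C := by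
  refine isFaceOf_of_add_mem bot_le fun x hx y hy h => ?_
  rw [Submodule.mem_bot] at h ⊢
  exact eq_zero_of_salient hC hx (by rwa [← eq_neg_of_add_eq_zero_right h])

theorem mem_hull_insert {G : Set V} {g x : V} :
    x ∈ PointedCone.hull ℝ (insert g G) ↔
      ∃ α : ℝ, 0 ≤ α ∧ ∃ y ∈ PointedCone.hull ℝ G, x = α • g + y := by
  constructor
  · intro h
    obtain ⟨a, z, hz, rfl⟩ := Submodule.mem_span_insert.1 h
    exact ⟨a.1, a.2, z, hz, rfl⟩
  · rintro ⟨α, hα, y, hy, rfl⟩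
    exact add_mem (PointedCone.smul_mem _ hα (PointedCone.subset_hull (by simp)))
      (Submodule.span_mono (Set.subset_insert _ _) hy)

/-- A finitely generated salient cone is generated by those of its generators that span
one-dimensional faces. -/
theorem exists_hull_eq_isFaceOf {G : Set V} (hG : G.Finite)
    (hs : (PointedCone.hull ℝ G : ConvexCone ℝ V).Salient) :
    ∃ G' ⊆ G, PointedCone.hull ℝ G' = PointedCone.hull ℝ G ∧
      ∀ g ∈ G', g ≠ 0 ∧ (PointedCone.hull ℝ {g}).IsFaceOf (PointedCone.hull ℝ G) := by
  have hfin : {T : Set V | T ⊆ G ∧ PointedCone.hull ℝ T = PointedCone.hull ℝ G}.Finite :=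
    hG.finite_subsets.subset fun T hT => hT.1
  obtain ⟨T, hT⟩ := hfin.exists_minimal ⟨G, subset_rfl, rfl⟩
  refine ⟨T, hT.prop.1, hT.prop.2, fun g hg => ?_⟩
  -- By minimality of `T`, no generator is redundant.
  have hnot : g ∉ PointedCone.hull ℝ (T \ {g}) := by
    intro h
    have h1 : PointedCone.hull ℝ (T \ {g}) = PointedCone.hull ℝ G := by
      rw [← hT.prop.2]
      apply le_antisymm (Submodule.span_mono Set.sdiff_subset)
      refine Submodule.span_le.2 fun x hx => ?_
      by_cases hxg : x = g
      · exact hxg ▸ h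
      · exact PointedCone.subset_hull ⟨hx, hxg⟩
    have := hT.le_of_le (y := T \ {g}) ⟨Set.sdiff_subset.trans hT.prop.1, h1⟩ Set.sdiff_subset hg
    exact this.2 rfl
  have hdec : ∀ x ∈ PointedCone.hull ℝ G,
      ∃ α : ℝ, 0 ≤ α ∧ ∃ y ∈ PointedCone.hull ℝ (T \ {g}), x = α • g + y := by
    intro x hx
    rw [← hT.prop.2, ← Set.insert_sdiff_self_of_mem hg] at hx
    exact mem_hull_insert.1 hx
  have hsub : PointedCone.hull ℝ (T \ {g}) ≤ PointedCone.hull ℝ G :=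
    Submodule.span_mono (Set.sdiff_subset.trans hT.prop.1)
  have hgG : g ∈ PointedCone.hull ℝ G := PointedCone.subset_hull (hT.prop.1 hg)
  refine ⟨fun h => hnot (h ▸ zero_mem _), isFaceOf_of_add_mem
    (Submodule.span_le.2 (by simpa using hgG)) fun x hx y hy hxy => ?_⟩
  obtain ⟨α, hα, x', hx', rfl⟩ := hdec x hx
  obtain ⟨β, hβ, y', hy', rfl⟩ := hdec y hy
  obtain ⟨γ, hγ, h⟩ := mem_hull_singleton.1 hxy
  have h2 : x' + y' = (γ - α - β) • g := by
    have : x' + y' = (α • g + x' + (β • g + y')) - (α + β) • g := by module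
    rw [this, h]; module
  -- A positive coefficient would make `g` redundant. Otherwise `-x'` also lies in the cone, and
  -- salience gives `x' = 0`.
  have hle : γ - α - β ≤ 0 := by
    by_contra hpos
    push Not at hpos
    apply hnot
    rw [← PointedCone.smul_mem_iff _ hpos, ← h2]
    exact add_mem hx' hy'
  have hx0 : x' = 0 := by
    apply eq_zero_of_salient hs (hsub hx')
    have : -x' = y' + (-(γ - α - β)) • g := by
      rw [eq_comm, ← sub_eq_zero]
      have : y' + (-(γ - α - β)) • g - -x' = (x' + y') - (γ - α - β) • g := by module
      rw [this, h2, sub_self]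
    rw [this]
    exact add_mem (hsub hy') (PointedCone.smul_mem _ (by linarith) hgG)
  subst hx0
  exact mem_hull_singleton.2 ⟨α, hα, by simp⟩

/-- The smallest face of a cone `C` that contains a given point of `C`. -/
def minFace (C : PointedCone ℝ V) (x : V) (_hx : x ∈ C) : PointedCone ℝ V where
  carrier := {u | u ∈ C ∧ ∃ k : ℝ, 0 ≤ k ∧ k • x - u ∈ C}
  zero_mem' := ⟨zero_mem _, 0, le_rfl, by simp⟩
  add_mem' := by
    rintro u v ⟨hu, k, hk, hku⟩ ⟨hv, l, hl, hlv⟩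
    refine ⟨add_mem hu hv, k + l, by positivity, ?_⟩
    have : (k + l) • x - (u + v) = (k • x - u) + (l • x - v) := by module
    rw [this]; exact add_mem hku hlv
  smul_mem' := by
    rintro c u ⟨hu, k, hk, hku⟩
    refine ⟨Submodule.smul_mem _ _ hu, c * k, mul_nonneg c.2 hk, ?_⟩
    have : ((c : ℝ) * k) • x - c • u = c • (k • x - u) := by
      rw [smul_sub]; congr 1; exact mul_smul (c : ℝ) k x
    rw [this]; exact Submodule.smul_mem _ _ hku

theorem minFace_isFaceOf (C : PointedCone ℝ V) (x : V) (hx : x ∈ C) :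
    (minFace C x hx).IsFaceOf C := by
  refine isFaceOf_of_add_mem (fun u hu => hu.1) ?_
  rintro u hu v hv ⟨-, k, hk, h⟩
  refine ⟨hu, k, hk, ?_⟩
  have : k • x - u = (k • x - (u + v)) + v := by module
  rw [this]; exact add_mem h hv

theorem exists_smul_sub_mem_minFace {C : PointedCone ℝ V} {x : V} (hx : x ∈ C) {u : V}
    (hu : u ∈ minFace C x hx) : ∃ k : ℝ, 0 ≤ k ∧ k • x - u ∈ minFace C x hx := by
  obtain ⟨hu, k, hk, h⟩ := hu
  exact ⟨k, hk, h, k, hk, by simpa using hu⟩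

theorem self_mem_minFace {C : PointedCone ℝ V} {x : V} (hx : x ∈ C) : x ∈ minFace C x hx :=
  ⟨hx, 1, zero_le_one, by simp⟩

theorem minFace_le {C F : PointedCone ℝ V} (hF : F.IsFaceOf C) {x : V} (hx : x ∈ C) (hxF : x ∈ F) :
    minFace C x hx ≤ F := by
  rintro u ⟨hu, k, hk, h⟩
  refine hF.mem_of_add_mem_left hu h ?_
  rw [add_sub_cancel]
  exact PointedCone.smul_mem _ hk hxF

end Cones

/-! ### Closedness of finitely generated salient cones. -/

section Closed

/-- A finitely generated salient cone is closed. -/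
theorem isClosed_hull {V : Type*} [NormedAddCommGroup V] [NormedSpace ℝ V]
    {G : Set V} (hG : G.Finite) (hs : (PointedCone.hull ℝ G : ConvexCone ℝ V).Salient) :
    IsClosed (PointedCone.hull ℝ G : Set V) := by
  obtain ⟨T, hTG, hT, hT0⟩ := exists_hull_eq_isFaceOf hG hs
  rw [← hT] at hs ⊢
  -- The convex hull of the nonzero generators is a compact base: it avoids the origin, and each
  -- nonzero point of the cone is a positive multiple of one of its points.
  have hK : IsCompact (convexHull ℝ T) := (hG.subset hTG).isCompact_convexHull (𝕜 := ℝ)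
  have hKsub : convexHull ℝ T ⊆ (PointedCone.hull ℝ T : Set V) :=
    convexHull_min PointedCone.subset_hull (PointedCone.convex _)
  have hcone : ∀ x ∈ PointedCone.hull ℝ T, x ≠ 0 →
      ∃ t : ℝ, 0 < t ∧ ∃ y ∈ convexHull ℝ T, x = t • y := by
    intro x hx
    induction hx using Submodule.span_induction with
    | mem x hx => exact fun _ => ⟨1, one_pos, x, subset_convexHull ℝ T hx, by simp⟩
    | zero => exact fun h => absurd rfl h
    | add x y hx hy ihx ihy =>
      intro _
      by_cases hx0 : x = 0
      · subst hx0; rw [zero_add] at *; exact ihy ‹_›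
      by_cases hy0 : y = 0
      · subst hy0; rw [add_zero] at *; exact ihx ‹_›
      obtain ⟨s, hs, x', hx', rfl⟩ := ihx hx0
      obtain ⟨t, ht, y', hy', rfl⟩ := ihy hy0
      refine ⟨s + t, by positivity, (s / (s + t)) • x' + (t / (s + t)) • y',
        convex_convexHull ℝ T hx' hy' (by positivity) (by positivity) (by field_simp), ?_⟩
      rw [smul_add, smul_smul, smul_smul]
      congr 2 <;> field_simp
    | smul a x hx ih =>
      intro h
      have ha : a ≠ 0 := fun h0 => h (by rw [h0, zero_smul])
      have hx0 : x ≠ 0 := fun h0 => h (by rw [h0, smul_zero])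
      obtain ⟨t, ht, y, hy, rfl⟩ := ih hx0
      have ha' : 0 < (a : ℝ) := lt_of_le_of_ne a.2 fun h0 => ha (Subtype.ext h0.symm)
      exact ⟨a * t, by positivity, y, hy, by rw [mul_smul]; rfl⟩
  have h0 : (0 : V) ∉ convexHull ℝ T := by
    intro h
    have key : ∀ x ∈ convexHull ℝ T, ∀ C : PointedCone ℝ V, C = PointedCone.hull ℝ T → x ≠ 0 := by
      rintro x hx C rfl rfl
      obtain ⟨ι, _, w, z, hw, hw1, hz, hsum⟩ := mem_convexHull_iff_exists_fintype.1 hx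
      obtain ⟨i, -, hi⟩ := Finset.exists_ne_zero_of_sum_ne_zero (hw1.trans_ne one_ne_zero)
      have hi' : 0 < w i := lt_of_le_of_ne (hw i) hi.symm
      classical
      have h1 : w i • z i ∈ PointedCone.hull ℝ T :=
        PointedCone.smul_mem _ (hw i) (PointedCone.subset_hull (hz i))
      have h2 : -(w i • z i) ∈ PointedCone.hull ℝ T := by
        rw [← Finset.add_sum_erase _ _ (Finset.mem_univ i)] at hsum
        rw [← eq_neg_of_add_eq_zero_right hsum]
        exact sum_mem fun j _ => PointedCone.smul_mem _ (hw j) (PointedCone.subset_hull (hz j))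
      rcases smul_eq_zero.1 (eq_zero_of_salient hs h1 h2) with h3 | h3
      · exact hi h3
      · exact (hT0 _ (hz i)).1 h3
    exact key 0 h _ rfl rfl
  obtain ⟨δ, hδ, hδK⟩ : ∃ δ > 0, ∀ y ∈ convexHull ℝ T, δ ≤ ‖y‖ := by
    rcases (convexHull ℝ T).eq_empty_or_nonempty with he | hne
    · exact ⟨1, one_pos, by simp [he]⟩
    · obtain ⟨y, hy, hmin⟩ := hK.exists_isMinOn hne continuous_norm.continuousOn
      exact ⟨‖y‖, norm_pos_iff.2 fun h => h0 (h ▸ hy), fun z hz => hmin hz⟩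
  refine isClosed_of_closure_subset fun x hx => ?_
  by_cases hx0 : x = 0
  · subst hx0; exact zero_mem _
  -- Points of the cone within distance 1 of `x` are `t • k` with `k` in the base and `δ ≤ ‖k‖`,
  -- hence `t ≤ M`: near `x` the cone is a compact image.
  set M := (‖x‖ + 1) / δ
  have himg : IsCompact ((fun p : ℝ × V => p.1 • p.2) '' (Set.Icc 0 M ×ˢ convexHull ℝ T)) :=
    (isCompact_Icc.prod hK).image (by fun_prop)
  have hsub : ∀ ε > 0, ∃ y ∈ (fun p : ℝ × V => p.1 • p.2) '' (Set.Icc 0 M ×ˢ convexHull ℝ T),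
      dist x y < ε := by
    intro ε hε
    obtain ⟨y, hy, hd⟩ := Metric.mem_closure_iff.1 hx (min ε (min 1 ‖x‖))
      (lt_min hε (lt_min one_pos (norm_pos_iff.2 hx0)))
    have hy0 : y ≠ 0 := by
      rintro rfl
      have := hd.trans_le ((min_le_right _ _).trans (min_le_right _ _))
      rw [dist_zero_right] at this
      exact lt_irrefl _ this
    obtain ⟨t, ht, k, hk, rfl⟩ := hcone y hy hy0
    refine ⟨_, ⟨(t, k), ⟨⟨ht.le, ?_⟩, hk⟩, rfl⟩, hd.trans_le (min_le_left _ _)⟩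
    have h1 : ‖t • k‖ ≤ ‖x‖ + 1 := by
      have h2 : dist x (t • k) < 1 := hd.trans_le ((min_le_right _ _).trans (min_le_left _ _))
      rw [dist_comm, dist_eq_norm] at h2
      linarith [norm_sub_norm_le (t • k) x]
    rw [norm_smul, Real.norm_of_nonneg ht.le] at h1
    rw [le_div_iff₀ hδ]
    exact (mul_le_mul_of_nonneg_left (hδK k hk) ht.le).trans h1
  obtain ⟨⟨t, k⟩, ⟨ht, hk⟩, rfl⟩ := himg.isClosed.closure_subset (Metric.mem_closure_iff.2 hsub)
  exact PointedCone.smul_mem _ ht.1 (hKsub hk)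

end Closed

/-! ### Fans, their vertices, supports and enlargements. -/

section Fans

variable {n : ℕ}

/-- The union of the cones of a collection. -/
def support (S : Set (PointedCone ℝ (Fin n → ℝ))) : Set (Fin n → ℝ) :=
  ⋃ σ ∈ S, (σ : Set (Fin n → ℝ))

/-- A nonzero vector that spans a ray of the collection. -/
def IsVertex (S : Set (PointedCone ℝ (Fin n → ℝ))) (g : Fin n → ℝ) : Prop :=
  g ≠ 0 ∧ PointedCone.hull ℝ {g} ∈ S

theorem mem_support {S : Set (PointedCone ℝ (Fin n → ℝ))} {x : Fin n → ℝ} :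
    x ∈ support S ↔ ∃ σ ∈ S, x ∈ σ := by simp [support]

theorem mem_hull_self {V : Type*} [AddCommGroup V] [Module ℝ V] (g : V) :
    g ∈ PointedCone.hull ℝ {g} := PointedCone.subset_hull rfl

theorem coneDim_hull (G : Set (Fin n → ℝ)) :
    coneDim (PointedCone.hull ℝ G) = Module.finrank ℝ (Submodule.span ℝ G) := by
  rw [coneDim, Submodule.span_span_of_tower]

theorem coneDim_hull_singleton {g : Fin n → ℝ} (hg : g ≠ 0) :
    coneDim (PointedCone.hull ℝ {g}) = 1 := by
  rw [coneDim_hull, finrank_span_singleton hg]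

/-- All generators lie on one line, and salience forbids two on opposite sides of the origin. -/
theorem exists_eq_hull_singleton {G : Set (Fin n → ℝ)}
    (hs : (PointedCone.hull ℝ G : ConvexCone ℝ (Fin n → ℝ)).Salient)
    (hd : coneDim (PointedCone.hull ℝ G) = 1) :
    ∃ g ∈ G, g ≠ 0 ∧ PointedCone.hull ℝ G = PointedCone.hull ℝ {g} := by
  rw [coneDim_hull] at hd
  obtain ⟨g, hg, hg0⟩ : ∃ g ∈ G, g ≠ 0 := by
    by_contra h
    push Not at h
    have : Submodule.span ℝ G = ⊥ := Submodule.span_eq_bot.2 h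
    rw [this, finrank_bot] at hd
    exact zero_ne_one hd
  refine ⟨g, hg, hg0, le_antisymm (Submodule.span_le.2 fun x hx => ?_)
    (Submodule.span_mono (by simpa using hg))⟩
  have hg0' : (⟨g, Submodule.subset_span hg⟩ : Submodule.span ℝ G) ≠ 0 := by
    simpa [Subtype.ext_iff] using hg0
  obtain ⟨c, hc⟩ := (finrank_eq_one_iff_of_nonzero' _ hg0').1 hd ⟨x, Submodule.subset_span hx⟩
  have hc' : c • g = x := congrArg Subtype.val hc
  rcases le_or_gt 0 c with h | h
  · exact mem_hull_singleton.2 ⟨c, h, hc'.symm⟩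
  · exfalso
    have hgC : g ∈ PointedCone.hull ℝ G := PointedCone.subset_hull hg
    have hxC : x ∈ PointedCone.hull ℝ G := PointedCone.subset_hull hx
    refine hg0 (eq_zero_of_salient hs hgC ?_)
    rw [← PointedCone.smul_mem_iff _ (neg_pos.2 h)]
    simpa [hc'] using hxC

variable {S : Set (PointedCone ℝ (Fin n → ℝ))}

theorem IsFan.bot_mem (hS : IsFan S) : ⊥ ∈ S := by
  obtain ⟨σ, hσ⟩ := hS.nonempty
  exact hS.face_mem σ hσ _ (isFaceOf_bot (hS.strictlyConvex σ hσ))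

theorem IsFan.zero_mem_support (hS : IsFan S) : (0 : Fin n → ℝ) ∈ support S :=
  mem_support.2 ⟨⊥, hS.bot_mem, zero_mem _⟩

theorem smul_mem_support {x : Fin n → ℝ} (hx : x ∈ support S) {c : ℝ} (hc : 0 ≤ c) :
    c • x ∈ support S := by
  obtain ⟨σ, hσ, h⟩ := mem_support.1 hx
  exact mem_support.2 ⟨σ, hσ, PointedCone.smul_mem _ hc h⟩

theorem smul_mem_support_iff {x : Fin n → ℝ} {c : ℝ} (hc : 0 < c) :
    c • x ∈ support S ↔ x ∈ support S := by
  refine ⟨fun h => ?_, fun h => smul_mem_support h hc.le⟩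
  simpa [hc.ne'] using smul_mem_support h (inv_nonneg.2 hc.le)

theorem IsFan.isClosed_cone (hS : IsFan S) {σ : PointedCone ℝ (Fin n → ℝ)} (hσ : σ ∈ S) :
    IsClosed (σ : Set (Fin n → ℝ)) := by
  obtain ⟨s, hs, rfl⟩ := hS.rational σ hσ
  exact isClosed_hull (hs.image _) (hS.strictlyConvex _ hσ)

theorem IsFan.isClosed_support (hS : IsFan S) : IsClosed (support S) :=
  hS.finite.isClosed_biUnion fun _ hσ => hS.isClosed_cone hσ

theorem IsFan.exists_generators (hS : IsFan S) {σ : PointedCone ℝ (Fin n → ℝ)} (hσ : σ ∈ S) :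
    ∃ G : Set (Fin n → ℝ), G.Finite ∧ σ = PointedCone.hull ℝ G ∧ ∀ g ∈ G, IsVertex S g := by
  obtain ⟨s, hs, rfl⟩ := hS.rational σ hσ
  obtain ⟨G, hG, h1, h2⟩ := exists_hull_eq_isFaceOf (hs.image _) (hS.strictlyConvex _ hσ)
  exact ⟨G, (hs.image _).subset hG, h1.symm,
    fun g hg => ⟨(h2 g hg).1, hS.face_mem _ hσ _ (h2 g hg).2⟩⟩

theorem IsVertex.mem_support {g : Fin n → ℝ} (hg : IsVertex S g) : g ∈ support S :=
  ToricFan.mem_support.2 ⟨_, hg.2, mem_hull_self g⟩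

theorem IsVertex.mem_fanRays {g : Fin n → ℝ} (hg : IsVertex S g) :
    PointedCone.hull ℝ {g} ∈ fanRays S := ⟨hg.2, coneDim_hull_singleton hg.1⟩

/-- If a point of one cone of a fan lies in another cone, then so does its smallest cone. -/
theorem IsFan.exists_carrier (hS : IsFan S) {x : Fin n → ℝ} (hx : x ∈ support S) :
    ∃ τ ∈ S, x ∈ τ ∧ (∀ σ ∈ S, x ∈ σ → τ ≤ σ) ∧ ∀ u ∈ τ, ∃ k : ℝ, 0 ≤ k ∧ k • x - u ∈ τ := by
  obtain ⟨σ, hσ, hxσ⟩ := mem_support.1 hx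
  refine ⟨minFace σ x hxσ, hS.face_mem σ hσ _ (minFace_isFaceOf σ x hxσ), self_mem_minFace hxσ,
    fun τ hτ hxτ => ?_, fun u hu => exists_smul_sub_mem_minFace hxσ hu⟩
  exact (minFace_le (hS.inter_face σ hσ τ hτ).1 hxσ ⟨hxσ, hxτ⟩).trans inf_le_right

theorem IsFan.mem_of_add_mem (hS : IsFan S) {σ τ : PointedCone ℝ (Fin n → ℝ)} (hσ : σ ∈ S)
    (hτ : τ ∈ S) {x y : Fin n → ℝ} (hx : x ∈ σ) (hy : y ∈ σ) (h : x + y ∈ τ) : x ∈ τ :=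
  ((hS.inter_face σ hσ τ hτ).1.mem_of_add_mem_left hx hy ⟨add_mem hx hy, h⟩).2

theorem IsFan.hull_singleton_isFaceOf (hS : IsFan S) {σ : PointedCone ℝ (Fin n → ℝ)} (hσ : σ ∈ S)
    {g : Fin n → ℝ} (hg : IsVertex S g) (hgσ : g ∈ σ) : (PointedCone.hull ℝ {g}).IsFaceOf σ := by
  have h := (hS.inter_face _ hg.2 σ hσ).2
  have hle : PointedCone.hull ℝ {g} ≤ σ := Submodule.span_le.2 (by simpa using hgσ)
  rwa [inf_eq_left.2 hle] at h

/-- A cone of a fan lies in any other cone that contains the sum of its generators. -/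
theorem IsFan.exists_mem_interior (hS : IsFan S) {σ : PointedCone ℝ (Fin n → ℝ)} (hσ : σ ∈ S) :
    ∃ x ∈ σ, ∀ F : PointedCone ℝ (Fin n → ℝ), F.IsFaceOf σ → x ∈ F → σ ≤ F := by
  obtain ⟨G, hG, rfl, -⟩ := hS.exists_generators hσ
  refine ⟨∑ g ∈ hG.toFinset, g, sum_mem fun g hg => PointedCone.subset_hull (by simpa using hg),
    fun F hF hx => Submodule.span_le.2 fun g hg => ?_⟩
  have hg' : g ∈ hG.toFinset := by simpa using hg
  rw [← Finset.add_sum_erase _ _ hg'] at hx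
  refine hF.mem_of_add_mem_left (PointedCone.subset_hull hg)
    (sum_mem fun j hj => PointedCone.subset_hull ?_) hx
  simpa using Finset.mem_of_mem_erase hj

/-- A relative interior point of a cone of `S'` lies in some cone of `S`. The two cones meet in a
face, which must be the whole first cone; this is then a face of a cone of `S`. -/
theorem IsFan.subset_of_isComplete {S' : Set (PointedCone ℝ (Fin n → ℝ))} (hS : IsFan S)
    (hc : IsComplete S) (hS' : IsFan S') (h : S ⊆ S') : S' ⊆ S := by
  intro σ hσ
  obtain ⟨x, hx, hmin⟩ := hS'.exists_mem_interior hσ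
  have : x ∈ support S := by
    have : support S = Set.univ := hc
    rw [this]; trivial
  obtain ⟨τ, hτ, hxτ⟩ := mem_support.1 this
  have hf := hS'.inter_face σ hσ τ (h hτ)
  have hle : σ ≤ τ := (hmin _ hf.1 ⟨hx, hxτ⟩).trans inf_le_right
  refine hS.face_mem τ hτ σ ?_
  have := hf.2
  rwa [inf_eq_left.2 hle] at this

theorem IsFan.isMaximalFan_of_isComplete {R : Set (PointedCone ℝ (Fin n → ℝ))} (hS : IsFan S)
    (hR : fanRays S ⊆ R) (hc : IsComplete S) : IsMaximalFan R S :=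
  ⟨⟨hS, hR⟩, fun _ hS' h => hS.subset_of_isComplete hc hS'.1 h⟩

/-- Adding one cone to a fan. -/
theorem IsFan.insert_cone (hS : IsFan S) {C : PointedCone ℝ (Fin n → ℝ)} (hrat : IsRationalPolyhedral C)
    (hsal : (C : ConvexCone ℝ (Fin n → ℝ)).Salient)
    (hfaces : ∀ F : PointedCone ℝ (Fin n → ℝ), F.IsFaceOf C → F ≠ C → F ∈ S)
    (hint : ∀ σ ∈ S, ∃ F ∈ S, F.IsFaceOf C ∧ σ ⊓ C ≤ F) : IsFan (insert C S) := by
  have key : ∀ σ ∈ S, (σ ⊓ C).IsFaceOf σ ∧ (σ ⊓ C).IsFaceOf C := by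
    intro σ hσ
    obtain ⟨F, hF, hFC, hle⟩ := hint σ hσ
    have : σ ⊓ C = σ ⊓ F :=
      le_antisymm (le_inf inf_le_left hle) (inf_le_inf_left _ hFC.le)
    rw [this]
    exact ⟨(hS.inter_face σ hσ F hF).1, (hS.inter_face σ hσ F hF).2.trans hFC⟩
  refine ⟨hS.finite.insert _, ⟨C, by simp⟩, ?_, ?_, ?_, ?_⟩
  · rintro σ (rfl | hσ)
    exacts [hrat, hS.rational σ hσ]
  · rintro σ (rfl | hσ)
    exacts [hsal, hS.strictlyConvex σ hσ]
  · rintro σ (rfl | hσ) τ hτ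
    · by_cases h : τ = σ
      exacts [Or.inl h, Or.inr (hfaces τ hτ h)]
    · exact Or.inr (hS.face_mem σ hσ τ hτ)
  · rintro σ (rfl | hσ) τ (rfl | hτ)
    · simp
    · rw [inf_comm]; exact (key τ hτ).symm
    · exact key σ hσ
    · exact hS.inter_face σ hσ τ hτ

end Fans

/-! ### Simplicial cones and their insertion into a fan. -/

section Simplicial

variable {n : ℕ} {ι : Type*} [Fintype ι]

theorem mem_hull_image_compl {V : Type*} [AddCommGroup V] [Module ℝ V] {g : ι → V} {i : ι} {x : V} :
    x ∈ PointedCone.hull ℝ (g '' {i}ᶜ) ↔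
      ∃ c : ι → ℝ, (∀ j, 0 ≤ c j) ∧ c i = 0 ∧ x = ∑ j, c j • g j := by
  classical
  constructor
  · intro hx
    induction hx using Submodule.span_induction with
    | mem x hx =>
      obtain ⟨j, hj, rfl⟩ := hx
      refine ⟨Pi.single j 1, fun k => ?_, ?_, ?_⟩
      · by_cases h : k = j
        · subst h; simp
        · simp [h]
      · have : i ≠ j := fun h => hj h.symm
        simp [this]
      · rw [Finset.sum_eq_single j] <;> simp +contextual
    | zero => exact ⟨0, by simp, by simp, by simp⟩
    | add x y hx hy ihx ihy =>
      obtain ⟨c, hc, hci, rfl⟩ := ihx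
      obtain ⟨d, hd, hdi, rfl⟩ := ihy
      exact ⟨c + d, fun j => add_nonneg (hc j) (hd j), by simp [hci, hdi],
        by simp [add_smul, Finset.sum_add_distrib]⟩
    | smul a x hx ih =>
      obtain ⟨c, hc, hci, rfl⟩ := ih
      refine ⟨fun j => a * c j, fun j => mul_nonneg a.2 (hc j), by simp [hci], ?_⟩
      rw [Finset.smul_sum]
      exact Finset.sum_congr rfl fun j _ => (mul_smul (a : ℝ) (c j) (g j)).symm
  · rintro ⟨c, hc, hci, rfl⟩
    refine sum_mem fun j _ => ?_
    by_cases h : j = i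
    · subst h; simp [hci]
    · exact PointedCone.smul_mem _ (hc j) (PointedCone.subset_hull ⟨j, h, rfl⟩)

variable {V : Type*} [AddCommGroup V] [Module ℝ V] {g : ι → V}

theorem hull_image_compl_isFaceOf (hg : LinearIndependent ℝ g) (i : ι) :
    (PointedCone.hull ℝ (g '' {i}ᶜ)).IsFaceOf (PointedCone.hull ℝ (Set.range g)) := by
  refine isFaceOf_of_add_mem (Submodule.span_mono (Set.image_subset_range _ _)) ?_
  intro x hx y hy hxy
  obtain ⟨c, hc, rfl⟩ := mem_hull_range.1 hx
  obtain ⟨d, hd, rfl⟩ := mem_hull_range.1 hy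
  obtain ⟨e, he, hei, h⟩ := mem_hull_image_compl.1 hxy
  refine mem_hull_image_compl.2 ⟨c, hc, ?_, rfl⟩
  have h0 : ∑ j, (c j + d j - e j) • g j = 0 := by
    simp only [sub_smul, add_smul, Finset.sum_sub_distrib, Finset.sum_add_distrib]
    rw [h, sub_self]
  have := Fintype.linearIndependent_iff.1 hg _ h0 i
  linarith [hc i, hd i]

/-- For each `i` take a point of `D` off the facet opposite to `g i`, and add these points up. -/
theorem exists_pos_of_not_le {D : PointedCone ℝ V} (hD : D ≤ PointedCone.hull ℝ (Set.range g))
    (h : ∀ i, ¬ D ≤ PointedCone.hull ℝ (g '' {i}ᶜ)) :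
    ∃ c : ι → ℝ, (∀ i, 0 < c i) ∧ ∑ i, c i • g i ∈ D := by
  have : ∀ i, ∃ c : ι → ℝ, (∀ j, 0 ≤ c j) ∧ 0 < c i ∧ ∑ j, c j • g j ∈ D := by
    intro i
    obtain ⟨x, hx, hxi⟩ := Set.not_subset.1 (h i)
    obtain ⟨c, hc, rfl⟩ := mem_hull_range.1 (hD hx)
    refine ⟨c, hc, lt_of_le_of_ne (hc i) fun h0 => hxi ?_, hx⟩
    exact mem_hull_image_compl.2 ⟨c, hc, h0.symm, rfl⟩
  choose c hc hci hcD using this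
  refine ⟨fun j => ∑ i, c i j, fun j => ?_, ?_⟩
  · exact Finset.sum_pos' (fun i _ => hc i j) ⟨j, Finset.mem_univ _, hci j⟩
  · have : ∑ j, (∑ i, c i j) • g j = ∑ i, ∑ j, c i j • g j := by
      rw [Finset.sum_comm]; simp only [Finset.sum_smul]
    rw [this]
    exact sum_mem fun i _ => hcD i

theorem salient_hull_range (hg : LinearIndependent ℝ g) :
    (PointedCone.hull ℝ (Set.range g) : ConvexCone ℝ V).Salient := by
  intro x hx hx0 hx'
  obtain ⟨c, hc, rfl⟩ := mem_hull_range.1 hx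
  obtain ⟨d, hd, h⟩ := mem_hull_range.1 hx'
  apply hx0
  have h0 : ∑ j, (c j + d j) • g j = 0 := by
    simp only [add_smul, Finset.sum_add_distrib]
    rw [← h, add_neg_cancel]
  refine Finset.sum_eq_zero fun j _ => ?_
  have := Fintype.linearIndependent_iff.1 hg _ h0 j
  have : c j = 0 := by linarith [hc j, hd j]
  simp [this]

/-- Adding to a fan a simplicial cone whose facets belong to the fan and whose relative interior
is not met by the fan. -/
theorem IsFan.insert_simplicial {S : Set (PointedCone ℝ (Fin n → ℝ))} (hS : IsFan S)
    {g : ι → Fin n → ℤ} (hg : LinearIndependent ℝ fun i => intVec (g i))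
    (hfac : ∀ i, PointedCone.hull ℝ ((fun i => intVec (g i)) '' {i}ᶜ) ∈ S)
    (hdisj : ∀ c : ι → ℝ, (∀ i, 0 < c i) → ∑ i, c i • intVec (g i) ∉ support S) :
    IsFan (insert (PointedCone.hull ℝ (Set.range fun i => intVec (g i))) S) := by
  refine hS.insert_cone ⟨Set.range g, Set.finite_range g, by rw [← Set.range_comp]; rfl⟩
    (salient_hull_range hg) (fun F hF hne => ?_) fun σ hσ => ?_
  · have : ∃ i, F ≤ PointedCone.hull ℝ ((fun i => intVec (g i)) '' {i}ᶜ) := by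
      by_contra hcon
      push Not at hcon
      obtain ⟨c, hc, hcF⟩ := exists_pos_of_not_le hF.le hcon
      refine hne (le_antisymm hF.le (Submodule.span_le.2 ?_))
      rintro _ ⟨i, rfl⟩
      exact hF.mem_of_sum_smul_mem (fun j => PointedCone.subset_hull ⟨j, rfl⟩)
        (fun j => (hc j).le) hcF i (hc i)
    obtain ⟨i, hi⟩ := this
    exact hS.face_mem _ (hfac i) _
      ((PointedCone.IsFaceOf.isFaceOf_iff_le hF (hull_image_compl_isFaceOf hg i)).2 hi)
  · have : ∃ i, σ ⊓ PointedCone.hull ℝ (Set.range fun i => intVec (g i)) ≤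
        PointedCone.hull ℝ ((fun i => intVec (g i)) '' {i}ᶜ) := by
      by_contra hcon
      push Not at hcon
      obtain ⟨c, hc, hcF⟩ := exists_pos_of_not_le inf_le_right hcon
      exact hdisj c hc (mem_support.2 ⟨σ, hσ, hcF.1⟩)
    obtain ⟨i, hi⟩ := this
    exact ⟨_, hfac i, hull_image_compl_isFaceOf hg i, hi⟩

end Simplicial

/-! ### Maximal and saturated fans. -/

section Extension

variable {n : ℕ} {R S : Set (PointedCone ℝ (Fin n → ℝ))}

/-- A cone is determined by the members of `R` below it, so a finite `R` admits only finitely many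
fans and maximal ones exist. -/
theorem IsFan.eq_sSup (hS : IsFan S) (hR : fanRays S ⊆ R) {σ : PointedCone ℝ (Fin n → ℝ)}
    (hσ : σ ∈ S) : σ = sSup {ρ ∈ R | ρ ≤ σ} := by
  apply le_antisymm _ (sSup_le fun ρ hρ => hρ.2)
  obtain ⟨G, -, h, hG⟩ := hS.exists_generators hσ
  have hGσ : ∀ g ∈ G, g ∈ σ := fun g hg => h ▸ PointedCone.subset_hull hg
  conv_lhs => rw [h]
  refine Submodule.span_le.2 fun g hg => ?_
  have hmem : PointedCone.hull ℝ {g} ∈ {ρ ∈ R | ρ ≤ σ} :=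
    ⟨hR (hG g hg).mem_fanRays, Submodule.span_le.2 (by simpa using hGσ g hg)⟩
  exact le_sSup hmem (mem_hull_self g)

theorem finite_setOf_isFan (hR : R.Finite) : {S | IsFan S ∧ fanRays S ⊆ R}.Finite := by
  refine (hR.finite_subsets.image sSup).finite_subsets.subset ?_
  intro S hS σ hσ
  exact ⟨{ρ ∈ R | ρ ≤ σ}, fun ρ hρ => hρ.1, (hS.1.eq_sSup hS.2 hσ).symm⟩

/-- Every fan with a given property extends to one that is maximal among the fans with that
property and with rays in a given finite set. -/
theorem IsFan.exists_maximal (hR : R.Finite) (hS : IsFan S) (hSR : fanRays S ⊆ R)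
    (P : Set (PointedCone ℝ (Fin n → ℝ)) → Prop) (hP : P S) :
    ∃ S', S ⊆ S' ∧ Maximal (fun S' => (IsFan S' ∧ fanRays S' ⊆ R) ∧ P S') S' :=
  have hfin : {S' | (IsFan S' ∧ fanRays S' ⊆ R) ∧ P S'}.Finite :=
    (finite_setOf_isFan hR).subset fun _ h => h.1
  hfin.exists_le_maximal ⟨⟨hS, hSR⟩, hP⟩

/-- A fan with rays in `R` to which no simplicial cone can be added without leaving the class of
fans with rays in `R`. -/
structure IsSaturated (R S : Set (PointedCone ℝ (Fin n → ℝ))) : Prop where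
  isFan : IsFan S
  fanRays_subset : fanRays S ⊆ R
  mem_of_insert : ∀ {k : ℕ} (g : Fin k → Fin n → ℤ), LinearIndependent ℝ (fun i => intVec (g i)) →
    IsFan (insert (PointedCone.hull ℝ (Set.range fun i => intVec (g i))) S) →
    fanRays (insert (PointedCone.hull ℝ (Set.range fun i => intVec (g i))) S) ⊆ R →
    PointedCone.hull ℝ (Set.range fun i => intVec (g i)) ∈ S

theorem IsMaximalFan.isSaturated (h : IsMaximalFan R S) : IsSaturated R S where
  isFan := h.prop.1
  fanRays_subset := h.prop.2
  mem_of_insert _ _ h1 h2 := h.le_of_ge ⟨h1, h2⟩ (Set.subset_insert _ _) (Set.mem_insert _ _)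

theorem isSimplicial_hull_range {ι : Type*} [Fintype ι] {g : ι → Fin n → ℝ}
    (hg : LinearIndependent ℝ g) : (PointedCone.hull ℝ (Set.range g)).IsSimplicial :=
  .hull (Set.finite_range g) hg.linearIndepOn_id

/-- Saturation tests only simplicial cones, whose insertion keeps a simplicial fan simplicial.
Maximality among simplicial fans is therefore enough. -/
theorem isSaturated_of_maximal_isSimplicial
    (h : Maximal (fun S' => (IsFan S' ∧ fanRays S' ⊆ R) ∧ IsSimplicial S') S) :
    IsSaturated R S where
  isFan := h.prop.1.1
  fanRays_subset := h.prop.1.2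
  mem_of_insert g hg h1 h2 := by
    refine h.le_of_ge ⟨⟨h1, h2⟩, ?_⟩ (Set.subset_insert _ _) (Set.mem_insert _ _)
    rintro σ (rfl | hσ)
    exacts [isSimplicial_hull_range hg, h.prop.2 σ hσ]

/-- The new cone can contribute a new ray only if it is itself one-dimensional, whence the condition
for `k = 1`. -/
theorem IsSaturated.mem (h : IsSaturated R S) {k : ℕ} {g : Fin k → Fin n → ℤ}
    (hg : LinearIndependent ℝ fun i => intVec (g i))
    (hfac : ∀ i, PointedCone.hull ℝ ((fun i => intVec (g i)) '' {i}ᶜ) ∈ S)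
    (hdisj : ∀ c : Fin k → ℝ, (∀ i, 0 < c i) → ∑ i, c i • intVec (g i) ∉ support S)
    (hR : k = 1 → PointedCone.hull ℝ (Set.range fun i => intVec (g i)) ∈ R) :
    PointedCone.hull ℝ (Set.range fun i => intVec (g i)) ∈ S := by
  refine h.mem_of_insert g hg (h.isFan.insert_simplicial hg hfac hdisj) ?_
  rintro σ ⟨rfl | hσ, hd⟩
  · rw [coneDim_hull, finrank_span_eq_card hg, Fintype.card_fin] at hd
    exact hR hd
  · exact h.fanRays_subset ⟨hσ, hd⟩

end Extension

/-! ### Linear coordinates in ℝ³. -/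

section Frames

/-- Linear coordinates with respect to three linearly independent vectors of `ℝ³`. -/
structure Frame (u v w : Fin 3 → ℝ) where
  (A B C : (Fin 3 → ℝ) →ₗ[ℝ] ℝ)
  eq : ∀ x, x = A x • u + B x • v + C x • w
  A_u : A u = 1
  A_v : A v = 0
  A_w : A w = 0
  B_u : B u = 0
  B_v : B v = 1
  B_w : B w = 0
  C_u : C u = 0
  C_v : C v = 0
  C_w : C w = 1

attribute [simp] Frame.A_u Frame.A_v Frame.A_w Frame.B_u Frame.B_v Frame.B_w
  Frame.C_u Frame.C_v Frame.C_w

/-- Three vectors are linearly independent. -/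
def Indep (u v w : Fin 3 → ℝ) : Prop :=
  ∀ a b c : ℝ, a • u + b • v + c • w = 0 → a = 0 ∧ b = 0 ∧ c = 0

variable {u v w : Fin 3 → ℝ}

theorem Indep.linearIndependent (h : Indep u v w) : LinearIndependent ℝ ![u, v, w] := by
  rw [Fintype.linearIndependent_iff]
  intro g hg
  simp only [Fin.sum_univ_three, Matrix.cons_val_zero, Matrix.cons_val_one, Matrix.cons_val] at hg
  obtain ⟨h0, h1, h2⟩ := h _ _ _ hg
  intro i; fin_cases i <;> assumption

theorem Indep.nonempty_frame (h : Indep u v w) : Nonempty (Frame u v w) := by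
  let b : Module.Basis (Fin 3) ℝ (Fin 3 → ℝ) :=
    basisOfLinearIndependentOfCardEqFinrank h.linearIndependent (by simp)
  have hb : ⇑b = ![u, v, w] := coe_basisOfLinearIndependentOfCardEqFinrank _ _
  have h0 : b 0 = u := by rw [hb]; rfl
  have h1 : b 1 = v := by rw [hb]; rfl
  have h2 : b 2 = w := by rw [hb]; rfl
  refine ⟨⟨b.coord 0, b.coord 1, b.coord 2, fun x => ?_, ?_, ?_, ?_, ?_, ?_, ?_, ?_, ?_, ?_⟩⟩
  · have := b.sum_repr x
    rw [Fin.sum_univ_three, h0, h1, h2] at this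
    exact this.symm
  all_goals simp [← h0, ← h1, ← h2]

theorem Frame.indep (f : Frame u v w) : Indep u v w := by
  intro a b c h
  have hA := congrArg f.A h
  have hB := congrArg f.B h
  have hC := congrArg f.C h
  simp at hA hB hC
  exact ⟨hA, hB, hC⟩

theorem Indep.swap (h : Indep u v w) : Indep v u w := fun a b c hc => by
  obtain ⟨h1, h2, h3⟩ := h b a c (by rw [← hc]; module)
  exact ⟨h2, h1, h3⟩

theorem Indep.rotate (h : Indep u v w) : Indep v w u := fun a b c hc => by
  obtain ⟨h1, h2, h3⟩ := h c a b (by rw [← hc]; module)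
  exact ⟨h2, h3, h1⟩

end Frames

/-! ### Adding cones on vertices; smallest cones and chords. -/

section Additions

variable {n : ℕ} {R S : Set (PointedCone ℝ (Fin n → ℝ))}

theorem hull_image_smul {V ι : Type*} [AddCommGroup V] [Module ℝ V] {t : ι → ℝ}
    (ht : ∀ i, 0 < t i) (h : ι → V) (s : Set ι) :
    PointedCone.hull ℝ ((fun i => t i • h i) '' s) = PointedCone.hull ℝ (h '' s) := by
  apply le_antisymm
  · refine Submodule.span_le.2 ?_
    rintro _ ⟨i, hi, rfl⟩
    exact PointedCone.smul_mem _ (ht i).le (PointedCone.subset_hull ⟨i, hi, rfl⟩)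
  · refine Submodule.span_le.2 ?_
    rintro _ ⟨i, hi, rfl⟩
    exact (PointedCone.smul_mem_iff _ (ht i)).1 (PointedCone.subset_hull ⟨i, hi, rfl⟩)

theorem exists_smul_eq_of_hull_eq {V : Type*} [AddCommGroup V] [Module ℝ V] {g h : V} (hg : g ≠ 0)
    (heq : PointedCone.hull ℝ {g} = PointedCone.hull ℝ {h}) : ∃ t : ℝ, 0 < t ∧ g = t • h := by
  obtain ⟨t, ht, hgt⟩ := mem_hull_singleton.1 (heq ▸ mem_hull_self g)
  refine ⟨t, lt_of_le_of_ne ht ?_, hgt⟩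
  rintro rfl
  exact hg (by simpa using hgt)

theorem IsVertex.exists_intVec (hS : IsFan S) {g : Fin n → ℝ} (hg : IsVertex S g) :
    ∃ (t : ℝ) (z : Fin n → ℤ), 0 < t ∧ g = t • intVec z := by
  obtain ⟨s, hs, h⟩ := hS.rational _ hg.2
  have hsal := hS.strictlyConvex _ hg.2
  have hdim := coneDim_hull_singleton hg.1
  rw [h] at hsal hdim
  obtain ⟨_, ⟨z, hz, rfl⟩, hz0, heq⟩ := exists_eq_hull_singleton hsal hdim
  obtain ⟨t, ht, hgt⟩ := exists_smul_eq_of_hull_eq hg.1 (h.trans heq)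
  exact ⟨t, z, ht, hgt⟩

/-- Saturation speaks of lattice generators while the geometry below yields real vectors, so each
generator is rescaled to a lattice vector on its ray. -/
theorem IsSaturated.mem_of_vertices (h : IsSaturated R S) {k : ℕ} (hk : k ≠ 1)
    {g : Fin k → Fin n → ℝ} (hv : ∀ i, IsVertex S (g i)) (hg : LinearIndependent ℝ g)
    (hfac : ∀ i, PointedCone.hull ℝ (g '' {i}ᶜ) ∈ S)
    (hdisj : ∀ c : Fin k → ℝ, (∀ i, 0 < c i) → ∑ i, c i • g i ∉ support S) :
    PointedCone.hull ℝ (Set.range g) ∈ S := by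
  choose t z ht hz using fun i => (hv i).exists_intVec h.isFan
  obtain rfl : g = fun i => t i • intVec (z i) := funext hz
  rw [← Set.image_univ, hull_image_smul ht, Set.image_univ]
  refine h.mem ?_ (fun i => ?_) (fun c hc hmem => ?_) fun h1 => absurd h1 hk
  · have := hg.units_smul fun i => (Units.mk0 (t i) (ht i).ne')⁻¹
    convert this using 1
    funext i
    simp [Units.smul_def, (ht i).ne']
  · rw [← hull_image_smul ht]; exact hfac i
  · have hsum : ∑ i, (c i / t i) • (t i • intVec (z i)) = ∑ i, c i • intVec (z i) :=
      Finset.sum_congr rfl fun i _ => by rw [smul_smul, div_mul_cancel₀ _ (ht i).ne']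
    exact hdisj (fun i => c i / t i) (fun i => div_pos (hc i) (ht i)) (hsum ▸ hmem)

theorem IsSaturated.hull_pair_mem (h : IsSaturated R S) {a b : Fin n → ℝ} (ha : IsVertex S a)
    (hb : IsVertex S b) (hab : ∀ s t : ℝ, s • a + t • b = 0 → s = 0 ∧ t = 0)
    (hdisj : ∀ α β : ℝ, 0 < α → 0 < β → α • a + β • b ∉ support S) :
    PointedCone.hull ℝ {a, b} ∈ S := by
  have := h.mem_of_vertices (k := 2) (by norm_num) (g := ![a, b])
    (by intro i; fin_cases i <;> assumption) (LinearIndependent.pair_iff.2 hab) ?_ ?_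
  · simpa [Set.pair_comm] using this
  · intro i
    fin_cases i
    · have : ({0}ᶜ : Set (Fin 2)) = {1} := by ext j; fin_cases j <;> simp
      simpa [this] using hb.2
    · have : ({1}ᶜ : Set (Fin 2)) = {0} := by ext j; fin_cases j <;> simp
      simpa [this] using ha.2
  · intro c hc
    simpa using hdisj _ _ (hc 0) (hc 1)

/-- Every positive multiple of a vertex is a vertex; one representative per ray makes minima and
counting available. -/
theorem IsFan.exists_representatives (hS : IsFan S) : ∃ W : Set (Fin n → ℝ), W.Finite ∧
    (∀ w ∈ W, IsVertex S w) ∧ ∀ g, IsVertex S g → ∃ w ∈ W, ∃ t : ℝ, 0 < t ∧ g = t • w := by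
  classical
  have hex : ∀ σ ∈ {σ ∈ S | ∃ g, IsVertex S g ∧ σ = PointedCone.hull ℝ {g}},
      ∃ g, IsVertex S g ∧ σ = PointedCone.hull ℝ {g} := fun σ hσ => hσ.2
  choose! f hf using hex
  refine ⟨f '' {σ ∈ S | ∃ g, IsVertex S g ∧ σ = PointedCone.hull ℝ {g}},
    (hS.finite.subset fun _ h => h.1).image f, ?_, fun g hg => ?_⟩
  · rintro _ ⟨σ, hσ, rfl⟩
    exact (hf σ hσ).1
  · have hmem : PointedCone.hull ℝ {g} ∈
        {σ ∈ S | ∃ g, IsVertex S g ∧ σ = PointedCone.hull ℝ {g}} := ⟨hg.2, g, hg, rfl⟩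
    exact ⟨_, ⟨_, hmem, rfl⟩, exists_smul_eq_of_hull_eq hg.1 (hf _ hmem).2⟩

theorem nonpos_of_mem_hull {V : Type*} [AddCommGroup V] [Module ℝ V] {G : Set V} (f : V →ₗ[ℝ] ℝ)
    (h : ∀ g ∈ G, f g ≤ 0) {x : V} (hx : x ∈ PointedCone.hull ℝ G) : f x ≤ 0 := by
  induction hx using Submodule.span_induction with
  | mem x hx => exact h x hx
  | zero => simp
  | add x y _ _ ihx ihy => rw [map_add]; linarith
  | smul a x _ ih =>
    have : f (a • x) = a * f x := f.map_smul (a : ℝ) x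
    rw [this]
    exact mul_nonpos_of_nonneg_of_nonpos a.2 ih

/-- `τ` is the smallest cone of the fan that contains `x`. -/
structure IsCarrier (S : Set (PointedCone ℝ (Fin n → ℝ))) (x : Fin n → ℝ)
    (τ : PointedCone ℝ (Fin n → ℝ)) : Prop where
  mem : τ ∈ S
  self_mem : x ∈ τ
  le : ∀ σ ∈ S, x ∈ σ → τ ≤ σ
  sub_mem : ∀ u ∈ τ, ∃ k : ℝ, 0 ≤ k ∧ k • x - u ∈ τ

theorem IsFan.exists_isCarrier (hS : IsFan S) {x : Fin n → ℝ} (hx : x ∈ support S) :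
    ∃ τ, IsCarrier S x τ := by
  obtain ⟨τ, h1, h2, h3, h4⟩ := hS.exists_carrier hx
  exact ⟨τ, h1, h2, h3, h4⟩

theorem IsCarrier.isVertex (hS : IsFan S) {x : Fin n → ℝ} {τ : PointedCone ℝ (Fin n → ℝ)}
    (hτ : IsCarrier S x τ) (hx : x ≠ 0) (h : ∀ u ∈ τ, ∃ t : ℝ, u = t • x) : IsVertex S x := by
  refine ⟨hx, ?_⟩
  convert hτ.mem
  apply le_antisymm (Submodule.span_le.2 (by simpa using hτ.self_mem))
  intro u hu
  obtain ⟨t, rfl⟩ := h u hu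
  refine mem_hull_singleton.2 ⟨t, ?_, rfl⟩
  by_contra ht
  push Not at ht
  refine hx (eq_zero_of_salient (hS.strictlyConvex _ hτ.mem) hτ.self_mem ?_)
  rw [← PointedCone.smul_mem_iff _ (neg_pos.2 ht)]
  simpa using hu

/-- Two points of the support of a fan between which there is no point of the support. -/
structure IsChord (S : Set (PointedCone ℝ (Fin n → ℝ))) (p q : Fin n → ℝ) : Prop where
  left_mem : p ∈ support S
  right_mem : q ∈ support S
  notMem : ∀ α β : ℝ, 0 < α → 0 < β → α • p + β • q ∉ support S

variable {p q : Fin n → ℝ}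

theorem IsChord.symm (h : IsChord S p q) : IsChord S q p :=
  ⟨h.right_mem, h.left_mem, fun α β hα hβ => by rw [add_comm]; exact h.notMem β α hβ hα⟩

theorem IsChord.right_ne_zero (h : IsChord S p q) : q ≠ 0 := by
  rintro rfl
  exact h.notMem 1 1 one_pos one_pos (by simpa using h.left_mem)

theorem IsChord.indep (hS : IsFan S) (h : IsChord S p q) (s t : ℝ) (hst : s • p + t • q = 0) :
    s = 0 ∧ t = 0 := by
  by_cases hs : s = 0
  · subst hs
    rw [zero_smul, zero_add, smul_eq_zero] at hst
    exact ⟨rfl, hst.resolve_right h.right_ne_zero⟩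
  · exfalso
    have hp : p = (-(t / s)) • q := by
      have : p = s⁻¹ • (s • p + t • q) - (t / s) • q := by
        rw [smul_add, smul_smul, smul_smul, inv_mul_cancel₀ hs]
        module
      rw [this, hst]; module
    rcases lt_or_ge (-(t / s)) 0 with h0 | h0
    · refine h.notMem 1 (t / s) one_pos (by linarith) ?_
      have : (1 : ℝ) • p + (t / s) • q = 0 := by rw [hp]; module
      rw [this]; exact hS.zero_mem_support
    · refine h.notMem 1 1 one_pos one_pos ?_
      have : (1 : ℝ) • p + (1 : ℝ) • q = (1 + -(t / s)) • q := by rw [hp]; module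
      rw [this]; exact smul_mem_support h.right_mem (by linarith)

/-- Adding a large multiple of `q` to `x - y` leads back into `τ`, because `q` dominates `y` there.
With `0 < c` this would put a point between `p` and `q` into the support. -/
theorem IsCarrier.le_zero_of_sub_eq {τ : PointedCone ℝ (Fin n → ℝ)} (h : IsChord S p q)
    (hτ : IsCarrier S q τ) {x y : Fin n → ℝ} (hx : x ∈ τ) (hy : y ∈ τ) {c d : ℝ}
    (hxy : x - y = c • p + d • q) : c ≤ 0 := by
  by_contra hc
  push Not at hc
  obtain ⟨k, hk, hky⟩ := hτ.sub_mem y hy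
  refine h.notMem c (d + k + |d| + 1) hc (by linarith [neg_abs_le d]) (mem_support.2 ⟨τ, hτ.mem, ?_⟩)
  have : c • p + (d + k + |d| + 1) • q = x + (k • q - y) + (|d| + 1) • q := by
    have : c • p = x - y - d • q := by rw [hxy]; module
    rw [this]; module
  rw [this]
  exact add_mem (add_mem hx hky) (PointedCone.smul_mem _ (by positivity) hτ.self_mem)

theorem IsSaturated.not_isVertex (h : IsSaturated R S) (hc : IsChord S p q) (hp : IsVertex S p) :
    ¬ IsVertex S q := fun hq =>
  hc.notMem 1 1 one_pos one_pos (mem_support.2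
    ⟨_, h.hull_pair_mem hp hq (hc.indep h.isFan) hc.notMem,
      mem_hull_pair.2 ⟨1, 1, zero_le_one, zero_le_one, rfl⟩⟩)

end Additions

/-! ### Triangles whose interior misses the support. -/

section Triangles

variable {R S : Set (PointedCone ℝ (Fin 3 → ℝ))} {a b c : Fin 3 → ℝ}

/-- The support does not meet the interior of the cone over a triangle. -/
def EmptyTriangle (S : Set (PointedCone ℝ (Fin 3 → ℝ))) (a b c : Fin 3 → ℝ) : Prop :=
  ∀ x y z : ℝ, 0 < x → 0 < y → 0 < z → x • a + y • b + z • c ∉ support S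

theorem EmptyTriangle.rotate (h : EmptyTriangle S a b c) : EmptyTriangle S b c a :=
  fun x y z hx hy hz => by
    have : x • b + y • c + z • a = z • a + x • b + y • c := by module
    rw [this]; exact h z x y hz hx hy

theorem IsSaturated.hull_triple_mem (h : IsSaturated R S) (ha : IsVertex S a) (hb : IsVertex S b)
    (hc : IsVertex S c) (hi : Indep a b c) (hab : PointedCone.hull ℝ {a, b} ∈ S)
    (hbc : PointedCone.hull ℝ {b, c} ∈ S) (hca : PointedCone.hull ℝ {c, a} ∈ S)
    (he : EmptyTriangle S a b c) : PointedCone.hull ℝ {a, b, c} ∈ S := by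
  have := h.mem_of_vertices (k := 3) (by norm_num) (g := ![a, b, c])
    (by intro i; fin_cases i <;> assumption) hi.linearIndependent ?_ ?_
  · have h3 : Set.range ![a, b, c] = {a, b, c} := by
      ext x; simp [eq_comm]; tauto
    rwa [h3] at this
  · intro i
    fin_cases i
    · have : ({0}ᶜ : Set (Fin 3)) = {1, 2} := by ext j; fin_cases j <;> simp
      simpa [this, Set.image_pair] using hbc
    · have : ({1}ᶜ : Set (Fin 3)) = {2, 0} := by ext j; fin_cases j <;> simp
      simpa [this, Set.image_pair] using hca
    · have : ({2}ᶜ : Set (Fin 3)) = {0, 1} := by ext j; fin_cases j <;> simp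
      simpa [this, Set.image_pair] using hab
  · intro d hd
    simpa [Fin.sum_univ_three] using he _ _ _ (hd 0) (hd 1) (hd 2)

theorem mem_of_forall_add_smul_mem {n : ℕ} {C : Set (Fin n → ℝ)} (hC : IsClosed C)
    {x z : Fin n → ℝ} (h : ∀ ε : ℝ, 0 < ε → x + ε • z ∈ C) : x ∈ C := by
  have ht : Filter.Tendsto (fun ε : ℝ => x + ε • z) (nhdsWithin 0 (Set.Ioi 0)) (nhds x) := by
    have : Filter.Tendsto (fun ε : ℝ => x + ε • z) (nhds 0) (nhds (x + (0 : ℝ) • z)) :=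
      (by fun_prop : Continuous fun ε : ℝ => x + ε • z).tendsto 0
    rw [zero_smul, add_zero] at this
    exact this.mono_left nhdsWithin_le_nhds
  exact hC.mem_of_tendsto ht (Filter.eventually_of_mem self_mem_nhdsWithin fun ε hε => h ε hε)

/-- If every point of a cone `σ` that lies in an open set has `σ` as its smallest face, then `σ`
contains with `z` all points of its span that can be reached from `z` inside the open set. -/
theorem mem_of_segment {n : ℕ} {σ : PointedCone ℝ (Fin n → ℝ)} (hσ : IsClosed (σ : Set (Fin n → ℝ)))
    {z u y : Fin n → ℝ} {s t : ℝ} (hz : z ∈ σ) (hu : u ∈ σ) (hy : y = s • z + t • u)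
    (h : ∀ r : ℝ, 0 ≤ r → r ≤ 1 → z + r • (y - z) ∈ σ →
      ∀ d ∈ σ, ∃ k : ℝ, 0 ≤ k ∧ k • (z + r • (y - z)) - d ∈ σ) : y ∈ σ := by
  have hsub : Set.Icc (0 : ℝ) 1 ⊆ {r | z + r • (y - z) ∈ σ} := by
    apply IsClosed.Icc_subset_of_forall_exists_gt
    · exact (hσ.preimage (by fun_prop : Continuous fun r : ℝ => z + r • (y - z))).inter isClosed_Icc
    · simpa using hz
    · rintro r ⟨hr, hr0, hr1⟩ r' hr'
      -- A large multiple of the current point absorbs the negative part of `y - z = (s - 1) • z + t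
      -- • u`, so the segment continues inside `σ`. The summand `1 / (r' - r)` of `K` keeps the step
      -- `1 / K` below `r' - r`.
      obtain ⟨k, hk, hkd⟩ := h r hr0 hr1.le hr ((|s - 1| - (s - 1)) • z + (|t| - t) • u)
        (add_mem (PointedCone.smul_mem _ (by linarith [le_abs_self (s - 1)]) hz)
          (PointedCone.smul_mem _ (by linarith [le_abs_self t]) hu))
      have hrr : 0 < r' - r := sub_pos.2 hr'
      set K := k + 1 / (r' - r)
      have hK : 0 < K := by positivity
      have hKr : 1 / K ≤ r' - r := by
        rw [div_le_iff₀ hK]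
        have : (r' - r) * K = (r' - r) * k + 1 := by simp only [K]; field_simp
        nlinarith [mul_nonneg hrr.le hk]
      refine ⟨r + 1 / K, ?_, by simp [hK], by linarith⟩
      have hmem : K • (z + r • (y - z)) + (y - z) ∈ σ := by
        have : K • (z + r • (y - z)) + (y - z) =
            (k • (z + r • (y - z)) - ((|s - 1| - (s - 1)) • z + (|t| - t) • u)) +
            ((1 / (r' - r)) • (z + r • (y - z)) + (|s - 1| • z + |t| • u)) := by
          simp only [K, hy]; module
        rw [this]
        exact add_mem hkd (add_mem (PointedCone.smul_mem _ (by positivity) hr)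
          (add_mem (PointedCone.smul_mem _ (abs_nonneg _) hz)
            (PointedCone.smul_mem _ (abs_nonneg _) hu)))
      have : z + (r + 1 / K) • (y - z) = (1 / K) • (K • (z + r • (y - z)) + (y - z)) := by
        rw [smul_add, smul_smul, one_div_mul_cancel hK.ne']; module
      change z + (r + 1 / K) • (y - z) ∈ σ
      rw [this]
      exact PointedCone.smul_mem _ (by positivity) hmem
  have := hsub (Set.right_mem_Icc.2 zero_le_one)
  simpa using this

/-- The interior of a triangle is not met by a fan if it contains no vertex and the cones that
meet it do not reach the two sides at one of the corners. -/
theorem IsFan.emptyTriangle (hS : IsFan S) {v q w : Fin 3 → ℝ} (hi : Indep v q w)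
    (hvert : ∀ x y z : ℝ, 0 < x → 0 < y → 0 < z → ¬ IsVertex S (x • v + y • q + z • w))
    (H : ∀ σ ∈ S, ∀ x y z : ℝ, 0 < x → 0 < y → 0 < z → x • v + y • q + z • w ∈ σ →
      ∀ α β : ℝ, 0 ≤ α → 0 < β → α • v + β • q ∉ σ ∧ β • q + α • w ∉ σ) :
    EmptyTriangle S v q w := by
  intro x y z hx hy hz hmem
  obtain ⟨f⟩ := hi.nonempty_frame
  -- A minimal cone meeting the open triangle is the smallest cone of each of its points there. It
  -- is not a ray, since the interior has no vertex, so it holds two independent vectors and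
  -- contains the whole trace of their plane in the triangle.
  let T : Set (PointedCone ℝ (Fin 3 → ℝ)) :=
    {σ ∈ S | ∃ x, (0 < f.A x ∧ 0 < f.B x ∧ 0 < f.C x) ∧ x ∈ σ}
  obtain ⟨σ₀, hσ₀, hzσ₀⟩ := mem_support.1 hmem
  obtain ⟨σ, hσ⟩ := (hS.finite.subset (fun _ h => h.1) : T.Finite).exists_minimal
    ⟨σ₀, hσ₀, _, ⟨by simpa, by simpa, by simpa⟩, hzσ₀⟩
  obtain ⟨hσS, z, hzpos, hzσ⟩ := hσ.prop
  have hcar : ∀ z' ∈ σ, 0 < f.A z' ∧ 0 < f.B z' ∧ 0 < f.C z' → IsCarrier S z' σ := by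
    intro z' hz' hpos
    obtain ⟨τ, hτ⟩ := hS.exists_isCarrier (mem_support.2 ⟨σ, hσS, hz'⟩)
    have hle := hτ.le σ hσS hz'
    have : τ = σ := le_antisymm hle (hσ.le_of_le ⟨hτ.mem, z', hpos, hτ.self_mem⟩ hle)
    exact this ▸ hτ
  have hz0 : z ≠ 0 := by
    rintro rfl
    simp at hzpos
  obtain ⟨u, hu, hunot⟩ : ∃ u ∈ σ, ∀ t : ℝ, u ≠ t • z := by
    by_contra hcon
    push Not at hcon
    have := (hcar z hzσ hzpos).isVertex hS hz0 hcon
    rw [f.eq z] at this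
    exact hvert _ _ _ hzpos.1 hzpos.2.1 hzpos.2.2 this
  have hpos : ∀ s t : ℝ, 0 < f.A (s • z + t • u) → 0 < f.B (s • z + t • u) →
      0 < f.C (s • z + t • u) → s • z + t • u ∈ σ := by
    intro s t hA hB hC
    refine mem_of_segment (hS.isClosed_cone hσS) hzσ hu rfl fun r hr0 hr1 hr => ?_
    refine (hcar _ hr ?_).sub_mem
    have hconv : ∀ α β : ℝ, 0 < α → 0 < β → 0 < α + r * (β - α) := by
      intro α β hα hβ
      rcases hr0.eq_or_lt with h | h
      · rw [← h]; linarith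
      · nlinarith [mul_pos h hβ, mul_nonneg (sub_nonneg.2 hr1) hα.le]
    simp only [map_add f.A, map_add f.B, map_add f.C, map_sub, map_smul, smul_eq_mul] at hA hB hC ⊢
    exact ⟨hconv _ _ hzpos.1 hA, hconv _ _ hzpos.2.1 hB, hconv _ _ hzpos.2.2 hC⟩
  have hnonneg : ∀ s t : ℝ, 0 ≤ f.A (s • z + t • u) → 0 ≤ f.B (s • z + t • u) →
      0 ≤ f.C (s • z + t • u) → s • z + t • u ∈ σ := by
    intro s t hA hB hC
    refine mem_of_forall_add_smul_mem (hS.isClosed_cone hσS) (z := z) fun ε hε => ?_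
    have : s • z + t • u + ε • z = (s + ε) • z + t • u := by module
    rw [SetLike.mem_coe, this]
    obtain ⟨h1, h2, h3⟩ := hzpos
    simp only [map_add, map_smul, smul_eq_mul] at hA hB hC
    refine hpos _ _ ?_ ?_ ?_ <;> simp only [map_add, map_smul, smul_eq_mul]
    · nlinarith [mul_pos hε h1]
    · nlinarith [mul_pos hε h2]
    · nlinarith [mul_pos hε h3]
  have hH := H σ hσS (f.A z) (f.B z) (f.C z) hzpos.1 hzpos.2.1 hzpos.2.2 (f.eq z ▸ hzσ)
  obtain ⟨h1, h2, h3⟩ := hzpos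
  have hside1 : ∀ s t α β : ℝ, 0 ≤ α → 0 < β → f.A (s • z + t • u) = α → f.B (s • z + t • u) = β →
      f.C (s • z + t • u) = 0 → False := by
    intro s t α β hα hβ hA hB hC
    refine (hH α β hα hβ).1 ?_
    have := hnonneg s t (hA ▸ hα) (hB ▸ hβ.le) hC.ge
    rw [f.eq (s • z + t • u), hA, hB, hC] at this
    simpa using this
  have hside2 : ∀ s t α β : ℝ, 0 ≤ α → 0 < β → f.A (s • z + t • u) = 0 → f.B (s • z + t • u) = β →
      f.C (s • z + t • u) = α → False := by
    intro s t α β hα hβ hA hB hC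
    refine (hH α β hα hβ).2 ?_
    have := hnonneg s t hA.ge (hB ▸ hβ.le) (hC ▸ hα)
    rw [f.eq (s • z + t • u), hA, hB, hC] at this
    simpa using this
  simp only [map_add, map_smul, smul_eq_mul] at hside1 hside2
  set z1 := f.A z
  set z2 := f.B z
  set z3 := f.C z
  set u1 := f.A u with hu1
  set u2 := f.B u with hu2
  set u3 := f.C u with hu3
  -- The coefficients are the cross product of `z` and `u`, the normal of their plane. A line
  -- through the interior meets the side `v w` at most once, so it also leaves through one of the
  -- sides at `q`, at a point other than `v` and `w`; the signs of the normal tell which side.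
  have hrel : (z2 * u3 - z3 * u2) * z1 + (z3 * u1 - z1 * u3) * z2 + (z1 * u2 - z2 * u1) * z3 = 0 := by
    ring
  rcases lt_trichotomy (z3 * u1 - z1 * u3) 0 with h | h | h
  · rcases lt_or_ge 0 (z2 * u3 - z3 * u2) with h' | h'
    · exact hside1 u3 (-z3) (-(z3 * u1 - z1 * u3)) (z2 * u3 - z3 * u2) (by linarith) h'
        (by ring) (by ring) (by ring)
    · have h'' : 0 < z1 * u2 - z2 * u1 := by
        by_contra hcon
        push Not at hcon
        nlinarith [mul_nonneg (neg_nonneg.2 h') h1.le, mul_pos (neg_pos.2 h) h2,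
          mul_nonneg (neg_nonneg.2 hcon) h3.le]
      exact hside2 (-u1) z1 (-(z3 * u1 - z1 * u3)) (z1 * u2 - z2 * u1) (by linarith) h''
        (by ring) (by ring) (by ring)
  · rcases lt_trichotomy (z2 * u3 - z3 * u2) 0 with h' | h' | h'
    · exact hside1 (-u3) z3 0 (-(z2 * u3 - z3 * u2)) le_rfl (by linarith)
        (by linarith) (by ring) (by ring)
    · apply hunot (u3 / z3)
      rw [f.eq u, f.eq z, ← hu1, ← hu2, ← hu3]
      have e1 : u1 = u3 / z3 * z1 := by field_simp; linarith
      have e2 : u2 = u3 / z3 * z2 := by field_simp; linarith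
      have e3 : u3 = u3 / z3 * z3 := by field_simp
      rw [smul_add, smul_add, smul_smul, smul_smul, smul_smul]
      change u1 • v + u2 • q + u3 • w = (u3 / z3 * z1) • v + (u3 / z3 * z2) • q + (u3 / z3 * z3) • w
      rw [← e1, ← e2, ← e3]
    · exact hside1 u3 (-z3) 0 (z2 * u3 - z3 * u2) le_rfl h'
        (by linarith) (by ring) (by ring)
  · rcases lt_or_ge (z2 * u3 - z3 * u2) 0 with h' | h'
    · exact hside1 (-u3) z3 (z3 * u1 - z1 * u3) (-(z2 * u3 - z3 * u2)) h.le (by linarith)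
        (by ring) (by ring) (by ring)
    · have h'' : z1 * u2 - z2 * u1 < 0 := by
        by_contra hcon
        push Not at hcon
        nlinarith [mul_nonneg h' h1.le, mul_pos h h2, mul_nonneg hcon h3.le]
      exact hside2 u1 (-z1) (z3 * u1 - z1 * u3) (-(z1 * u2 - z2 * u1)) h.le (by linarith)
        (by ring) (by ring) (by ring)

end Triangles

/-! ### Edges between vertices, and the exclusion of empty triangles. -/

section Edges

variable {R S : Set (PointedCone ℝ (Fin 3 → ℝ))} {a b c : Fin 3 → ℝ}

/-- The functional `β • f.A - α • f.B` vanishes at the given point and is positive at `a`. Some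
generator is on the positive side, as otherwise all are multiples of the point. It is not strictly
between `a` and `b`, so `a` lies in the cone spanned by it and the point. -/
theorem IsCarrier.left_mem (hS : IsFan S) (hi : Indep a b c) {α β : ℝ} (hα : 0 < α) (hβ : 0 < β)
    {τ : PointedCone ℝ (Fin 3 → ℝ)} (hτ : IsCarrier S (α • a + β • b) τ)
    (hplane : ∀ u ∈ τ, ∃ s t : ℝ, u = s • a + t • b)
    (hno : ∀ s t : ℝ, 0 < s → 0 < t → ¬ IsVertex S (s • a + t • b)) : a ∈ τ := by
  obtain ⟨f⟩ := hi.nonempty_frame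
  obtain ⟨G, -, hG, hGv⟩ := hS.exists_generators hτ.mem
  have hsal := hS.strictlyConvex _ hτ.mem
  have hGτ : ∀ g ∈ G, g ∈ τ := fun g hg => hG ▸ PointedCone.subset_hull hg
  have hy0 : α • a + β • b ≠ 0 := fun h => by
    have := congrArg f.A h
    simp at this
    exact hα.ne' this
  have hex : ∃ g ∈ G, 0 < (β • f.A - α • f.B) g := by
    by_contra hcon
    push Not at hcon
    have hnonpos : ∀ x ∈ τ, (β • f.A - α • f.B) x ≤ 0 := fun x hx =>
      nonpos_of_mem_hull _ hcon (hG ▸ hx)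
    apply hy0
    have hGempty : ∀ g ∈ G, False := by
      intro g hg
      obtain ⟨s, t, rfl⟩ := hplane g (hGτ g hg)
      obtain ⟨k, hk, hkg⟩ := hτ.sub_mem _ (hGτ _ hg)
      have h1 := hnonpos _ (hGτ _ hg)
      have h2 := hnonpos _ hkg
      simp at h1 h2
      have h3 : β * s = α * t := by nlinarith
      have hs : s = t / β * α := by field_simp; linarith
      have ht : t = t / β * β := by field_simp
      have heq : s • a + t • b = (t / β) • (α • a + β • b) := by
        rw [smul_add, smul_smul, smul_smul, ← hs, ← ht]
      rcases lt_or_ge 0 t with h0 | h0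
      · exact hno s t (by rw [hs]; positivity) h0 (hGv _ hg)
      · have h4 : -(s • a + t • b) ∈ τ := by
          have : -(s • a + t • b) = (-t / β) • (α • a + β • b) := by rw [heq]; module
          rw [this]
          exact PointedCone.smul_mem _ (div_nonneg (by linarith) hβ.le) hτ.self_mem
        exact (hGv _ hg).1 (eq_zero_of_salient hsal (hGτ _ hg) h4)
    have : G = ∅ := Set.eq_empty_of_forall_notMem hGempty
    have hm := hτ.self_mem
    rw [hG, this] at hm
    simpa using hm
  obtain ⟨g, hg, hpos⟩ := hex
  obtain ⟨s, t, rfl⟩ := hplane g (hGτ g hg)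
  have hgv := hGv _ hg
  have hgτ := hGτ _ hg
  simp at hpos
  rcases lt_trichotomy t 0 with ht | ht | ht
  · have : (α * (-t) + β * s) • a = (-t) • (α • a + β • b) + β • (s • a + t • b) := by module
    rw [← PointedCone.smul_mem_iff τ (c := α * (-t) + β * s) (by linarith), this]
    exact add_mem (PointedCone.smul_mem _ (by linarith) hτ.self_mem)
      (PointedCone.smul_mem _ hβ.le hgτ)
  · subst ht
    have hs : 0 < s := by
      rw [mul_zero] at hpos
      exact pos_of_mul_pos_right hpos hβ.le
    rw [← PointedCone.smul_mem_iff τ hs]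
    simpa using hgτ
  · exfalso
    have hs : 0 < s := pos_of_mul_pos_right ((mul_pos hα ht).trans hpos) hβ.le
    exact hno s t hs ht hgv

/-- An open edge that misses the support can be added. Otherwise take the smallest cone of a common
point: it cannot reach into the empty triangle, nor, by `IsCarrier.sub_mem`, to the opposite side of
the plane of `a` and `b`. It thus lies in that plane, and since no vertex is in between it is the
cone on `a` and `b`. -/
theorem IsSaturated.hull_pair_mem_of_emptyTriangle (h : IsSaturated R S) (ha : IsVertex S a)
    (hb : IsVertex S b) (hi : Indep a b c) (he : EmptyTriangle S a b c)
    (hno : ∀ s t : ℝ, 0 < s → 0 < t → ¬ IsVertex S (s • a + t • b)) :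
    PointedCone.hull ℝ {a, b} ∈ S := by
  have hS := h.isFan
  obtain ⟨f⟩ := hi.nonempty_frame
  by_cases hd : ∀ α β : ℝ, 0 < α → 0 < β → α • a + β • b ∉ support S
  · refine h.hull_pair_mem ha hb (fun s t hst => ?_) hd
    obtain ⟨h1, h2, -⟩ := hi s t 0 (by rw [hst]; simp)
    exact ⟨h1, h2⟩
  push Not at hd
  obtain ⟨α, β, hα, hβ, hy⟩ := hd
  obtain ⟨τ, hτ⟩ := hS.exists_isCarrier hy
  have hle : ∀ u ∈ τ, f.C u ≤ 0 := by
    intro u hu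
    by_contra hC
    push Not at hC
    set k := |f.A u| / α + |f.B u| / β + 1
    have hk : 0 < k := by positivity
    have hkA : |f.A u| < k * α := by
      have : k * α = |f.A u| + (|f.B u| / β * α + α) := by simp only [k]; field_simp; ring
      rw [this]
      linarith [show 0 < |f.B u| / β * α + α by positivity]
    have hkB : |f.B u| < k * β := by
      have : k * β = |f.B u| + (|f.A u| / α * β + β) := by simp only [k]; field_simp; ring
      rw [this]
      linarith [show 0 < |f.A u| / α * β + β by positivity]
    refine he (k * α + f.A u) (k * β + f.B u) (f.C u) (by linarith [neg_abs_le (f.A u)])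
      (by linarith [neg_abs_le (f.B u)]) hC (mem_support.2 ⟨τ, hτ.mem, ?_⟩)
    have : (k * α + f.A u) • a + (k * β + f.B u) • b + f.C u • c =
        k • (α • a + β • b) + (f.A u • a + f.B u • b + f.C u • c) := by module
    rw [this, ← f.eq u]
    exact add_mem (PointedCone.smul_mem _ hk.le hτ.self_mem) hu
  have hplane : ∀ u ∈ τ, ∃ s t : ℝ, u = s • a + t • b := by
    intro u hu
    obtain ⟨k, hk, hku⟩ := hτ.sub_mem u hu
    have h1 := hle u hu
    have h2 := hle _ hku
    simp at h2
    have h3 : f.C u = 0 := le_antisymm h1 h2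
    refine ⟨f.A u, f.B u, ?_⟩
    conv_lhs => rw [f.eq u]
    rw [h3]; module
  have haτ : a ∈ τ := hτ.left_mem hS hi hα hβ hplane hno
  have hbτ : b ∈ τ := by
    have hτ' : IsCarrier S (β • b + α • a) τ := by rwa [add_comm]
    refine hτ'.left_mem hS hi.swap hβ hα (fun u hu => ?_) fun s t hs ht => ?_
    · obtain ⟨s, t, rfl⟩ := hplane u hu
      exact ⟨t, s, add_comm _ _⟩
    · rw [add_comm]; exact hno t s ht hs
  have hsal := hS.strictlyConvex _ hτ.mem
  have hcoef : ∀ s t : ℝ, s • a + t • b ∈ τ → 0 ≤ s := by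
    intro s t hu
    by_contra hs
    push Not at hs
    rcases lt_or_ge t 0 with ht | ht
    · have h0 : -(s • a + t • b) ∈ τ := by
        have : -(s • a + t • b) = (-s) • a + (-t) • b := by module
        rw [this]
        exact add_mem (PointedCone.smul_mem _ (by linarith) haτ)
          (PointedCone.smul_mem _ (by linarith) hbτ)
      have h1 := congrArg f.A (eq_zero_of_salient hsal hu h0)
      simp at h1
      exact hs.ne h1
    · have hface := hS.hull_singleton_isFaceOf hτ.mem hb hbτ
      have h1 : (-s) • a ∈ PointedCone.hull ℝ {b} := by
        refine hface.mem_of_add_mem_left (PointedCone.smul_mem _ (by linarith) haτ) hu ?_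
        exact mem_hull_singleton.2 ⟨t, ht, by module⟩
      obtain ⟨r, -, hr⟩ := mem_hull_singleton.1 h1
      have h2 := congrArg f.A hr
      simp at h2
      exact hs.ne h2
  have hcoef' : ∀ s t : ℝ, s • a + t • b ∈ τ → 0 ≤ t := by
    intro s t hu
    by_contra ht
    push Not at ht
    have hs := hcoef s t hu
    have hface := hS.hull_singleton_isFaceOf hτ.mem ha haτ
    have h1 : (-t) • b ∈ PointedCone.hull ℝ {a} := by
      refine hface.mem_of_add_mem_left (PointedCone.smul_mem _ (by linarith) hbτ) hu ?_
      exact mem_hull_singleton.2 ⟨s, hs, by module⟩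
    obtain ⟨r, -, hr⟩ := mem_hull_singleton.1 h1
    have h2 := congrArg f.B hr
    simp at h2
    exact ht.ne h2
  have : PointedCone.hull ℝ {a, b} = τ := by
    apply le_antisymm
    · refine Submodule.span_le.2 ?_
      rintro _ (rfl | rfl)
      exacts [haτ, hbτ]
    · intro u hu
      obtain ⟨s, t, rfl⟩ := hplane u hu
      exact mem_hull_pair.2 ⟨s, t, hcoef s t hu, hcoef' s t hu, rfl⟩
  exact this ▸ hτ.mem

/-- In a saturated fan no triangle of vertices has an interior that is missed by the fan. -/
theorem IsSaturated.not_emptyTriangle (h : IsSaturated R S) (ha : IsVertex S a) (hb : IsVertex S b)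
    (hc : IsVertex S c) (hi : Indep a b c) : ¬ EmptyTriangle S a b c := by
  obtain ⟨W, hW, -, hWrep⟩ := h.isFan.exists_representatives
  induction hN : (W ∩ PointedCone.hull ℝ {a, b, c}).ncard using Nat.strong_induction_on
    generalizing a b c with
  | _ N ih =>
  intro he
  -- A vertex inside a side cuts off a smaller triangle, still empty, that has lost the ray of `b`.
  -- By induction the sides contain no such vertex, hence are cones of the fan, and the triangle
  -- itself can be added.
  have key : ∀ {a b c : Fin 3 → ℝ}, IsVertex S a → IsVertex S b → IsVertex S c → Indep a b c →
      (W ∩ PointedCone.hull ℝ {a, b, c}).ncard = N → EmptyTriangle S a b c →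
      ∀ s t : ℝ, 0 < s → 0 < t → ¬ IsVertex S (s • a + t • b) := by
    intro a b c ha hb hc hi hN he s t hs ht hu
    have hi' : Indep a (s • a + t • b) c := by
      intro x y z hxyz
      obtain ⟨h1, h2, h3⟩ := hi (x + y * s) (y * t) z (by rw [← hxyz]; module)
      have hy : y = 0 := by simpa [ht.ne'] using h2
      subst hy
      exact ⟨by simpa using h1, rfl, h3⟩
    refine ih _ ?_ ha hu hc hi' rfl fun x y z hx hy hz => ?_
    · rw [← hN]
      refine Set.ncard_lt_ncard ?_ (hW.inter_of_left _)
      refine ⟨Set.inter_subset_inter_right _ ?_, fun hsub => ?_⟩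
      · refine SetLike.coe_subset_coe.2 (Submodule.span_le.2 ?_)
        rintro _ (rfl | rfl | rfl)
        · exact PointedCone.subset_hull (by simp)
        · exact add_mem (PointedCone.smul_mem _ hs.le (PointedCone.subset_hull (by simp)))
            (PointedCone.smul_mem _ ht.le (PointedCone.subset_hull (by simp)))
        · exact PointedCone.subset_hull (by simp)
      · obtain ⟨w, hw, r, hr, rfl⟩ := hWrep b hb
        have hwm : w ∈ PointedCone.hull ℝ {a, r • w, c} :=
          (PointedCone.smul_mem_iff _ hr).1 (PointedCone.subset_hull (by simp))
        obtain ⟨x, y, z, hx, hy, hz, hxyz⟩ := mem_hull_triple.1 (hsub ⟨hw, hwm⟩).2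
        obtain ⟨h1, h2, h3⟩ := hi (r * (x + y * s)) (r * (y * t) - 1) (r * z) (by
          have : (r * (x + y * s)) • a + (r * (y * t) - 1) • r • w + (r * z) • c =
            r • (x • a + y • (s • a + t • r • w) + z • c) - r • w := by module
          rw [this, ← hxyz, sub_self])
        rcases mul_eq_zero.1 h1 with h1 | h1
        · exact hr.ne' h1
        · have : y * s = 0 := by linarith [mul_nonneg hy hs.le]
          rcases mul_eq_zero.1 this with h4 | h4
          · rw [h4] at h2; norm_num at h2
          · exact hs.ne' h4
    · have : x • a + y • (s • a + t • b) + z • c = (x + y * s) • a + (y * t) • b + z • c := by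
        module
      rw [this]
      exact he _ _ _ (by positivity) (by positivity) hz
  have hrot : ∀ a b c : Fin 3 → ℝ, ({b, c, a} : Set (Fin 3 → ℝ)) = {a, b, c} := by
    intro a b c; ext x; simp; tauto
  have hab := h.hull_pair_mem_of_emptyTriangle ha hb hi he (key ha hb hc hi hN he)
  have hbc := h.hull_pair_mem_of_emptyTriangle hb hc hi.rotate he.rotate
    (key hb hc ha hi.rotate (by rw [hrot, hN]) he.rotate)
  have hca := h.hull_pair_mem_of_emptyTriangle hc ha hi.rotate.rotate he.rotate.rotate
    (key hc ha hb hi.rotate.rotate (by rw [hrot, hrot, hN]) he.rotate.rotate)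
  refine he 1 1 1 one_pos one_pos one_pos (mem_support.2
    ⟨_, h.hull_triple_mem ha hb hc hi hab hbc hca he, ?_⟩)
  exact mem_hull_triple.2 ⟨1, 1, 1, by simp, by simp, by simp, rfl⟩

end Edges

/-! ### Chords that start at a vertex. -/

section Chords

variable {R S : Set (PointedCone ℝ (Fin 3 → ℝ))} {p q a b : Fin 3 → ℝ}
  {τ : PointedCone ℝ (Fin 3 → ℝ)}

/-- `IsFan.emptyTriangle` at the corner `p`. A cone meeting the interior cannot contain `p`: it
would contain `τ`, which absorbs the `a`-part and leaves a point of the chord. If it met the side `p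
a` off `a`, it would contain `p` by the face property. -/
theorem IsChord.emptyTriangle (hS : IsFan S) (hc : IsChord S q p) (hτ : IsCarrier S p τ)
    (ha : a ∈ τ) (hi : Indep q p a)
    (hvert : ∀ x y z : ℝ, 0 < x → 0 < y → 0 < z → ¬ IsVertex S (x • q + y • p + z • a)) :
    EmptyTriangle S q p a := by
  refine hS.emptyTriangle hi hvert fun σ hσ x y z hx hy hz hmem α β hα hβ => ?_
  have hp : p ∉ σ := by
    intro hp
    have hle := hτ.le σ hσ hp
    obtain ⟨k, hk, hka⟩ := hτ.sub_mem a ha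
    refine hc.notMem x (y + z * k) hx (by positivity) (mem_support.2 ⟨σ, hσ, ?_⟩)
    have : x • q + (y + z * k) • p = (x • q + y • p + z • a) + z • (k • p - a) := by module
    rw [this]
    exact add_mem hmem (PointedCone.smul_mem _ hz.le (hle hka))
  constructor
  · intro hmem'
    rcases hα.eq_or_lt with rfl | hα
    · rw [zero_smul, zero_add, PointedCone.smul_mem_iff _ hβ] at hmem'
      exact hp hmem'
    · exact hc.notMem α β hα hβ (mem_support.2 ⟨σ, hσ, hmem'⟩)
  · intro hmem'
    have := hS.mem_of_add_mem hτ.mem hσ (PointedCone.smul_mem _ hβ.le hτ.self_mem)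
      (PointedCone.smul_mem _ hα ha) hmem'
    exact hp ((PointedCone.smul_mem_iff _ hβ).1 this)

/-- The first vertex that is met when a chord is turned around one of its end points. -/
theorem IsChord.exists_vertex (hS : IsFan S) (hc : IsChord S q p) (hτ : IsCarrier S p τ)
    (ha : a ∈ τ) (hi : Indep q p a) (hne : ¬ EmptyTriangle S q p a) :
    ∃ x y z : ℝ, 0 < x ∧ 0 < y ∧ 0 < z ∧ IsVertex S (x • q + y • p + z • a) ∧
      EmptyTriangle S q p (y • p + z • a) := by
  obtain ⟨W, hW, hWv, hWrep⟩ := hS.exists_representatives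
  obtain ⟨f⟩ := hi.nonempty_frame
  let W' : Set (Fin 3 → ℝ) := {w ∈ W | 0 < f.A w ∧ 0 < f.B w ∧ 0 < f.C w}
  have hWne : W'.Nonempty := by
    by_contra hcon
    apply hne
    refine hc.emptyTriangle hS hτ ha hi fun x y z hx hy hz hv => hcon ?_
    obtain ⟨w, hw, t, ht, hwt⟩ := hWrep _ hv
    refine ⟨w, hw, ?_⟩
    have hA := congrArg f.A hwt
    have hB := congrArg f.B hwt
    have hC := congrArg f.C hwt
    simp at hA hB hC
    exact ⟨pos_of_mul_pos_right (hA ▸ hx) ht.le, pos_of_mul_pos_right (hB ▸ hy) ht.le,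
      pos_of_mul_pos_right (hC ▸ hz) ht.le⟩
  -- Seen from `q`, the ratio `f.C w / f.B w` is the angle by which the chord must turn from `p`
  -- towards `a` to reach `w`.
  obtain ⟨w, ⟨hw, hA, hB, hC⟩, hmin⟩ :=
    Set.exists_min_image W' (fun w => f.C w / f.B w) (hW.subset fun _ h => h.1) hWne
  refine ⟨f.A w, f.B w, f.C w, hA, hB, hC, f.eq w ▸ hWv w hw, ?_⟩
  refine hc.emptyTriangle hS hτ (add_mem (PointedCone.smul_mem _ hB.le hτ.self_mem)
    (PointedCone.smul_mem _ hC.le ha)) ?_ fun x y z hx hy hz hv => ?_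
  · intro x y z hxyz
    obtain ⟨h1, h2, h3⟩ := hi x (y + z * f.B w) (z * f.C w) (by rw [← hxyz]; module)
    have hz : z = 0 := by simpa [hC.ne'] using h3
    subst hz
    exact ⟨h1, by simpa using h2, rfl⟩
  · obtain ⟨w', hw', t, ht, hwt⟩ := hWrep _ hv
    have hA' := congrArg f.A hwt
    have hB' := congrArg f.B hwt
    have hC' := congrArg f.C hwt
    simp at hA' hB' hC'
    have hBpos : 0 < f.B w' := pos_of_mul_pos_right (hB' ▸ by positivity : 0 < t * f.B w') ht.le
    have hCpos : 0 < f.C w' := pos_of_mul_pos_right (hC' ▸ by positivity : 0 < t * f.C w') ht.le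
    have := hmin w' ⟨hw', pos_of_mul_pos_right (hA' ▸ hx) ht.le, hBpos, hCpos⟩
    rw [div_le_div_iff₀ hB hBpos] at this
    have h1 : f.C w * (t * f.B w') ≤ t * f.C w' * f.B w := by nlinarith
    rw [← hB', ← hC'] at h1
    nlinarith [mul_pos hC hy]

/-- The smallest cone of `q` is not a ray, and `IsCarrier.le_zero_of_sub_eq` confines it to a plane
transverse to the chord. It is thus two-dimensional with `q` in its relative interior, so it has
generators on both sides of `q`. -/
theorem IsChord.exists_two_vertices (hS : IsFan S) (hc : IsChord S p q) (hτ : IsCarrier S q τ)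
    (hq : ¬ IsVertex S q) :
    ∃ a b : Fin 3 → ℝ, a ∈ τ ∧ b ∈ τ ∧ IsVertex S a ∧ IsVertex S b ∧ Indep p q a ∧
      ∃ l m : ℝ, 0 < l ∧ 0 < m ∧ q = l • a + m • b := by
  obtain ⟨G, -, hG, hGv⟩ := hS.exists_generators hτ.mem
  have hsal := hS.strictlyConvex _ hτ.mem
  have hGτ : ∀ g ∈ G, g ∈ τ := fun g hg => hG ▸ PointedCone.subset_hull hg
  have hind := hc.indep hS
  obtain ⟨u, hu, hunot⟩ : ∃ u ∈ τ, ∀ t : ℝ, u ≠ t • q := by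
    by_contra hcon
    push Not at hcon
    exact hq (hτ.isVertex hS hc.right_ne_zero hcon)
  have hi : Indep p q u := by
    intro α β γ h
    have hle1 : α ≤ 0 := IsCarrier.le_zero_of_sub_eq hc hτ
      (PointedCone.smul_mem _ (sub_nonneg.2 (le_abs_self γ)) hu)
      (PointedCone.smul_mem _ (abs_nonneg γ) hu) (d := β) (by
        have : α • p + β • q = -(γ • u) := by
          rw [eq_neg_iff_add_eq_zero, h]
        rw [this]; module)
    have hle2 : -α ≤ 0 := IsCarrier.le_zero_of_sub_eq hc hτ
      (PointedCone.smul_mem _ (abs_nonneg γ) hu)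
      (PointedCone.smul_mem _ (sub_nonneg.2 (le_abs_self γ)) hu)
      (d := -β) (by
        have : (-α) • p + (-β) • q = γ • u := by
          have : γ • u = (α • p + β • q + γ • u) - α • p - β • q := by module
          rw [this, h]; module
        rw [this]; module)
    have hα : α = 0 := by linarith
    subst hα
    have hγ : γ = 0 := by
      by_contra hγ
      apply hunot (-(β / γ))
      have : u = γ⁻¹ • ((0 : ℝ) • p + β • q + γ • u) - (β / γ) • q := by
        rw [smul_add, smul_smul γ⁻¹ γ, inv_mul_cancel₀ hγ]; module
      rw [this, h]; module
    subst hγ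
    exact ⟨rfl, (hind 0 _ (by simpa using h)).2, rfl⟩
  obtain ⟨f⟩ := hi.nonempty_frame
  have hA : ∀ g ∈ τ, f.A g = 0 := by
    intro g hg
    apply le_antisymm
    · refine IsCarrier.le_zero_of_sub_eq hc hτ
        (add_mem hg (PointedCone.smul_mem _ (by linarith [le_abs_self (f.C g)] :
          0 ≤ |f.C g| - f.C g) hu)) (PointedCone.smul_mem _ (abs_nonneg (f.C g)) hu)
        (d := f.B g) ?_
      have := f.eq g
      have h2 : f.A g • p + f.B g • q = g - f.C g • u := by
        rw [eq_sub_iff_add_eq]; exact this.symm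
      rw [h2]; module
    · rw [← neg_nonpos]
      refine IsCarrier.le_zero_of_sub_eq hc hτ (PointedCone.smul_mem _ (abs_nonneg (f.C g)) hu)
        (add_mem hg (PointedCone.smul_mem _ (by linarith [le_abs_self (f.C g)] :
          0 ≤ |f.C g| - f.C g) hu))
        (d := -f.B g) ?_
      have := f.eq g
      have h2 : f.A g • p + f.B g • q = g - f.C g • u := by
        rw [eq_sub_iff_add_eq]; exact this.symm
      have h3 : (-f.A g) • p + (-f.B g) • q = -(f.A g • p + f.B g • q) := by module
      rw [h3, h2]; module
  obtain ⟨a, ha, haC⟩ : ∃ g ∈ G, 0 < f.C g := by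
    by_contra hcon
    push Not at hcon
    have := nonpos_of_mem_hull f.C hcon (hG ▸ hu)
    simp at this
    linarith
  obtain ⟨b, hb, hbC⟩ : ∃ g ∈ G, f.C g < 0 := by
    by_contra hcon
    push Not at hcon
    obtain ⟨k, hk, hku⟩ := hτ.sub_mem u hu
    have := nonpos_of_mem_hull (-f.C) (fun g hg => by simpa using hcon g hg) (hG ▸ hku)
    simp at this
    linarith
  have hab : (-f.C b) • a + f.C a • b = f.B ((-f.C b) • a + f.C a • b) • q := by
    conv_lhs => rw [f.eq ((-f.C b) • a + f.C a • b)]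
    have h1 : f.A ((-f.C b) • a + f.C a • b) = 0 := by simp [hA a (hGτ a ha), hA b (hGτ b hb)]
    have h2 : f.C ((-f.C b) • a + f.C a • b) = 0 := by simp; ring
    rw [h1, h2]; module
  set r := f.B ((-f.C b) • a + f.C a • b)
  have hr : 0 < r := by
    by_contra hr
    push Not at hr
    have h1 : (-f.C b) • a ∈ τ := PointedCone.smul_mem _ (by linarith) (hGτ a ha)
    have h2 : -((-f.C b) • a) ∈ τ := by
      have : -((-f.C b) • a) = f.C a • b + (-r) • q := by
        have : -((-f.C b) • a) = f.C a • b - ((-f.C b) • a + f.C a • b) := by module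
        rw [this, hab]; module
      rw [this]
      exact add_mem (PointedCone.smul_mem _ haC.le (hGτ b hb))
        (PointedCone.smul_mem _ (by linarith) hτ.self_mem)
    rcases smul_eq_zero.1 (eq_zero_of_salient hsal h1 h2) with h3 | h3
    · linarith
    · exact (hGv a ha).1 h3
  refine ⟨a, b, hGτ a ha, hGτ b hb, hGv a ha, hGv b hb, fun x y z h => ?_, -f.C b / r, f.C a / r,
    div_pos (by linarith) hr, div_pos haC hr, ?_⟩
  · have h1 := congrArg f.C h
    simp [haC.ne'] at h1
    subst h1
    rw [zero_smul, add_zero] at h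
    exact ⟨(hind _ _ h).1, (hind _ _ h).2, rfl⟩
  · have : (-f.C b / r) • a + (f.C a / r) • b = r⁻¹ • ((-f.C b) • a + f.C a • b) := by
      module
    rw [this, hab, smul_smul, inv_mul_cancel₀ hr.ne', one_smul]

/-- If the triangle is already empty, the turning chord meets nothing before `a`, and `a` itself
serves as the first vertex. -/
theorem IsChord.exists_first_vertex (hS : IsFan S) (hc : IsChord S q p) (hτ : IsCarrier S p τ)
    (ha : a ∈ τ) (hav : IsVertex S a) (hi : Indep q p a) :
    ∃ x y z : ℝ, 0 ≤ x ∧ 0 ≤ y ∧ 0 < z ∧ IsVertex S (x • q + y • p + z • a) ∧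
      EmptyTriangle S q p (y • p + z • a) := by
  by_cases h : EmptyTriangle S q p a
  · exact ⟨0, 0, 1, le_rfl, le_rfl, one_pos, by simpa using hav, by simpa using h⟩
  · obtain ⟨x, y, z, hx, hy, hz, h1, h2⟩ := hc.exists_vertex hS hτ ha hi h
    exact ⟨x, y, z, hx.le, hy.le, hz, h1, h2⟩

/-- In a saturated fan no chord starts at a vertex. -/
theorem IsSaturated.not_isChord_of_isVertex (h : IsSaturated R S) (hp : IsVertex S p) :
    ¬ IsChord S p q := by
  intro hc
  have hS := h.isFan
  have hq := h.not_isVertex hc hp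
  obtain ⟨τ, hτ⟩ := hS.exists_isCarrier hc.right_mem
  obtain ⟨a, b, ha, hb, hav, hbv, hi, l, m, hl, hm, hlm⟩ := hc.exists_two_vertices hS hτ hq
  have hbeq : b = (1 / m) • q - (l / m) • a := by
    have : (1 / m) • q - (l / m) • a = (1 / m) • (m • b) := by rw [hlm]; module
    rw [this, smul_smul, one_div_mul_cancel hm.ne', one_smul]
  have hib : Indep p q b := by
    intro x y z hxyz
    obtain ⟨h1, h2, h3⟩ := hi x (y + z / m) (-(z * l / m)) (by
      rw [← hxyz, hbeq]; module)
    have hz : z = 0 := by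
      rw [neg_eq_zero, div_eq_zero_iff, mul_eq_zero] at h3
      rcases h3 with (h3 | h3) | h3
      exacts [h3, absurd h3 hl.ne', absurd h3 hm.ne']
    subst hz
    exact ⟨h1, by simpa using h2, rfl⟩
  obtain ⟨x, y, z, hx, hy, hz, hw, he⟩ := hc.exists_first_vertex hS hτ ha hav hi
  obtain ⟨x', y', z', hx', hy', hz', hw', he'⟩ := hc.exists_first_vertex hS hτ hb hbv hib
  -- The first vertices on the two sides of the chord span with `p` a triangle covered by the two
  -- empty triangles swept out and the chord.
  refine h.not_emptyTriangle hp hw hw' ?_ ?_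
  · intro α β γ h0
    obtain ⟨h1, h2, h3⟩ := hi (α + β * x + γ * x') (β * y + γ * y' + γ * z' / m)
      (β * z - γ * z' * l / m) (by rw [← h0, hbeq]; module)
    have h4 : β * z = γ * (z' * l / m) := by
      have : γ * (z' * l / m) = γ * z' * l / m := by ring
      linarith
    have h5 : γ * (z' * l / m * y + z * y' + z * z' / m) = 0 := by
      have : γ * (z' * l / m * y + z * y' + z * z' / m) =
        y * (γ * (z' * l / m)) + z * (γ * y' + γ * z' / m) := by ring
      rw [this, ← h4]
      have : y * (β * z) + z * (γ * y' + γ * z' / m) = z * (β * y + γ * y' + γ * z' / m) := by ring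
      rw [this, h2, mul_zero]
    have h6 : 0 < z' * l / m * y + z * y' + z * z' / m := by positivity
    have hγ : γ = 0 := (mul_eq_zero.1 h5).resolve_right h6.ne'
    subst hγ
    have hβ : β = 0 := by simpa [hz.ne'] using h4
    subst hβ
    exact ⟨by simpa using h1, rfl, rfl⟩
  · intro α β γ hα hβ hγ hmem
    -- The sign of the `a`-coordinate `β * z - γ * z' * l / m` places the point in the first empty
    -- triangle, on the chord, or in the second one.
    rcases lt_trichotomy (γ * z' * l / m) (β * z) with h1 | h1 | h1
    · set t := β - γ * z' * l / (m * z)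
      have htz : t * z = β * z - γ * z' * l / m := by simp only [t]; field_simp
      have ht : 0 < t := by
        have : 0 < t * z := by linarith
        exact pos_of_mul_pos_left this hz.le
      have hβt : 0 < β - t := by
        have : β - t = γ * z' * l / (m * z) := by simp only [t]; ring
        rw [this]; positivity
      refine he (α + β * x + γ * x') ((β - t) * y + γ * y' + γ * z' / m) t (by positivity)
        (by positivity) ht ?_
      convert hmem using 1
      rw [hbeq]
      have : t • (y • q + z • a) = (t * y) • q + (β * z - γ * z' * l / m) • a := by
        rw [← htz]; module
      rw [this]; module
    · refine hc.notMem (α + β * x + γ * x') (β * y + γ * y' + γ * z' / m) (by positivity)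
        (by positivity) ?_
      convert hmem using 1
      rw [hbeq]
      have : β • (x • p + y • q + z • a) = β • x • p + (β * y) • q + (γ * z' * l / m) • a := by
        rw [h1]; module
      rw [this]; module
    · have haeq : a = (1 / l) • q - (m / l) • b := by
        have : (1 / l) • q - (m / l) • b = (1 / l) • (l • a) := by rw [hlm]; module
        rw [this, smul_smul, one_div_mul_cancel hl.ne', one_smul]
      set t := γ - β * z * m / (l * z')
      have htz : t * z' = γ * z' - β * z * m / l := by simp only [t]; field_simp
      have ht : 0 < t := by
        have : 0 < t * z' := by
          rw [htz, sub_pos, div_lt_iff₀ hl]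
          rw [lt_div_iff₀ hm] at h1
          linarith
        exact pos_of_mul_pos_left this hz'.le
      have hβt : 0 < γ - t := by
        have : γ - t = β * z * m / (l * z') := by simp only [t]; ring
        rw [this]; positivity
      refine he' (α + β * x + γ * x') ((γ - t) * y' + β * y + β * z / l) t (by positivity)
        (by positivity) ht ?_
      convert hmem using 1
      rw [haeq]
      have : t • (y' • q + z' • b) = (t * y') • q + (γ * z' - β * z * m / l) • b := by
        rw [← htz]; module
      rw [this]; module

/-- Otherwise the first vertex met in turning about `q` is joined to `p` by a chord, running inside
the empty triangle swept out. -/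
theorem IsSaturated.emptyTriangle_of_isChord (h : IsSaturated R S) (hc : IsChord S q p)
    (hτ : IsCarrier S p τ) (ha : a ∈ τ) (hi : Indep q p a) : EmptyTriangle S q p a := by
  by_contra hne
  obtain ⟨x, y, z, hx, hy, hz, hv, he⟩ := hc.exists_vertex h.isFan hτ ha hi hne
  refine h.not_isChord_of_isVertex hv (q := p) ⟨hv.mem_support, hc.right_mem, ?_⟩
  intro α β hα hβ hmem
  refine he (α * x) β α (by positivity) hβ hα ?_
  convert hmem using 1
  module

end Chords

/-! ### Exclusion of all chords. -/

section Completeness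

variable {R S : Set (PointedCone ℝ (Fin 3 → ℝ))} {p q a b c d : Fin 3 → ℝ}
  {τ τ' : PointedCone ℝ (Fin 3 → ℝ)}

/-- Here `c` is the end on the side of `a` of a segment through `q`. If `c` leans away from `p`,
then `d` leans towards `p`, and the vertex `a` is joined by a chord to a point `q + ε • d`. If `c`
leans towards `p`, either `c` lies inside the empty triangle on `p, q, a`, or the face property puts
`p` into `τ'`. -/
theorem IsSaturated.coord_eq_zero (h : IsSaturated R S) (hc : IsChord S p q)
    (hτ : IsCarrier S p τ) (hτ' : IsCarrier S q τ') (ha : a ∈ τ) (hav : IsVertex S a)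
    (f : Frame p q a) (hcτ : c ∈ τ') (hdτ : d ∈ τ') {l m : ℝ} (hl : 0 < l) (hm : 0 < m)
    (hlm : q = l • c + m • d) (hpos : 0 < f.C c) : f.A c = 0 := by
  have hS := h.isFan
  have hA := congrArg f.A hlm
  have hC := congrArg f.C hlm
  simp at hA hC
  have hd3 : f.C d < 0 := by
    by_contra hcon
    push Not at hcon
    linarith [mul_pos hl hpos, mul_nonneg hm.le hcon]
  have hid : Indep p q d := by
    intro x y z hxyz
    rw [f.eq d] at hxyz
    obtain ⟨h1, h2, h3⟩ := f.indep (x + z * f.A d) (y + z * f.B d) (z * f.C d)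
      (by rw [← hxyz]; module)
    have hz : z = 0 := by simpa [hd3.ne] using h3
    subst hz
    exact ⟨by simpa using h1, by simpa using h2, rfl⟩
  have hea := h.emptyTriangle_of_isChord hc.symm hτ ha f.indep.swap
  have hed := h.emptyTriangle_of_isChord hc hτ' hdτ hid
  have hd := f.eq d
  have hceq := f.eq c
  set d1 := f.A d
  set d2 := f.B d
  set d3 := f.C d
  rcases lt_trichotomy (f.A c) 0 with h1 | h1 | h1
  · exfalso
    have hd1 : 0 < d1 := by
      by_contra hcon
      push Not at hcon
      nlinarith [mul_pos hl (neg_pos.2 h1)]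
    -- Small enough for `|d2| * ε < 1`, which keeps the `q`-coordinates positive in `hbound`.
    set ε := 1 / (1 + |d2|)
    have hε : 0 < ε := by positivity
    have hεd : |d2| * ε < 1 := by
      simp only [ε]
      rw [mul_one_div, div_lt_one (by positivity)]
      linarith
    refine h.not_isChord_of_isVertex hav (q := q + ε • d) ⟨hav.mem_support, mem_support.2
      ⟨τ', hτ'.mem, add_mem hτ'.self_mem (PointedCone.smul_mem _ hε.le hdτ)⟩, ?_⟩
    intro α β hα hβ hmem
    have hβε : 0 < β * ε := mul_pos hβ hε
    have hbound : ∀ s, 0 ≤ s → s ≤ β * ε → 0 < β + d2 * s := by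
      intro s hs hsβ
      have e1 : |d2| * s ≤ β * (|d2| * ε) := by
        calc |d2| * s ≤ |d2| * (β * ε) := mul_le_mul_of_nonneg_left hsβ (abs_nonneg _)
          _ = β * (|d2| * ε) := by ring
      have e2 : β * (|d2| * ε) < β := by nlinarith
      have e3 : -|d2| * s ≤ d2 * s := mul_le_mul_of_nonneg_right (neg_abs_le d2) hs
      linarith
    -- The sign of the `a`-coordinate: the point lies in the empty triangle with `d`, on the chord,
    -- or in the empty triangle with `a`.
    rcases lt_trichotomy (α + β * ε * d3) 0 with hk | hk | hk
    · set t := (α + β * ε * d3) / d3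
      have htd : t * d3 = α + β * ε * d3 := div_mul_cancel₀ _ hd3.ne
      have ht : 0 < t := div_pos_of_neg_of_neg hk hd3
      have htβ : 0 < β * ε - t := by
        have : (β * ε - t) * d3 = -α := by rw [sub_mul, htd]; ring
        by_contra hcon
        push Not at hcon
        nlinarith [mul_nonneg (neg_nonneg.2 hcon) (neg_nonneg.2 hd3.le)]
      refine hed ((β * ε - t) * d1) (β + d2 * (β * ε - t)) t (by positivity)
        (hbound _ htβ.le (by linarith)) ht ?_
      convert hmem using 1
      rw [hd]
      have : t • (d1 • p + d2 • q + d3 • a) =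
        (t * d1) • p + (t * d2) • q + (α + β * ε * d3) • a := by rw [← htd]; module
      rw [this]; module
    · refine hc.notMem (β * ε * d1) (β + d2 * (β * ε)) (by positivity)
        (hbound _ hβε.le le_rfl) ?_
      convert hmem using 1
      rw [hd]
      have : α • a + β • (q + ε • (d1 • p + d2 • q + d3 • a)) =
        (β * ε * d1) • p + (β + d2 * (β * ε)) • q + (α + β * ε * d3) • a := by module
      rw [this, hk]; module
    · refine hea (β + d2 * (β * ε)) (β * ε * d1) (α + β * ε * d3) (hbound _ hβε.le le_rfl)
        (by positivity) hk ?_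
      convert hmem using 1
      rw [hd]; module
  · exact h1
  · exfalso
    rcases lt_or_ge 0 (f.B c) with h2 | h2
    · refine hea _ _ _ h2 h1 hpos (mem_support.2 ⟨τ', hτ'.mem, ?_⟩)
      convert hcτ using 1
      conv_rhs => rw [hceq]
      module
    · have hmem : f.A c • p + f.C c • a ∈ τ' := by
        have : f.A c • p + f.C c • a = (f.A c • p + f.B c • q + f.C c • a) + (-f.B c) • q := by
          module
        rw [this, ← hceq]
        exact add_mem hcτ (PointedCone.smul_mem _ (by linarith) hτ'.self_mem)
      have hp := hS.mem_of_add_mem hτ.mem hτ'.mem (PointedCone.smul_mem _ h1.le hτ.self_mem)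
        (PointedCone.smul_mem _ hpos.le ha) hmem
      exact hc.notMem (f.A c) 1 h1 one_pos (mem_support.2 ⟨τ', hτ'.mem,
        add_mem hp (PointedCone.smul_mem _ zero_le_one hτ'.self_mem)⟩)

/-- Let `p` lie between `a, b` and `q` between `c, d`. If `c` is on the side of `a`, then
`IsSaturated.coord_eq_zero` puts `c`, hence `d`, into the plane of `q` and `a`, and applied on the
other side it puts `d` into the plane of `q` and `b`. These planes share only the line of `q`. The
same applies to `d`, so both `c` and `d` would lie in the plane of `p` and `q`, which is excluded.
-/
theorem IsSaturated.not_isChord (h : IsSaturated R S) : ¬ IsChord S p q := by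
  intro hc
  have hS := h.isFan
  have hp : ¬ IsVertex S p := fun hp => h.not_isChord_of_isVertex hp hc
  have hq : ¬ IsVertex S q := fun hq => h.not_isChord_of_isVertex hq hc.symm
  obtain ⟨τ, hτ⟩ := hS.exists_isCarrier hc.left_mem
  obtain ⟨τ', hτ'⟩ := hS.exists_isCarrier hc.right_mem
  obtain ⟨a, b, ha, hb, hav, hbv, hia, l, m, hl, hm, hlm⟩ :=
    hc.symm.exists_two_vertices hS hτ hp
  obtain ⟨c, d, hcτ, hdτ, -, -, hic, l', m', hl', hm', hlm'⟩ := hc.exists_two_vertices hS hτ' hq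
  obtain ⟨f⟩ := hia.swap.nonempty_frame
  have hbeq : b = (1 / m) • p - (l / m) • a := by
    have : (1 / m) • p - (l / m) • a = (1 / m) • (m • b) := by rw [hlm]; module
    rw [this, smul_smul, one_div_mul_cancel hm.ne', one_smul]
  have hib : Indep p q b := by
    intro x y z hxyz
    obtain ⟨h1, h2, h3⟩ := f.indep (x + z / m) y (-(z * l / m)) (by
      rw [← hxyz, hbeq]; module)
    have hz : z = 0 := by
      rw [neg_eq_zero, div_eq_zero_iff, mul_eq_zero] at h3
      rcases h3 with (h3 | h3) | h3
      exacts [h3, absurd h3 hl.ne', absurd h3 hm.ne']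
    subst hz
    exact ⟨by simpa using h1, h2, rfl⟩
  obtain ⟨f'⟩ := hib.nonempty_frame
  have key : ∀ {c d : Fin 3 → ℝ} {l' m' : ℝ}, c ∈ τ' → d ∈ τ' → 0 < l' → 0 < m' →
      q = l' • c + m' • d → ¬ 0 < f.C c := by
    intro c d l' m' hcτ hdτ hl' hm' hlm' hpos
    have hAc := h.coord_eq_zero hc hτ hτ' ha hav f hcτ hdτ hl' hm' hlm' hpos
    have e1 := congrArg f.A hlm'
    have e2 := congrArg f.C hlm'
    simp [hAc, hm'.ne'] at e1 e2
    have hCd : f.C d < 0 := by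
      by_contra hcon
      push Not at hcon
      linarith [mul_pos hl' hpos, mul_nonneg hm'.le hcon]
    have e3 := congrArg f'.A hlm
    have e4 := congrArg f'.C hlm
    have e5 := congrArg f'.A (f.eq d)
    have e6 := congrArg f'.C (f.eq d)
    simp [e1] at e3 e4 e5 e6
    have hCa : f'.C a < 0 := by
      by_contra hcon
      push Not at hcon
      linarith [mul_nonneg hl.le hcon]
    have hpos' : 0 < f'.C d := by rw [e6]; exact mul_pos_of_neg_of_neg hCd hCa
    have hAd := h.coord_eq_zero hc hτ hτ' hb hbv f' hdτ hcτ hm' hl'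
      (by rw [hlm']; exact add_comm _ _) hpos'
    rw [hAd] at e5
    rcases mul_eq_zero.1 e5.symm with h0 | h0
    · exact hCd.ne h0
    · rw [h0, mul_zero] at e3
      exact one_ne_zero e3
  have h1 := key hcτ hdτ hl' hm' hlm'
  have h2 := key hdτ hcτ hm' hl' (by rw [hlm']; exact add_comm _ _)
  have e2 := congrArg f.C hlm'
  simp at e2
  have hCc : f.C c = 0 := by
    push Not at h1 h2
    nlinarith [mul_nonneg hl'.le (neg_nonneg.2 h1), mul_nonneg hm'.le (neg_nonneg.2 h2)]
  have := (hic (f.A c) (f.B c) (-1) (by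
    have := f.eq c
    rw [hCc, zero_smul, add_zero] at this
    rw [← this]; module)).2.2
  norm_num at this

end Completeness

/-! ### Existence of chords, and completeness in dimension three. -/

section Existence

variable {n : ℕ} {R S : Set (PointedCone ℝ (Fin n → ℝ))} {p q : Fin n → ℝ}

/-- The chord joins the last point of the closed support before the midpoint of the segment and the
first one after it. -/
theorem IsFan.exists_isChord (hS : IsFan S) (hp : p ∈ support S) (hq : q ∈ support S)
    (hpq : p + q ∉ support S) : ∃ p' q', IsChord S p' q' := by
  set γ : ℝ → Fin n → ℝ := fun t => (1 - t) • p + t • q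
  have hγ : Continuous γ := by fun_prop
  have hA : IsClosed (γ ⁻¹' support S) := hS.isClosed_support.preimage hγ
  have hhalf : γ (1 / 2) ∉ support S := by
    have : γ (1 / 2) = (1 / 2 : ℝ) • (p + q) := by simp only [γ]; module
    rw [this, smul_mem_support_iff (by norm_num)]
    exact hpq
  obtain ⟨s, ⟨hsA, hs0, hs1⟩, hs⟩ := (isCompact_Icc.inter_left hA :
    IsCompact (γ ⁻¹' support S ∩ Set.Icc 0 (1 / 2))).exists_isGreatest
    ⟨0, by simpa [γ] using hp, by norm_num⟩
  obtain ⟨t, ⟨htA, ht0, ht1⟩, ht⟩ := (isCompact_Icc.inter_left hA :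
    IsCompact (γ ⁻¹' support S ∩ Set.Icc (1 / 2) 1)).exists_isLeast
    ⟨1, by simpa [γ] using hq, by norm_num⟩
  have hs' : s < 1 / 2 := lt_of_le_of_ne hs1 fun h => hhalf (h ▸ hsA)
  have ht' : 1 / 2 < t := lt_of_le_of_ne ht0 fun h => hhalf (h ▸ htA)
  refine ⟨γ s, γ t, hsA, htA, fun α β hα hβ hmem => ?_⟩
  set r := (α * s + β * t) / (α + β)
  have hαβ : 0 < α + β := by positivity
  have hr : (α + β) * r = α * s + β * t := by simp only [r]; field_simp
  have heq : α • γ s + β • γ t = (α + β) • γ r := by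
    have : (α + β) • γ r = (α + β - (α + β) * r) • p + ((α + β) * r) • q := by
      simp only [γ]; module
    rw [this, hr]; simp only [γ]; module
  rw [heq, smul_mem_support_iff hαβ] at hmem
  have h1 : s < r := by
    by_contra hcon
    push Not at hcon
    nlinarith [mul_le_mul_of_nonneg_left hcon hαβ.le]
  have h2 : r < t := by
    by_contra hcon
    push Not at hcon
    nlinarith [mul_le_mul_of_nonneg_left hcon hαβ.le]
  rcases le_total r (1 / 2) with h3 | h3
  · exact absurd (hs ⟨hmem, by linarith, h3⟩) (not_le.2 h1)
  · exact absurd (ht ⟨hmem, h3, by linarith⟩) (not_le.2 h2)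

theorem IsSaturated.subset_support (h : IsSaturated R S) (hR : ∀ ρ ∈ R, IsRay ρ)
    {ρ : PointedCone ℝ (Fin n → ℝ)} (hρ : ρ ∈ R) {x : Fin n → ℝ} (hx : x ∈ ρ) : x ∈ support S := by
  obtain ⟨v, hv, rfl⟩ := hR ρ hρ
  have hv' : intVec v ≠ 0 := fun h0 => hv (by
    funext i
    have := congrFun h0 i
    simpa [intVec] using this)
  by_contra hcon
  have hvs : intVec v ∉ support S := by
    intro hvs
    obtain ⟨t, ht, rfl⟩ := mem_hull_singleton.1 hx
    exact hcon (smul_mem_support hvs ht)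
  have hrange : (Set.range fun _ : Fin 1 => intVec v) = {intVec v} := Set.range_const
  have := h.mem (k := 1) (g := fun _ => v) (LinearIndependent.of_subsingleton 0 hv') (fun i => ?_)
    (fun c hc => ?_) (fun _ => by rwa [hrange])
  · rw [hrange] at this
    exact hcon (mem_support.2 ⟨_, this, hx⟩)
  · have : ({i}ᶜ : Set (Fin 1)) = ∅ := by
      ext j; simp [Subsingleton.elim j i]
    rw [this, Set.image_empty, PointedCone.hull, Submodule.span_empty]
    exact h.isFan.bot_mem
  · simpa [smul_mem_support_iff (hc 0)] using hvs

/-- In dimension three, saturated fans are complete, provided that the rays that may be used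
positively span the space. -/
theorem IsSaturated.isComplete {R S : Set (PointedCone ℝ (Fin 3 → ℝ))} (h : IsSaturated R S)
    (hR : ∀ ρ ∈ R, IsRay ρ) (hspan : sSup R = ⊤) : IsComplete S := by
  have hadd : ∀ p ∈ support S, ∀ q ∈ support S, p + q ∈ support S := by
    intro p hp q hq
    by_contra hcon
    obtain ⟨p', q', hc⟩ := h.isFan.exists_isChord hp hq hcon
    exact h.not_isChord hc
  -- Without chords the support is a convex cone; it contains all members of `R`, which together
  -- generate the space.
  let C : PointedCone ℝ (Fin 3 → ℝ) :=
    { carrier := support S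
      add_mem' := fun hp hq => hadd _ hp _ hq
      zero_mem' := h.isFan.zero_mem_support
      smul_mem' := fun c _ hx => smul_mem_support hx c.2 }
  have hC : sSup R ≤ C := sSup_le fun ρ hρ x hx => h.subset_support hR hρ hx
  rw [hspan] at hC
  exact Set.eq_univ_of_forall fun x => hC (Submodule.mem_top : x ∈ ⊤)

end Existence

/-! ### Normal fans of finite point sets, and an obstruction to projectivity. -/

section NormalFans

variable {n : ℕ} {s : Set (Fin n → ℝ)} {u x y p q : Fin n → ℝ}

/-- The points of `s` at which the linear form `⟨·, u⟩` is minimal. -/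
def argmin (s : Set (Fin n → ℝ)) (u : Fin n → ℝ) : Set (Fin n → ℝ) :=
  {p ∈ s | ∀ q ∈ s, p ⬝ᵥ u ≤ q ⬝ᵥ u}

theorem argmin_nonempty (hs : s.Finite) (hne : s.Nonempty) (u : Fin n → ℝ) :
    (argmin s u).Nonempty := by
  obtain ⟨p, hp, h⟩ := Set.exists_min_image s (fun p => p ⬝ᵥ u) hs hne
  exact ⟨p, hp, h⟩

theorem eq_of_mem_argmin (hp : p ∈ argmin s u) (hq : q ∈ argmin s u) : p ⬝ᵥ u = q ⬝ᵥ u :=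
  le_antisymm (hp.2 q hq.1) (hq.2 p hp.1)

theorem mem_argmin_of_eq (hp : p ∈ argmin s u) (hq : q ∈ s) (h : q ⬝ᵥ u = p ⬝ᵥ u) :
    q ∈ argmin s u := ⟨hq, fun r hr => h ▸ hp.2 r hr⟩

theorem mem_normalCone {P F : Set (Fin n → ℝ)} :
    u ∈ normalCone P F ↔ ∀ p ∈ F, ∀ q ∈ P, p ⬝ᵥ u ≤ q ⬝ᵥ u := Iff.rfl

theorem mem_normalCone_argmin : x ∈ normalCone s (argmin s u) ↔ argmin s u ⊆ argmin s x :=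
  ⟨fun h p hp => ⟨hp.1, h p hp⟩, fun h _ hp => (h hp).2⟩

theorem self_mem_normalCone_argmin : u ∈ normalCone s (argmin s u) :=
  mem_normalCone_argmin.2 subset_rfl

/-- Given a common minimizer, the minima of `x` and `y` add up, so a minimizer of the sum attains
both. -/
theorem argmin_add_subset (hp : p ∈ argmin s x) (hp' : p ∈ argmin s y) (hq : q ∈ argmin s (x + y)) :
    q ∈ argmin s x := by
  refine mem_argmin_of_eq hp hq.1 (le_antisymm ?_ (hp.2 q hq.1))
  have h1 := hq.2 p hp.1
  have h2 := hp'.2 q hq.1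
  rw [dotProduct_add, dotProduct_add] at h1
  linarith

/-- On `argmin s u` both differences vanish, and on the finitely many other points the one for `u`
is positive. Consequently `k • u - x` is still minimal at `p`. -/
theorem exists_dominating (hs : s.Finite) (h : argmin s u ⊆ argmin s x) (hp : p ∈ argmin s u) :
    ∃ k : ℝ, 0 ≤ k ∧ ∀ q ∈ s, q ⬝ᵥ x - p ⬝ᵥ x ≤ k * (q ⬝ᵥ u - p ⬝ᵥ u) := by
  have hex : ∀ q ∈ s, ∃ k : ℝ, 0 ≤ k ∧ q ⬝ᵥ x - p ⬝ᵥ x ≤ k * (q ⬝ᵥ u - p ⬝ᵥ u) := by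
    intro q hq
    rcases (hp.2 q hq).eq_or_lt with h0 | h0
    · refine ⟨0, le_rfl, ?_⟩
      rw [eq_of_mem_argmin (h (mem_argmin_of_eq hp hq h0.symm)) (h hp)]
      simp
    · have hpos := sub_pos.2 h0
      refine ⟨|q ⬝ᵥ x - p ⬝ᵥ x| / (q ⬝ᵥ u - p ⬝ᵥ u), by positivity, ?_⟩
      rw [div_mul_cancel₀ _ hpos.ne']
      exact le_abs_self _
  choose! k hk hkq using hex
  refine ⟨∑ q ∈ hs.toFinset, k q, Finset.sum_nonneg fun q hq => hk q (by simpa using hq),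
    fun q hq => (hkq q hq).trans (mul_le_mul_of_nonneg_right ?_ (sub_nonneg.2 (hp.2 q hq)))⟩
  exact Finset.single_le_sum (f := k) (fun q hq => hk q (by simpa using hq)) (by simpa using hq)

theorem le_dotProduct_of_mem_convexHull {m : ℝ} (h : ∀ q ∈ s, m ≤ q ⬝ᵥ u)
    (hq : q ∈ convexHull ℝ s) : m ≤ q ⬝ᵥ u := by
  have hconv : Convex ℝ {q : Fin n → ℝ | m ≤ q ⬝ᵥ u} :=
    convex_halfSpace_ge (𝕜 := ℝ) ⟨fun a b => add_dotProduct a b u, fun c a => smul_dotProduct c a u⟩ m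
  exact convexHull_min (show s ⊆ {q | m ≤ q ⬝ᵥ u} from h) hconv hq

theorem argmin_subset_argmin_convexHull : argmin s u ⊆ argmin (convexHull ℝ s) u :=
  fun _ hp => ⟨subset_convexHull ℝ s hp.1, fun _ hq => le_dotProduct_of_mem_convexHull hp.2 hq⟩

theorem normalCone_convexHull (hs : s.Finite) (hne : s.Nonempty) (u : Fin n → ℝ) :
    normalCone (convexHull ℝ s) (argmin (convexHull ℝ s) u) = normalCone s (argmin s u) := by
  ext x
  constructor
  · exact fun h p hp q hq => h p (argmin_subset_argmin_convexHull hp) q (subset_convexHull ℝ s hq)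
  · intro h p hp q hq
    obtain ⟨p₀, hp₀⟩ := argmin_nonempty hs hne u
    obtain ⟨k, hk, hks⟩ := exists_dominating hs (mem_normalCone_argmin.1 h) hp₀
    have h1 : k * p₀ ⬝ᵥ u - p₀ ⬝ᵥ x ≤ p ⬝ᵥ (k • u - x) := by
      refine le_dotProduct_of_mem_convexHull (fun q hq => ?_) hp.1
      rw [dotProduct_sub, dotProduct_smul, smul_eq_mul]
      linarith [hks q hq]
    have h2 : p ⬝ᵥ u = p₀ ⬝ᵥ u := eq_of_mem_argmin hp (argmin_subset_argmin_convexHull hp₀)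
    rw [dotProduct_sub, dotProduct_smul, smul_eq_mul, h2] at h1
    have h3 := le_dotProduct_of_mem_convexHull (fun q hq => h p₀ hp₀ q hq) hq
    linarith

/-- The normal fan of a polytope in terms of a finite set of points that spans it. -/
theorem normalFan_convexHull (hs : s.Finite) (hne : s.Nonempty) :
    normalFan (convexHull ℝ s) = Set.range fun u => normalCone s (argmin s u) := by
  ext σ
  constructor
  · rintro ⟨F, hF, hFne, rfl⟩
    obtain ⟨l, hl⟩ := hF hFne
    -- Exposed faces are defined by maximizing, inner normal cones by minimizing: hence the sign.
    set u : Fin n → ℝ := fun i => -l (fun j => if i = j then 1 else 0)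
    have hu : ∀ x, x ⬝ᵥ u = -l x := by
      intro x
      have := LinearMap.pi_apply_eq_sum_univ (l : (Fin n → ℝ) →ₗ[ℝ] ℝ) x
      rw [ContinuousLinearMap.coe_coe] at this
      rw [this, dotProduct, ← Finset.sum_neg_distrib]
      exact Finset.sum_congr rfl fun i _ => by simp [u]
    refine ⟨u, ?_⟩
    have : F = argmin (convexHull ℝ s) u := by
      rw [hl]; ext x; simp [argmin, hu]
    rw [this]
    exact (normalCone_convexHull hs hne u).symm
  · rintro ⟨u, rfl⟩
    refine ⟨argmin (convexHull ℝ s) u, fun _ => ⟨∑ i, (-u i) • ContinuousLinearMap.proj i, ?_⟩,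
      (argmin_nonempty hs hne u).mono argmin_subset_argmin_convexHull,
      (normalCone_convexHull hs hne u).symm⟩
    have hu : ∀ x : Fin n → ℝ,
        (∑ i, (-u i) • ContinuousLinearMap.proj (R := ℝ) (φ := fun _ : Fin n => ℝ) i) x
          = -(x ⬝ᵥ u) := by
      intro x
      simp [dotProduct, mul_comm]
    ext x
    simp [argmin, hu]

/-- The normal fan of the convex hull of `s`. -/
def pointFan (s : Set (Fin n → ℝ)) : Set (PointedCone ℝ (Fin n → ℝ)) :=
  Set.range fun u => normalCone s (argmin s u)

theorem normalCone_argmin_isFaceOf (hs : s.Finite) (hne : s.Nonempty) {v : Fin n → ℝ} :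
    (normalCone s (argmin s u) ⊓ normalCone s (argmin s v)).IsFaceOf (normalCone s (argmin s u)) := by
  refine isFaceOf_of_add_mem inf_le_left fun x hx y hy h => ⟨hx, ?_⟩
  have h2 := mem_normalCone_argmin.1 h.2
  obtain ⟨p, hp⟩ := argmin_nonempty hs hne u
  rw [SetLike.mem_coe, mem_normalCone_argmin] at *
  exact fun q hq => argmin_add_subset (hx hp) (hy hp) (h2 hq)

theorem normalCone_argmin_isFaceOf_singleton (hp : p ∈ argmin s u) :
    (normalCone s (argmin s u)).IsFaceOf (normalCone s {p}) := by
  refine isFaceOf_of_add_mem (fun x hx q hq => ?_) fun x hx y hy h => ?_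
  · rintro r hr
    rw [Set.mem_singleton_iff.1 hq]
    exact hx p hp r hr
  · rw [mem_normalCone_argmin] at h ⊢
    exact fun q hq => argmin_add_subset ⟨hp.1, hx p rfl⟩ ⟨hp.1, hy p rfl⟩ (h hq)

/-- A vector `v` of the face with a minimal set of minimizers plays the part of a relative interior
point. If `w` is minimal wherever `v` is, then `k • v - w` lies in the big cone for large `k`, and
the face property gives `w`. -/
theorem eq_normalCone_argmin_of_isFaceOf (hs : s.Finite) (hne : s.Nonempty)
    {τ : PointedCone ℝ (Fin n → ℝ)} (hτ : τ.IsFaceOf (normalCone s (argmin s u))) :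
    ∃ v, τ = normalCone s (argmin s v) := by
  have hfin : (argmin s '' τ).Finite := hs.finite_subsets.subset (by
    rintro _ ⟨v, -, rfl⟩ p hp
    exact hp.1)
  obtain ⟨A, hA⟩ := hfin.exists_minimal ⟨_, 0, zero_mem _, rfl⟩
  obtain ⟨v, hv, rfl⟩ := hA.prop
  obtain ⟨p, hp⟩ := argmin_nonempty hs hne u
  have hmem : ∀ w ∈ τ, p ∈ argmin s w := fun w hw => mem_normalCone_argmin.1 (hτ.le hw) hp
  refine ⟨v, le_antisymm (fun w hw => ?_) fun w hw => ?_⟩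
  · rw [mem_normalCone_argmin]
    have h1 : argmin s (v + w) ⊆ argmin s v :=
      fun q hq => argmin_add_subset (hmem v hv) (hmem w hw) hq
    have h2 : argmin s v ⊆ argmin s (v + w) := hA.le_of_le ⟨_, add_mem hv hw, rfl⟩ h1
    intro q hq
    have h3 := h2 hq
    rw [add_comm] at h3
    exact argmin_add_subset (hmem w hw) (hmem v hv) h3
  · have hpv := hmem v hv
    rw [mem_normalCone_argmin] at hw
    obtain ⟨k, hk, hkq⟩ := exists_dominating hs hw hpv
    have hpu : argmin s u ⊆ argmin s v := mem_normalCone_argmin.1 (hτ.le hv)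
    have hwC : w ∈ normalCone s (argmin s u) := mem_normalCone_argmin.2 (hpu.trans hw)
    refine hτ.mem_of_add_mem_left hwC (y := k • v - w) ?_ ?_
    · intro q hq r hr
      rw [dotProduct_sub, dotProduct_sub, dotProduct_smul, dotProduct_smul, smul_eq_mul, smul_eq_mul]
      have h1 := eq_of_mem_argmin (hpu hq) hpv
      have h2 := eq_of_mem_argmin (hw (hpu hq)) (hw hpv)
      rw [h1, h2]
      linarith [hkq r hr]
    · rw [add_sub_cancel]
      exact PointedCone.smul_mem _ hk hv

theorem isComplete_pointFan (s : Set (Fin n → ℝ)) : IsComplete (pointFan s) :=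
  Set.eq_univ_of_forall fun _ =>
    Set.mem_biUnion (Set.mem_range_self _) (SetLike.mem_coe.2 self_mem_normalCone_argmin)

/-- Rationality and salience need checking only at single points, since every other normal cone is a
face of such a cone. -/
theorem isFan_pointFan (hs : s.Finite) (hne : s.Nonempty)
    (hrat : ∀ p ∈ s, IsRationalPolyhedral (normalCone s {p}))
    (hsal : ∀ p ∈ s, (normalCone s {p} : ConvexCone ℝ (Fin n → ℝ)).Salient) :
    IsFan (pointFan s) where
  finite := by
    refine (hs.finite_subsets.image (normalCone s)).subset ?_
    rintro _ ⟨u, rfl⟩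
    exact ⟨_, fun p hp => hp.1, rfl⟩
  nonempty := ⟨_, 0, rfl⟩
  rational := by
    rintro _ ⟨u, rfl⟩
    obtain ⟨p, hp⟩ := argmin_nonempty hs hne u
    obtain ⟨G, hG, h⟩ := hrat p hp.1
    refine ⟨{z ∈ G | intVec z ∈ normalCone s (argmin s u)}, hG.subset fun _ h => h.1, ?_⟩
    have heq : intVec '' G ∩ normalCone s (argmin s u) =
        intVec '' {z ∈ G | intVec z ∈ normalCone s (argmin s u)} := by
      ext x
      constructor
      · rintro ⟨⟨z, hz, rfl⟩, hx⟩
        exact ⟨z, ⟨hz, hx⟩, rfl⟩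
      · rintro ⟨z, ⟨hz, hx⟩, rfl⟩
        exact ⟨⟨z, hz, rfl⟩, hx⟩
    rw [← heq]
    exact isFaceOf_eq_hull (normalCone_argmin_isFaceOf_singleton hp) h
  strictlyConvex := by
    rintro _ ⟨u, rfl⟩
    obtain ⟨p, hp⟩ := argmin_nonempty hs hne u
    intro x hx hx0 hx'
    have hle := (normalCone_argmin_isFaceOf_singleton hp).le
    exact hsal p hp.1 x (hle hx) hx0 (hle hx')
  face_mem := by
    rintro _ ⟨u, rfl⟩ τ hτ
    obtain ⟨v, rfl⟩ := eq_normalCone_argmin_of_isFaceOf hs hne hτ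
    exact ⟨v, rfl⟩
  inter_face := by
    rintro _ ⟨u, rfl⟩ _ ⟨v, rfl⟩
    refine ⟨normalCone_argmin_isFaceOf hs hne, ?_⟩
    rw [inf_comm]
    exact normalCone_argmin_isFaceOf hs hne

theorem fanRays_pointFan_subset (hs : s.Finite) (hne : s.Nonempty)
    (hsal : ∀ p ∈ s, (normalCone s {p} : ConvexCone ℝ (Fin n → ℝ)).Salient)
    {R : Set (PointedCone ℝ (Fin n → ℝ))}
    (hR : ∀ p ∈ s, ∃ G : Set (Fin n → ℝ), normalCone s {p} = PointedCone.hull ℝ G ∧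
      ∀ g ∈ G, PointedCone.hull ℝ {g} ∈ R) : fanRays (pointFan s) ⊆ R := by
  rintro _ ⟨⟨u, rfl⟩, hdim⟩
  obtain ⟨p, hp⟩ := argmin_nonempty hs hne u
  obtain ⟨G, hG, hGR⟩ := hR p hp.1
  have heq := isFaceOf_eq_hull (normalCone_argmin_isFaceOf_singleton hp) hG
  have hsal' : (PointedCone.hull ℝ (G ∩ normalCone s (argmin s u)) :
      ConvexCone ℝ (Fin n → ℝ)).Salient := by
    rw [← heq]
    intro x hx hx0 hx'
    have hle := (normalCone_argmin_isFaceOf_singleton hp).le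
    exact hsal p hp.1 x (hle hx) hx0 (hle hx')
  change coneDim (normalCone s (argmin s u)) = 1 at hdim
  change normalCone s (argmin s u) ∈ R
  rw [heq] at hdim ⊢
  obtain ⟨g, hg, -, h⟩ := exists_eq_hull_singleton hsal' hdim
  rw [h]
  exact hGR g hg.1

theorem isProjective_pointFan {t : Set (Fin n → ℚ)} (ht : t.Finite) (hne : t.Nonempty) :
    IsProjective (pointFan (ratVec '' t)) :=
  ⟨_, ⟨t, ht, rfl⟩, (normalFan_convexHull (ht.image _) (hne.image _)).symm⟩

theorem IsProjective.exists_eq_pointFan {S : Set (PointedCone ℝ (Fin n → ℝ))} (hS : IsProjective S)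
    (hne : S.Nonempty) :
    ∃ t : Set (Fin n → ℚ), t.Finite ∧ t.Nonempty ∧ S = pointFan (ratVec '' t) := by
  obtain ⟨_, ⟨t, ht, rfl⟩, rfl⟩ := hS
  have htne : t.Nonempty := by
    rw [Set.nonempty_iff_ne_empty]
    rintro rfl
    obtain ⟨_, F, hF, ⟨x, hx⟩, -⟩ := hne
    obtain ⟨l, hl⟩ := hF ⟨x, hx⟩
    rw [hl] at hx
    simpa using hx.1
  exact ⟨t, ht, htne, normalFan_convexHull (ht.image _) (htne.image _)⟩

/-- A cyclic obstruction to the existence of a strictly convex support function: the edges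
`v (i + 1), w i` of the three sides of a triangular prism belong to the fan. -/
def IsTwisted (S : Set (PointedCone ℝ (Fin n → ℝ))) : Prop :=
  ∃ v w : Fin 3 → Fin n → ℝ, (∀ i, v i + w (i + 1) = v (i + 1) + w i) ∧
    ∀ i, PointedCone.hull ℝ {v (i + 1), w i} ∈ S ∧ v i ∉ PointedCone.hull ℝ {v (i + 1), w i}

/-- The support function `m u ⬝ᵥ u` is concave and linear on each cone of a normal fan. As the
diagonal `v (i + 1), w i` spans a cone not containing `v i`, the parallelogram relation gives a
strict inequality between the sums over the two diagonals. Added over the three sides, both totals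
agree: a contradiction. -/
theorem IsTwisted.not_isProjective {S : Set (PointedCone ℝ (Fin n → ℝ))} (h : IsTwisted S) :
    ¬ IsProjective S := by
  intro hS
  obtain ⟨v, w, hvw, hE⟩ := h
  obtain ⟨t, ht, htne, rfl⟩ := hS.exists_eq_pointFan ⟨_, (hE 0).1⟩
  have hs := ht.image ratVec
  have hne := htne.image ratVec
  set s := ratVec '' t
  choose m hm using argmin_nonempty hs hne
  have key : ∀ i, m (v i) ⬝ᵥ v i + m (w (i + 1)) ⬝ᵥ w (i + 1) <
      m (v (i + 1)) ⬝ᵥ v (i + 1) + m (w i) ⬝ᵥ w i := by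
    intro i
    obtain ⟨⟨u, hu⟩, hv⟩ := hE i
    have hu : normalCone s (argmin s u) = PointedCone.hull ℝ {v (i + 1), w i} := hu
    have h1 : argmin s u ⊆ argmin s (v (i + 1)) := by
      rw [← mem_normalCone_argmin, hu]; exact PointedCone.subset_hull (by simp)
    have h2 : argmin s u ⊆ argmin s (w i) := by
      rw [← mem_normalCone_argmin, hu]; exact PointedCone.subset_hull (by simp)
    have hsum : ∀ p, p ⬝ᵥ v i + p ⬝ᵥ w (i + 1) = p ⬝ᵥ v (i + 1) + p ⬝ᵥ w i := by
      intro p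
      rw [← dotProduct_add, ← dotProduct_add, hvw]
    by_contra hcon
    push Not at hcon
    apply hv
    rw [← hu, mem_normalCone_argmin]
    intro p hp
    refine mem_argmin_of_eq (hm (v i)) hp.1 ?_
    have e1 := eq_of_mem_argmin (h1 hp) (hm _)
    have e2 := eq_of_mem_argmin (h2 hp) (hm _)
    have e3 := (hm (v i)).2 p hp.1
    have e4 := (hm (w (i + 1))).2 p hp.1
    have e5 := hsum p
    linarith
  have k0 := key 0
  have k1 := key 1
  have k2 := key 2
  have e0 : (0 : Fin 3) + 1 = 1 := rfl
  have e1 : (1 : Fin 3) + 1 = 2 := rfl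
  have e2 : (2 : Fin 3) + 1 = 0 := rfl
  rw [e0] at k0
  rw [e1] at k1
  rw [e2] at k2
  linarith

end NormalFans

/-! ### Products with the fan of the projective line. -/

section Suspension

variable {n : ℕ}

/-- Forgetting the first coordinate. -/
def tailMap (n : ℕ) : (Fin (n + 1) → ℝ) →ₗ[ℝ] (Fin n → ℝ) := LinearMap.funLeft ℝ ℝ Fin.succ

/-- The inclusion of the coordinate hyperplane on which the first coordinate vanishes. -/
def consMap (n : ℕ) : (Fin n → ℝ) →ₗ[ℝ] (Fin (n + 1) → ℝ) where
  toFun x := Fin.cons 0 x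
  map_add' x y := by ext i; refine Fin.cases ?_ (fun j => ?_) i <;> simp
  map_smul' c x := by ext i; refine Fin.cases ?_ (fun j => ?_) i <;> simp

/-- The vector `(c, 0)`. -/
def pole (n : ℕ) (c : ℝ) : Fin (n + 1) → ℝ := Fin.cons c 0

@[simp] theorem tailMap_apply (y : Fin (n + 1) → ℝ) (i : Fin n) : tailMap n y i = y i.succ := rfl

@[simp] theorem consMap_zero (x : Fin n → ℝ) : consMap n x 0 = 0 := rfl

@[simp] theorem consMap_succ (x : Fin n → ℝ) (i : Fin n) : consMap n x i.succ = x i := rfl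

@[simp] theorem pole_zero (c : ℝ) : pole n c 0 = c := rfl

@[simp] theorem pole_succ (c : ℝ) (i : Fin n) : pole n c i.succ = 0 := rfl

@[simp] theorem tailMap_consMap (x : Fin n → ℝ) : tailMap n (consMap n x) = x := rfl

@[simp] theorem tailMap_pole (c : ℝ) : tailMap n (pole n c) = 0 := rfl

theorem consMap_add_pole (y : Fin (n + 1) → ℝ) : consMap n (tailMap n y) + pole n (y 0) = y := by
  ext i; refine Fin.cases ?_ (fun j => ?_) i <;> simp

theorem consMap_injective : Function.Injective (consMap n) :=
  Function.LeftInverse.injective tailMap_consMap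

theorem consMap_tailMap {y : Fin (n + 1) → ℝ} (h : y 0 = 0) : consMap n (tailMap n y) = y := by
  ext i; refine Fin.cases ?_ (fun j => ?_) i <;> simp [h]

theorem smul_pole (c d : ℝ) : c • pole n d = pole n (c * d) := by
  ext i; refine Fin.cases ?_ (fun j => ?_) i <;> simp

/-- The product of a cone with the half-line spanned by `z`. -/
def suspCone (σ : PointedCone ℝ (Fin n → ℝ)) (z : ℤ) : PointedCone ℝ (Fin (n + 1) → ℝ) :=
  σ.comap (tailMap n) ⊓ (PointedCone.hull ℝ {(z : ℝ)}).comap (LinearMap.proj 0)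

theorem mem_suspCone {σ : PointedCone ℝ (Fin n → ℝ)} {z : ℤ} {y : Fin (n + 1) → ℝ} :
    y ∈ suspCone σ z ↔ tailMap n y ∈ σ ∧ ∃ α : ℝ, 0 ≤ α ∧ y 0 = α * z := by
  change tailMap n y ∈ σ ∧ y 0 ∈ PointedCone.hull ℝ {(z : ℝ)} ↔ _
  rw [mem_hull_singleton]; rfl

theorem consMap_mem_suspCone {σ : PointedCone ℝ (Fin n → ℝ)} {z : ℤ} {x : Fin n → ℝ} :
    consMap n x ∈ suspCone σ z ↔ x ∈ σ := by
  rw [mem_suspCone]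
  exact ⟨fun h => h.1, fun h => ⟨h, 0, le_rfl, by simp⟩⟩

theorem pole_mem_suspCone {σ : PointedCone ℝ (Fin n → ℝ)} {z : ℤ} : pole n z ∈ suspCone σ z :=
  mem_suspCone.2 ⟨by simp, 1, zero_le_one, by simp⟩

/-- For `z = 0` the half-line degenerates, so `suspCone σ 0` is a copy of `σ` in the hyperplane. -/
theorem mem_suspCone_zero {σ : PointedCone ℝ (Fin n → ℝ)} {y : Fin (n + 1) → ℝ} :
    y ∈ suspCone σ 0 ↔ tailMap n y ∈ σ ∧ y 0 = 0 := by
  rw [mem_suspCone]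
  exact ⟨fun ⟨h, _, _, h2⟩ => ⟨h, by simpa using h2⟩, fun ⟨h, h2⟩ => ⟨h, 0, le_rfl, by simpa using h2⟩⟩

theorem comap_suspCone (σ : PointedCone ℝ (Fin n → ℝ)) (z : ℤ) :
    (suspCone σ z).comap (consMap n) = σ := by
  ext x; exact consMap_mem_suspCone

theorem suspCone_injective (z : ℤ) :
    Function.Injective fun σ : PointedCone ℝ (Fin n → ℝ) => suspCone σ z := fun σ τ h => by
  rw [← comap_suspCone σ z, ← comap_suspCone τ z]; exact congrArg _ h

theorem suspCone_hull (G : Set (Fin n → ℝ)) (z : ℤ) :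
    suspCone (PointedCone.hull ℝ G) z = PointedCone.hull ℝ (insert (pole n z) (consMap n '' G)) := by
  apply le_antisymm
  · intro y hy
    obtain ⟨h, α, hα, h0⟩ := mem_suspCone.1 hy
    refine mem_hull_insert.2 ⟨α, hα, consMap n (tailMap n y), ?_, ?_⟩
    · have : consMap n (tailMap n y) ∈ (PointedCone.hull ℝ G).map (consMap n) :=
        PointedCone.mem_map.2 ⟨_, h, rfl⟩
      rwa [PointedCone.map, PointedCone.hull, Submodule.map_span] at this
    · rw [smul_pole, ← h0]
      exact ((add_comm _ _).trans (consMap_add_pole y)).symm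
  · refine Submodule.span_le.2 ?_
    rintro _ (rfl | ⟨g, hg, rfl⟩)
    · exact pole_mem_suspCone
    · exact consMap_mem_suspCone.2 (PointedCone.subset_hull hg)

theorem suspCone_hull_zero (G : Set (Fin n → ℝ)) :
    suspCone (PointedCone.hull ℝ G) 0 = PointedCone.hull ℝ (consMap n '' G) := by
  rw [suspCone_hull]
  apply le_antisymm _ (Submodule.span_mono (Set.subset_insert _ _))
  refine Submodule.span_le.2 ?_
  rintro _ (rfl | hg)
  · have : pole n ((0 : ℤ) : ℝ) = 0 := by
      ext i; refine Fin.cases ?_ (fun j => ?_) i <;> simp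
    rw [this]; exact zero_mem _
  · exact PointedCone.subset_hull hg

theorem suspCone_isFaceOf {σ τ : PointedCone ℝ (Fin n → ℝ)} (h : τ.IsFaceOf σ) (z : ℤ) :
    (suspCone τ z).IsFaceOf (suspCone σ z) :=
  (h.comap _).inf .rfl

theorem suspCone_zero_isFaceOf (σ : PointedCone ℝ (Fin n → ℝ)) (z : ℤ) :
    (suspCone σ 0).IsFaceOf (suspCone σ z) := by
  refine isFaceOf_of_add_mem (fun y hy => ?_) fun x hx y hy h => ?_
  · obtain ⟨h1, h2⟩ := mem_suspCone_zero.1 hy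
    exact mem_suspCone.2 ⟨h1, 0, le_rfl, by simpa using h2⟩
  · obtain ⟨h1, α, hα, hx0⟩ := mem_suspCone.1 hx
    obtain ⟨h2, β, hβ, hy0⟩ := mem_suspCone.1 hy
    have h0 := (mem_suspCone_zero.1 h).2
    refine mem_suspCone_zero.2 ⟨h1, ?_⟩
    rw [Pi.add_apply, hx0, hy0, ← add_mul] at h0
    rcases mul_eq_zero.1 h0 with h0 | h0
    · have : α = 0 := by linarith
      rw [hx0, this, zero_mul]
    · rw [hx0, h0, mul_zero]

theorem salient_suspCone {σ : PointedCone ℝ (Fin n → ℝ)}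
    (hσ : (σ : ConvexCone ℝ (Fin n → ℝ)).Salient) (z : ℤ) :
    (suspCone σ z : ConvexCone ℝ (Fin (n + 1) → ℝ)).Salient := by
  intro x hx hx0 hx'
  obtain ⟨h1, α, hα, e1⟩ := mem_suspCone.1 hx
  obtain ⟨h2, β, hβ, e2⟩ := mem_suspCone.1 hx'
  have ht := eq_zero_of_salient hσ h1 (by rwa [map_neg] at h2)
  have h0 : x 0 = 0 := by
    rw [Pi.neg_apply, e1] at e2
    have h0 : (α + β) * (z : ℝ) = 0 := by linarith
    rcases mul_eq_zero.1 h0 with h0 | h0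
    · have : α = 0 := by linarith
      rw [e1, this, zero_mul]
    · rw [e1, h0, mul_zero]
  apply hx0
  rw [← consMap_tailMap h0, ht, map_zero]

/-- With each `y` the face contains its hyperplane part and its pole part; whether it contains the
pole decides between the two forms. -/
theorem exists_eq_suspCone_of_isFaceOf {σ : PointedCone ℝ (Fin n → ℝ)} {z : ℤ}
    {F : PointedCone ℝ (Fin (n + 1) → ℝ)} (hF : F.IsFaceOf (suspCone σ z)) :
    ∃ τ : PointedCone ℝ (Fin n → ℝ), τ.IsFaceOf σ ∧ (F = suspCone τ z ∨ F = suspCone τ 0) := by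
  refine ⟨F.comap (consMap n), comap_suspCone σ z ▸ hF.comap (consMap n), ?_⟩
  have hsplit : ∀ y ∈ F, consMap n (tailMap n y) ∈ F ∧ pole n (y 0) ∈ F := by
    intro y hy
    obtain ⟨h1, α, hα, h0⟩ := mem_suspCone.1 (hF.le hy)
    have h2 : pole n (y 0) ∈ suspCone σ z := by
      rw [h0, ← smul_pole]; exact PointedCone.smul_mem _ hα pole_mem_suspCone
    rw [← consMap_add_pole y] at hy
    exact (hF.add_mem_iff_mem (consMap_mem_suspCone.2 h1) h2).1 hy
  by_cases hz : pole n z ∈ F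
  · left
    ext y
    rw [mem_suspCone]
    constructor
    · intro hy
      obtain ⟨-, h⟩ := mem_suspCone.1 (hF.le hy)
      exact ⟨(hsplit y hy).1, h⟩
    · rintro ⟨h1, α, hα, h0⟩
      rw [← consMap_add_pole y, h0, ← smul_pole]
      exact add_mem h1 (PointedCone.smul_mem _ hα hz)
  · right
    ext y
    rw [mem_suspCone_zero]
    constructor
    · intro hy
      obtain ⟨-, α, hα, h0⟩ := mem_suspCone.1 (hF.le hy)
      refine ⟨(hsplit y hy).1, ?_⟩
      rcases hα.eq_or_lt with rfl | hα
      · rw [h0, zero_mul]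
      · exfalso
        apply hz
        have := (hsplit y hy).2
        rwa [h0, ← smul_pole, PointedCone.smul_mem_iff _ hα] at this
    · rintro ⟨h1, h0⟩
      rw [← consMap_tailMap h0]
      exact h1

theorem isRationalPolyhedral_suspCone {σ : PointedCone ℝ (Fin n → ℝ)}
    (hσ : IsRationalPolyhedral σ) (z : ℤ) : IsRationalPolyhedral (suspCone σ z) := by
  obtain ⟨s, hs, rfl⟩ := hσ
  refine ⟨insert (Fin.cons z 0) ((fun x => Fin.cons 0 x) '' s), (hs.image _).insert _, ?_⟩
  rw [suspCone_hull, Set.image_insert_eq, Set.image_image, Set.image_image]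
  congr 1
  congr 1
  · ext i; refine Fin.cases ?_ (fun j => ?_) i <;> simp [intVec]
  · refine Set.image_congr fun x _ => ?_
    ext i; refine Fin.cases ?_ (fun j => ?_) i <;> simp [intVec]

/-- The suspension of a fan: the product with the fan of the projective line. -/
def susp (S : Set (PointedCone ℝ (Fin n → ℝ))) : Set (PointedCone ℝ (Fin (n + 1) → ℝ)) :=
  Set.image2 suspCone S {0, 1, -1}

/-- The rays of the suspension of a fan whose rays are in `R`. -/
def suspRays (R : Set (PointedCone ℝ (Fin n → ℝ))) : Set (PointedCone ℝ (Fin (n + 1) → ℝ)) :=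
  (fun ρ => suspCone ρ 0) '' R ∪ {PointedCone.hull ℝ {pole n 1}, PointedCone.hull ℝ {pole n (-1)}}

variable {R S : Set (PointedCone ℝ (Fin n → ℝ))}

theorem suspCone_zero_mem_susp {σ : PointedCone ℝ (Fin n → ℝ)} (hσ : σ ∈ S) :
    suspCone σ 0 ∈ susp S := ⟨σ, hσ, 0, by simp, rfl⟩

theorem susp_mono {S' : Set (PointedCone ℝ (Fin n → ℝ))} (h : S ⊆ S') : susp S ⊆ susp S' :=
  Set.image2_subset_right h

theorem suspCone_inf_isFaceOf {σ τ : PointedCone ℝ (Fin n → ℝ)} (h : (σ ⊓ τ).IsFaceOf σ)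
    (z z' : ℤ) : (suspCone σ z ⊓ suspCone τ z').IsFaceOf (suspCone σ z) := by
  refine isFaceOf_of_add_mem inf_le_left fun x hx y hy hxy => ⟨hx, ?_⟩
  obtain ⟨h1, α, hα, e1⟩ := mem_suspCone.1 hx
  obtain ⟨h2, β, hβ, e2⟩ := mem_suspCone.1 hy
  obtain ⟨h3, γ, hγ, e3⟩ := mem_suspCone.1 hxy.2
  rw [map_add] at h3
  refine mem_suspCone.2 ⟨(h.mem_of_add_mem_left h1 h2 ⟨add_mem h1 h2, h3⟩).2, ?_⟩
  rw [Pi.add_apply, e1, e2] at e3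
  by_cases hαβ : α + β = 0
  · have : α = 0 := by linarith
    exact ⟨0, le_rfl, by rw [e1, this, zero_mul, zero_mul]⟩
  · refine ⟨γ * (α / (α + β)), by positivity, ?_⟩
    have : γ * (α / (α + β)) * z' = α / (α + β) * (γ * z') := by ring
    rw [this, ← e3, e1]
    field_simp

theorem IsFan.susp (hS : IsFan S) : IsFan (susp S) where
  finite := hS.finite.image2 _ (by simp)
  nonempty := hS.nonempty.image2 ⟨0, by simp⟩
  rational := by
    rintro _ ⟨σ, hσ, z, -, rfl⟩
    exact isRationalPolyhedral_suspCone (hS.rational σ hσ) z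
  strictlyConvex := by
    rintro _ ⟨σ, hσ, z, -, rfl⟩
    exact salient_suspCone (hS.strictlyConvex σ hσ) z
  face_mem := by
    rintro _ ⟨σ, hσ, z, hz, rfl⟩ F hF
    obtain ⟨τ, hτ, rfl | rfl⟩ := exists_eq_suspCone_of_isFaceOf hF
    · exact ⟨τ, hS.face_mem σ hσ τ hτ, z, hz, rfl⟩
    · exact suspCone_zero_mem_susp (hS.face_mem σ hσ τ hτ)
  inter_face := by
    rintro _ ⟨σ, hσ, z, -, rfl⟩ _ ⟨τ, hτ, z', -, rfl⟩
    refine ⟨suspCone_inf_isFaceOf (hS.inter_face σ hσ τ hτ).1 z z', ?_⟩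
    rw [inf_comm]
    exact suspCone_inf_isFaceOf (hS.inter_face τ hτ σ hσ).1 z' z

theorem isComplete_susp (hS : IsComplete S) : IsComplete (susp S) := by
  refine Set.eq_univ_of_forall fun y => ?_
  have : tailMap n y ∈ ⋃ σ ∈ S, (σ : Set (Fin n → ℝ)) := by
    have : ⋃ σ ∈ S, (σ : Set (Fin n → ℝ)) = Set.univ := hS
    rw [this]; trivial
  obtain ⟨σ, hσ, hy⟩ := Set.mem_iUnion₂.1 this
  rcases le_total 0 (y 0) with h | h
  · exact Set.mem_biUnion (⟨σ, hσ, 1, by simp, rfl⟩ : suspCone σ 1 ∈ susp S)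
      (mem_suspCone.2 ⟨hy, y 0, h, by simp⟩)
  · exact Set.mem_biUnion (⟨σ, hσ, -1, by simp, rfl⟩ : suspCone σ (-1) ∈ susp S)
      (mem_suspCone.2 ⟨hy, -y 0, by linarith, by simp⟩)

theorem consMap_intVec (v : Fin n → ℤ) :
    consMap n (intVec v) = intVec (Fin.cons 0 v : Fin (n + 1) → ℤ) := by
  ext i; refine Fin.cases ?_ (fun j => ?_) i <;> simp [intVec]

theorem pole_intCast (z : ℤ) : pole n z = intVec (Fin.cons z 0 : Fin (n + 1) → ℤ) := by
  ext i; refine Fin.cases ?_ (fun j => ?_) i <;> simp [intVec]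

theorem suspCone_hull_singleton_zero (g : Fin n → ℝ) :
    suspCone (PointedCone.hull ℝ {g}) 0 = PointedCone.hull ℝ {consMap n g} := by
  rw [suspCone_hull_zero, Set.image_singleton]

theorem fanRays_susp_subset (hS : IsFan S) (hR : fanRays S ⊆ R) :
    fanRays (susp S) ⊆ suspRays R := by
  rintro _ ⟨⟨σ, hσ, z, hz, rfl⟩, hdim⟩
  obtain ⟨s, hs, rfl⟩ := hS.rational σ hσ
  have hsal := salient_suspCone (hS.strictlyConvex _ hσ) z
  rw [suspCone_hull] at hsal hdim ⊢
  obtain ⟨g, hg, hg0, heq⟩ := exists_eq_hull_singleton hsal hdim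
  rcases hg with rfl | ⟨g, hg, rfl⟩
  · rw [heq]
    right
    simp only [Set.mem_insert_iff, Set.mem_singleton_iff] at hz ⊢
    rcases hz with rfl | rfl | rfl
    · exact absurd (by ext i; refine Fin.cases ?_ (fun j => ?_) i <;> simp) hg0
    · left; simp
    · right; simp
  · rw [heq, ← suspCone_hull_singleton_zero]
    refine Or.inl ⟨_, hR ?_, rfl⟩
    rw [← suspCone_hull, ← suspCone_hull_singleton_zero] at heq
    have : PointedCone.hull ℝ (intVec '' s) = PointedCone.hull ℝ {g} := by
      rw [← comap_suspCone (PointedCone.hull ℝ (intVec '' s)) z, heq, comap_suspCone]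
    rw [← this]
    refine ⟨hσ, ?_⟩
    rw [this]
    exact coneDim_hull_singleton fun h => hg0 (by rw [h, map_zero])

theorem isRay_suspRays (hR : ∀ ρ ∈ R, IsRay ρ) : ∀ ρ ∈ suspRays R, IsRay ρ := by
  rintro _ (⟨ρ, hρ, rfl⟩ | rfl | rfl)
  · obtain ⟨v, hv, rfl⟩ := hR ρ hρ
    refine ⟨Fin.cons 0 v, fun h => hv ?_, ?_⟩
    · funext i; exact congrFun h i.succ
    · dsimp only
      rw [suspCone_hull_singleton_zero, consMap_intVec]
  · refine ⟨Fin.cons 1 0, fun h => one_ne_zero (congrFun h 0), ?_⟩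
    rw [← pole_intCast]; simp
  · refine ⟨Fin.cons (-1) 0, fun h => by simpa using congrFun h 0, ?_⟩
    rw [← pole_intCast]; simp

theorem finite_suspRays (hR : R.Finite) : (suspRays R).Finite :=
  (hR.image _).union (by simp)

/-- The part of a fan in a coordinate hyperplane. -/
def slice (S' : Set (PointedCone ℝ (Fin (n + 1) → ℝ))) : Set (PointedCone ℝ (Fin n → ℝ)) :=
  {σ | suspCone σ 0 ∈ S'}

variable {S' : Set (PointedCone ℝ (Fin (n + 1) → ℝ))}

theorem suspCone_bot : suspCone (⊥ : PointedCone ℝ (Fin n → ℝ)) 0 = ⊥ := by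
  rw [← Submodule.span_empty, suspCone_hull_zero, Set.image_empty, PointedCone.hull,
    Submodule.span_empty]

theorem IsFan.slice (hS : IsFan S') : IsFan (slice S') where
  finite := hS.finite.preimage (suspCone_injective 0).injOn
  nonempty := ⟨⊥, by
    change suspCone ⊥ 0 ∈ S'
    rw [suspCone_bot]; exact hS.bot_mem⟩
  rational := by
    intro σ hσ
    obtain ⟨s, hs, h⟩ := hS.rational _ hσ
    refine ⟨(fun v i => v (Fin.succ i)) '' s, hs.image _, ?_⟩
    have h1 : σ = (suspCone σ 0).map (tailMap n) := by
      ext x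
      rw [PointedCone.mem_map]
      constructor
      · exact fun hx => ⟨consMap n x, consMap_mem_suspCone.2 hx, rfl⟩
      · rintro ⟨y, hy, rfl⟩
        exact (mem_suspCone_zero.1 hy).1
    rw [h1, h, PointedCone.map, PointedCone.hull, Submodule.map_span, Set.image_image,
      Set.image_image]
    rfl
  strictlyConvex := by
    intro σ hσ x hx hx0 hx'
    refine hS.strictlyConvex _ hσ (consMap n x) (consMap_mem_suspCone.2 hx) (fun h => hx0 ?_) ?_
    · exact consMap_injective (h.trans (map_zero _).symm)
    · rw [← map_neg]; exact consMap_mem_suspCone.2 hx'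
  face_mem σ hσ τ hτ := hS.face_mem _ hσ _ (suspCone_isFaceOf hτ 0)
  inter_face := by
    intro σ hσ τ hτ
    obtain ⟨h1, h2⟩ := hS.inter_face _ hσ _ hτ
    have h1 := h1.comap (consMap n)
    have h2 := h2.comap (consMap n)
    have h3 : (suspCone σ 0 ⊓ suspCone τ 0).comap (consMap n) = σ ⊓ τ := by
      ext x
      exact and_congr consMap_mem_suspCone consMap_mem_suspCone
    rw [h3, comap_suspCone] at h1 h2
    exact ⟨h1, h2⟩

theorem zero_eq_of_mem_suspRays {g : Fin (n + 1) → ℝ}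
    (h : PointedCone.hull ℝ {g} ∈ suspRays R) :
    (g 0 = 0 ∧ ∃ ρ ∈ R, PointedCone.hull ℝ {g} = suspCone ρ 0) ∨ tailMap n g = 0 := by
  rcases h with ⟨ρ, hρ, h⟩ | h | h
  · dsimp only at h
    have := mem_hull_self g
    rw [← h] at this
    exact Or.inl ⟨(mem_suspCone_zero.1 this).2, ρ, hρ, h.symm⟩
  all_goals
    right
    have := mem_hull_self g
    rw [h] at this
    obtain ⟨α, -, rfl⟩ := mem_hull_singleton.1 this
    simp

theorem fanRays_slice_subset (hS : IsFan S') (hR : fanRays S' ⊆ suspRays R) :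
    fanRays (slice S') ⊆ R := by
  rintro σ ⟨hσ, hdim⟩
  obtain ⟨s, hs, rfl⟩ := hS.slice.rational σ hσ
  obtain ⟨g, -, hg0, heq⟩ := exists_eq_hull_singleton (hS.slice.strictlyConvex _ hσ) hdim
  rw [heq] at hσ ⊢
  have hv : IsVertex S' (consMap n g) := by
    refine ⟨fun h => hg0 (consMap_injective (h.trans (map_zero _).symm)), ?_⟩
    rw [← suspCone_hull_singleton_zero]; exact hσ
  rcases zero_eq_of_mem_suspRays (hR hv.mem_fanRays) with ⟨-, ρ, hρ, h⟩ | h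
  · rw [← suspCone_hull_singleton_zero] at h
    rwa [suspCone_injective 0 h]
  · exact absurd h hg0

/-- A fan with rays in `suspRays R` is contained in the suspension of its slice. -/
theorem subset_susp_slice (hS : IsFan S') (hR : fanRays S' ⊆ suspRays R) :
    S' ⊆ susp (slice S') := by
  intro C hC
  obtain ⟨G, -, hG, hGv⟩ := hS.exists_generators hC
  have hsal := hS.strictlyConvex _ hC
  have hGC : ∀ g ∈ G, g ∈ C := fun g hg => hG ▸ PointedCone.subset_hull hg
  have hG0 : ∀ g ∈ G, g 0 = 0 ∨ tailMap n g = 0 := fun g hg =>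
    (zero_eq_of_mem_suspRays (hR (hGv g hg).mem_fanRays)).imp And.left id
  have hpole : ∀ g ∈ G, g 0 ≠ 0 → pole n (g 0) ∈ C := by
    intro g hg h
    have h2 := consMap_add_pole g
    rw [(hG0 g hg).resolve_left h, map_zero, zero_add] at h2
    rw [h2]; exact hGC g hg
  -- Each generator lies in the hyperplane or on the axis, and by salience `C` contains at most one
  -- pole. So `C` is the product of its hyperplane part with the half-line of that pole, or with
  -- zero.
  have main : ∀ z ∈ ({0, 1, -1} : Set ℤ), pole n z ∈ C →
      (∀ g ∈ G, ∃ α : ℝ, 0 ≤ α ∧ g 0 = α * z) → C ∈ susp (slice S') := by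
    intro z hz hzC hGz
    have heq : C = suspCone (C.comap (consMap n)) z := by
      apply le_antisymm
      · conv_lhs => rw [hG]
        refine Submodule.span_le.2 fun g hg => mem_suspCone.2 ⟨?_, hGz g hg⟩
        rcases hG0 g hg with h | h
        · rw [PointedCone.mem_comap, consMap_tailMap h]; exact hGC g hg
        · rw [h]; exact zero_mem _
      · intro y hy
        obtain ⟨h, α, hα, h0⟩ := mem_suspCone.1 hy
        rw [← consMap_add_pole y, h0, ← smul_pole]
        exact add_mem h (PointedCone.smul_mem _ hα hzC)
    refine ⟨C.comap (consMap n), ?_, z, hz, heq.symm⟩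
    refine hS.face_mem C hC _ ?_
    conv_rhs => rw [heq]
    exact suspCone_zero_isFaceOf _ _
  have hunit : ∀ {c : ℝ} (t : ℝ), 0 < t → pole n (t * c) ∈ C → pole n c ∈ C := by
    intro c t ht h
    rwa [← smul_pole, PointedCone.smul_mem_iff _ ht] at h
  have hnot : ¬ (pole n 1 ∈ C ∧ pole n (-1) ∈ C) := by
    rintro ⟨h1, h2⟩
    have h3 : pole n (-1) = -pole n 1 := by
      ext i; refine Fin.cases ?_ (fun j => ?_) i <;> simp
    have := congrFun (eq_zero_of_salient hsal h1 (h3 ▸ h2)) 0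
    simp at this
  have hposC : ∀ g ∈ G, 0 < g 0 → pole n 1 ∈ C := fun g hg h =>
    hunit (g 0) h (by simpa using hpole g hg h.ne')
  have hnegC : ∀ g ∈ G, g 0 < 0 → pole n (-1) ∈ C := fun g hg h =>
    hunit (-g 0) (by linarith) (by simpa using hpole g hg h.ne)
  by_cases h1 : pole n 1 ∈ C
  · refine main 1 (by simp) (by simpa using h1) fun g hg => ⟨g 0, ?_, by simp⟩
    by_contra h
    exact hnot ⟨h1, hnegC g hg (not_le.1 h)⟩
  by_cases h2 : pole n (-1) ∈ C
  · refine main (-1) (by simp) (by simpa using h2) fun g hg => ⟨-g 0, ?_, by simp⟩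
    by_contra h
    exact hnot ⟨hposC g hg (by linarith), h2⟩
  · refine main 0 (by simp) ?_ fun g hg => ⟨0, le_rfl, ?_⟩
    · have : pole n ((0 : ℤ) : ℝ) = 0 := by
        ext i; refine Fin.cases ?_ (fun j => ?_) i <;> simp
      rw [this]; exact zero_mem _
    · rcases lt_trichotomy (g 0) 0 with h | h | h
      · exact absurd (hnegC g hg h) h2
      · simpa using h
      · exact absurd (hposC g hg h) h1

/-- By `subset_susp_slice` a maximal fan equals the suspension of its slice. The slice is maximal
too, since a larger one would suspend to a larger fan. -/
theorem isComplete_of_isMaximalFan_suspRays (hR : ∀ S, IsMaximalFan R S → IsComplete S)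
    (hS : IsMaximalFan (suspRays R) S') : IsComplete S' := by
  obtain ⟨hfan, hrays⟩ := hS.prop
  have hsub := subset_susp_slice hfan hrays
  have hslice : IsMaximalFan R (slice S') := by
    refine ⟨⟨hfan.slice, fanRays_slice_subset hfan hrays⟩, fun S₁ hS₁ hle σ hσ => ?_⟩
    exact hS.le_of_ge ⟨hS₁.1.susp, fanRays_susp_subset hS₁.1 hS₁.2⟩
      (hsub.trans (susp_mono hle)) (suspCone_zero_mem_susp hσ)
  have hle : susp (slice S') ⊆ S' :=
    hS.le_of_ge ⟨hfan.slice.susp, fanRays_susp_subset hfan.slice hslice.prop.2⟩ hsub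
  exact subset_antisymm hsub hle ▸ isComplete_susp (hR _ hslice)

/-- Adding a coordinate with values `0` and `1` to a set of points. -/
def prismPoints (s : Set (Fin n → ℝ)) : Set (Fin (n + 1) → ℝ) :=
  Set.image2 (fun p t => consMap n p + pole n t) s {0, 1}

theorem add_pole_dotProduct (p : Fin n → ℝ) (t : ℝ) (y : Fin (n + 1) → ℝ) :
    (consMap n p + pole n t) ⬝ᵥ y = p ⬝ᵥ tailMap n y + t * y 0 := by
  simp [dotProduct, Fin.sum_univ_succ]
  ring

/-- The last two inequalities say that `t` minimizes `t * y 0` over `{0, 1}`. -/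
theorem mem_argmin_prismPoints {s : Set (Fin n → ℝ)} {p : Fin n → ℝ} {t : ℝ}
    {y : Fin (n + 1) → ℝ} : consMap n p + pole n t ∈ argmin (prismPoints s) y ↔
      p ∈ argmin s (tailMap n y) ∧ t ∈ ({0, 1} : Set ℝ) ∧ t * y 0 ≤ 0 ∧ t * y 0 ≤ y 0 := by
  constructor
  · rintro ⟨⟨p', hp', t', ht', h⟩, hmin⟩
    have e1 : p' = p := by
      have := congrArg (tailMap n) h
      simpa using this
    have e2 : t' = t := by
      have := congrFun h 0
      simpa using this
    subst e1 e2
    have hmin' : ∀ q ∈ s, ∀ r ∈ ({0, 1} : Set ℝ),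
        p' ⬝ᵥ tailMap n y + t' * y 0 ≤ q ⬝ᵥ tailMap n y + r * y 0 := by
      intro q hq r hr
      have := hmin _ ⟨q, hq, r, hr, rfl⟩
      rwa [add_pole_dotProduct, add_pole_dotProduct] at this
    refine ⟨⟨hp', fun q hq => ?_⟩, ht', ?_, ?_⟩
    · linarith [hmin' q hq t' ht']
    · linarith [hmin' p' hp' 0 (by simp)]
    · linarith [hmin' p' hp' 1 (by simp)]
  · rintro ⟨hp, ht, h0, h1⟩
    refine ⟨⟨p, hp.1, t, ht, rfl⟩, ?_⟩
    rintro _ ⟨q, hq, r, hr, rfl⟩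
    rw [add_pole_dotProduct, add_pole_dotProduct]
    have := hp.2 q hq
    rcases hr with rfl | rfl <;> linarith

/-- The sign of `y 0` selects the end `0`, both ends or the end `1` of the segment, with normal
cones spanned by `1`, `0` and `-1`. -/
theorem normalCone_prismPoints {s : Set (Fin n → ℝ)} (hs : s.Finite) (hne : s.Nonempty)
    {y : Fin (n + 1) → ℝ} {z : ℤ} (hz : (0 < y 0 ∧ z = 1) ∨ (y 0 = 0 ∧ z = 0) ∨ (y 0 < 0 ∧ z = -1)) :
    normalCone (prismPoints s) (argmin (prismPoints s) y) =
      suspCone (normalCone s (argmin s (tailMap n y))) z := by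
  obtain ⟨p₀, hp₀⟩ := argmin_nonempty hs hne (tailMap n y)
  ext x
  rw [mem_normalCone_argmin, mem_suspCone, mem_normalCone_argmin]
  have hleft : argmin (prismPoints s) y ⊆ argmin (prismPoints s) x ↔
      ∀ p ∈ argmin s (tailMap n y), ∀ t ∈ ({0, 1} : Set ℝ), t * y 0 ≤ 0 → t * y 0 ≤ y 0 →
        p ∈ argmin s (tailMap n x) ∧ t * x 0 ≤ 0 ∧ t * x 0 ≤ x 0 := by
    constructor
    · intro h p hp t ht h0 h1
      have := mem_argmin_prismPoints.1 (h (mem_argmin_prismPoints.2 ⟨hp, ht, h0, h1⟩))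
      exact ⟨this.1, this.2.2⟩
    · intro h r hr
      obtain ⟨p, -, t, -, rfl⟩ := hr.1
      obtain ⟨hp, ht, h0, h1⟩ := mem_argmin_prismPoints.1 hr
      obtain ⟨h2, h3⟩ := h p hp t ht h0 h1
      exact mem_argmin_prismPoints.2 ⟨h2, ht, h3⟩
  rw [hleft]
  rcases hz with ⟨hy, rfl⟩ | ⟨hy, rfl⟩ | ⟨hy, rfl⟩
  · constructor
    · intro h
      have h' := fun p hp => h p hp 0 (by simp) (by simp) (by simpa using hy.le)
      exact ⟨fun p hp => (h' p hp).1, x 0, by simpa using (h' p₀ hp₀).2.2, by simp⟩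
    · rintro ⟨h, α, hα, h0⟩ p hp t (rfl | rfl) h2 h3
      · exact ⟨h hp, by simp, by simpa [h0] using hα⟩
      · linarith
  · constructor
    · intro h
      have h0 := fun p hp => h p hp 0 (by simp) (by simp) (by simp [hy])
      have h1 := fun p hp => h p hp 1 (by simp) (by simp [hy]) (by simp)
      refine ⟨fun p hp => (h0 p hp).1, 0, le_rfl, ?_⟩
      have e0 := (h0 p₀ hp₀).2.2
      have e1 := (h1 p₀ hp₀).2.1
      simp at e0 e1 ⊢
      linarith
    · rintro ⟨h, α, hα, h0⟩ p hp t ht h2 h3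
      have h0 : x 0 = 0 := by simpa using h0
      exact ⟨h hp, by simp [h0], by simp [h0]⟩
  · constructor
    · intro h
      have h' := fun p hp => h p hp 1 (by simp) (by simpa using hy.le) (by simp)
      exact ⟨fun p hp => (h' p hp).1, -x 0, by simpa using (h' p₀ hp₀).2.1, by simp⟩
    · rintro ⟨h, α, hα, h0⟩ p hp t (rfl | rfl) h2 h3
      · linarith
      · exact ⟨h hp, by simpa [h0] using hα, by simp⟩

theorem susp_pointFan {s : Set (Fin n → ℝ)} (hs : s.Finite) (hne : s.Nonempty) :
    susp (pointFan s) = pointFan (prismPoints s) := by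
  ext C
  constructor
  · rintro ⟨_, ⟨u, rfl⟩, z, hz, rfl⟩
    refine ⟨consMap n u + pole n z, ?_⟩
    dsimp only
    rw [normalCone_prismPoints hs hne (z := z)]
    · simp
    · rcases hz with rfl | rfl | rfl <;> simp
  · rintro ⟨y, rfl⟩
    dsimp only
    rcases lt_trichotomy (y 0) 0 with h | h | h
    · rw [normalCone_prismPoints hs hne (.inr (.inr ⟨h, rfl⟩))]
      exact ⟨_, ⟨_, rfl⟩, _, by simp, rfl⟩
    · rw [normalCone_prismPoints hs hne (.inr (.inl ⟨h, rfl⟩))]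
      exact ⟨_, ⟨_, rfl⟩, _, by simp, rfl⟩
    · rw [normalCone_prismPoints hs hne (.inl ⟨h, rfl⟩)]
      exact ⟨_, ⟨_, rfl⟩, _, by simp, rfl⟩

theorem isProjective_susp (hS : IsProjective S) (hne : S.Nonempty) : IsProjective (susp S) := by
  obtain ⟨t, ht, htne, rfl⟩ := hS.exists_eq_pointFan hne
  rw [susp_pointFan (ht.image _) (htne.image _)]
  have : prismPoints (ratVec '' t) =
      ratVec '' Set.image2 (fun p c => (Fin.cons c p : Fin (n + 1) → ℚ)) t {0, 1} := by
    rw [prismPoints, Set.image2_image_left, Set.image_image2]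
    have h01 : ({0, 1} : Set ℝ) = (fun c : ℚ => (c : ℝ)) '' {0, 1} := by
      rw [Set.image_pair]; simp
    rw [h01, Set.image2_image_right]
    refine Set.image2_congr fun p _ c _ => ?_
    ext i; refine Fin.cases ?_ (fun j => ?_) i <;> simp [ratVec]
  rw [this]
  exact isProjective_pointFan (ht.image2 _ (by simp)) (htne.image2 ⟨0, by simp⟩)

theorem exists_family_of_isSimplicial {V : Type*} [AddCommGroup V] [Module ℝ V]
    {C : PointedCone ℝ V} (hC : C.IsSimplicial) :
    ∃ s : Finset V, LinearIndependent ℝ (fun x : s => (x : V)) ∧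
      PointedCone.hull ℝ (Set.range fun x : s => (x : V)) = C := by
  obtain ⟨s, hs, hli, rfl⟩ := hC
  lift s to Finset V using hs
  exact ⟨s, hli, by simp⟩

theorem isSimplicial_suspCone_iff {σ : PointedCone ℝ (Fin n → ℝ)} :
    (suspCone σ 0).IsSimplicial ↔ σ.IsSimplicial := by
  constructor
  · intro h
    obtain ⟨s, hs, hC⟩ := exists_family_of_isSimplicial h
    have h0 : ∀ x : s, consMap n (tailMap n x) = x := fun x => by
      have hx : (x : Fin (n + 1) → ℝ) ∈ suspCone σ 0 :=
        hC ▸ PointedCone.subset_hull (Set.mem_range_self x)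
      exact consMap_tailMap (mem_suspCone_zero.1 hx).2
    have hli : LinearIndependent ℝ fun x : s => tailMap n (x : Fin (n + 1) → ℝ) := by
      apply LinearIndependent.of_comp (consMap n)
      have h1 : (consMap n ∘ fun x : s => tailMap n (x : Fin (n + 1) → ℝ)) = fun x : s => x.1 :=
        funext h0
      rw [h1]
      exact hs
    have : σ = PointedCone.hull ℝ (Set.range fun x : s => tailMap n (x : Fin (n + 1) → ℝ)) := by
      apply suspCone_injective 0
      dsimp only
      rw [suspCone_hull_zero, ← Set.range_comp, ← hC]
      congr 2
      exact (funext h0).symm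
    rw [this]
    exact isSimplicial_hull_range hli
  · intro h
    obtain ⟨s, hs, rfl⟩ := exists_family_of_isSimplicial h
    rw [suspCone_hull_zero, ← Set.range_comp]
    exact isSimplicial_hull_range (hs.map' _ (LinearMap.ker_eq_bot.2 consMap_injective))

theorem isSimplicial_suspCone {σ : PointedCone ℝ (Fin n → ℝ)} (h : σ.IsSimplicial) {z : ℤ}
    (hz : z ≠ 0) : (suspCone σ z).IsSimplicial := by
  obtain ⟨s, hs, rfl⟩ := exists_family_of_isSimplicial h
  rw [suspCone_hull, ← Set.range_comp]
  have hli := hs.map' _ (LinearMap.ker_eq_bot.2 (consMap_injective (n := n)))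
  refine ⟨_, (Set.finite_range _).insert _, ?_, rfl⟩
  refine (linearIndepOn_insert ?_).2 ⟨hli.linearIndepOn_id, ?_⟩
  · rintro ⟨x, hx⟩
    have := congrFun hx 0
    simp at this
    exact hz (by simpa using this.symm)
  · rw [Set.image_id]
    intro hmem
    have hle : Submodule.span ℝ (Set.range (consMap n ∘ fun x : s => (x : Fin n → ℝ))) ≤
        LinearMap.ker (LinearMap.proj (R := ℝ) (φ := fun _ : Fin (n + 1) => ℝ) 0) := by
      refine Submodule.span_le.2 ?_
      rintro _ ⟨x, rfl⟩
      simp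
    have := hle hmem
    simp at this
    exact hz this

theorem isSimplicial_susp (hS : IsSimplicial S) : IsSimplicial (susp S) := by
  rintro _ ⟨σ, hσ, z, hz, rfl⟩
  by_cases h : z = 0
  · subst h; exact isSimplicial_suspCone_iff.2 (hS σ hσ)
  · exact isSimplicial_suspCone (hS σ hσ) h

theorem not_isSimplicial_susp (hS : ¬ IsSimplicial S) : ¬ IsSimplicial (susp S) := fun h =>
  hS fun _ hσ => isSimplicial_suspCone_iff.1 (h _ (suspCone_zero_mem_susp hσ))

/-- The same diagonals, placed in the hyperplane, remain a witness; this is why non-projectivity is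
carried along as twistedness. -/
theorem IsTwisted.susp (hS : IsTwisted S) : IsTwisted (susp S) := by
  obtain ⟨v, w, h1, h2⟩ := hS
  refine ⟨fun i => consMap n (v i), fun i => consMap n (w i), fun i => ?_, fun i => ?_⟩
  · rw [← map_add, ← map_add, h1]
  · have : PointedCone.hull ℝ {consMap n (v (i + 1)), consMap n (w i)} =
        suspCone (PointedCone.hull ℝ {v (i + 1), w i}) 0 := by
      rw [suspCone_hull_zero, Set.image_pair]
    rw [this, consMap_mem_suspCone]
    exact ⟨suspCone_zero_mem_susp (h2 i).1, (h2 i).2⟩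

end Suspension

/-! ### Fans generated by disjoint cones; simplicial cones. -/

section FaceFans

variable {n : ℕ} {R S C : Set (PointedCone ℝ (Fin n → ℝ))}

/-- The faces of the cones of a collection. -/
def faces (C : Set (PointedCone ℝ (Fin n → ℝ))) : Set (PointedCone ℝ (Fin n → ℝ)) :=
  {τ | ∃ σ ∈ C, τ.IsFaceOf σ}

theorem subset_faces : C ⊆ faces C := fun σ hσ => ⟨σ, hσ, .refl σ⟩

/-- Strictly convex rational polyhedral cones that pairwise meet only in the origin generate
a fan. -/
theorem isFan_faces (hC : C.Finite) (hne : C.Nonempty) (hrat : ∀ σ ∈ C, IsRationalPolyhedral σ)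
    (hsal : ∀ σ ∈ C, (σ : ConvexCone ℝ (Fin n → ℝ)).Salient)
    (hdisj : C.Pairwise fun σ τ => σ ⊓ τ = ⊥) : IsFan (faces C) where
  finite := by
    have h : faces C = ⋃ σ ∈ C, {τ | τ.IsFaceOf σ} := by ext; simp [faces]
    rw [h]
    refine hC.biUnion fun σ hσ => ?_
    obtain ⟨G, hG, h⟩ := hrat σ hσ
    refine ((hG.image intVec).finite_subsets.image (PointedCone.hull ℝ)).subset fun τ hτ => ?_
    exact ⟨_, Set.inter_subset_left, (isFaceOf_eq_hull hτ h).symm⟩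
  nonempty := hne.mono subset_faces
  rational := by
    rintro τ ⟨σ, hσ, hτ⟩
    obtain ⟨G, hG, h⟩ := hrat σ hσ
    refine ⟨{z ∈ G | intVec z ∈ τ}, hG.subset fun _ h => h.1, ?_⟩
    rw [isFaceOf_eq_hull hτ h]
    congr 1
    ext x
    constructor
    · rintro ⟨⟨z, hz, rfl⟩, hx⟩
      exact ⟨z, ⟨hz, by rwa [← isFaceOf_eq_hull hτ h]⟩, rfl⟩
    · rintro ⟨z, ⟨hz, hx⟩, rfl⟩
      exact ⟨⟨z, hz, rfl⟩, by rwa [← isFaceOf_eq_hull hτ h] at hx⟩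
  strictlyConvex := by
    rintro τ ⟨σ, hσ, hτ⟩ x hx hx0 hx'
    exact hsal σ hσ x (hτ.le hx) hx0 (hτ.le hx')
  face_mem := by
    rintro τ ⟨σ, hσ, hτ⟩ F hF
    exact ⟨σ, hσ, hF.trans hτ⟩
  inter_face := by
    have key : ∀ σ ∈ C, ∀ σ' ∈ C, ∀ τ τ' : PointedCone ℝ (Fin n → ℝ), τ.IsFaceOf σ →
        τ'.IsFaceOf σ' → (τ ⊓ τ').IsFaceOf τ := by
      intro σ hσ σ' hσ' τ τ' hτ hτ'
      by_cases h : σ = σ'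
      · subst h
        exact (PointedCone.IsFaceOf.isFaceOf_iff_le (hτ.inf_left hτ') hτ).2 inf_le_left
      · have : τ ⊓ τ' = ⊥ := le_bot_iff.1 ((inf_le_inf hτ.le hτ'.le).trans (hdisj hσ hσ' h).le)
        rw [this]
        exact isFaceOf_bot fun x hx hx0 hx' => hsal σ hσ x (hτ.le hx) hx0 (hτ.le hx')
    rintro τ ⟨σ, hσ, hτ⟩ τ' ⟨σ', hσ', hτ'⟩
    refine ⟨key σ hσ σ' hσ' τ τ' hτ hτ', ?_⟩
    rw [inf_comm]
    exact key σ' hσ' σ hσ τ' τ hτ' hτ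

theorem fanRays_faces_subset (hsal : ∀ σ ∈ C, (σ : ConvexCone ℝ (Fin n → ℝ)).Salient)
    (hR : ∀ σ ∈ C, ∃ G : Set (Fin n → ℝ), σ = PointedCone.hull ℝ G ∧
      ∀ g ∈ G, PointedCone.hull ℝ {g} ∈ R) : fanRays (faces C) ⊆ R := by
  rintro τ ⟨⟨σ, hσ, hτ⟩, hdim⟩
  obtain ⟨G, hG, hGR⟩ := hR σ hσ
  have heq := isFaceOf_eq_hull hτ hG
  have hsal' : (PointedCone.hull ℝ (G ∩ τ) : ConvexCone ℝ (Fin n → ℝ)).Salient := by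
    rw [← heq]
    exact fun x hx hx0 hx' => hsal σ hσ x (hτ.le hx) hx0 (hτ.le hx')
  rw [heq] at hdim
  obtain ⟨g, hg, -, h⟩ := exists_eq_hull_singleton hsal' hdim
  rw [heq, h]
  exact hGR g hg.1

theorem isSimplicial_faces (hC : IsSimplicial C) : IsSimplicial (faces C) := by
  rintro τ ⟨σ, hσ, hτ⟩
  obtain ⟨s, hs, hli, h⟩ := hC σ hσ
  exact ⟨s ∩ τ, hs.inter_of_left _, hli.mono Set.inter_subset_left, (isFaceOf_eq_hull hτ h.symm).symm⟩

/-- The Riesz decomposition property of simplicial cones. -/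
theorem exists_riesz_of_isSimplicial {σ : PointedCone ℝ (Fin n → ℝ)} (hσ : σ.IsSimplicial)
    {a a' b b' : Fin n → ℝ} (ha : a ∈ σ) (ha' : a' ∈ σ) (hb : b ∈ σ) (hb' : b' ∈ σ)
    (h : a + a' = b + b') : ∃ x ∈ σ, a - x ∈ σ ∧ b - x ∈ σ ∧ b' - (a - x) ∈ σ := by
  obtain ⟨s, hs, rfl⟩ := exists_family_of_isSimplicial hσ
  obtain ⟨c, hc, rfl⟩ := mem_hull_range.1 ha
  obtain ⟨c', hc', rfl⟩ := mem_hull_range.1 ha'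
  obtain ⟨d, hd, rfl⟩ := mem_hull_range.1 hb
  obtain ⟨d', hd', rfl⟩ := mem_hull_range.1 hb'
  have hsum : ∀ i, c i + c' i = d i + d' i := by
    have h0 : ∑ i, (c i + c' i - (d i + d' i)) • (i : Fin n → ℝ) = 0 := by
      simp only [sub_smul, add_smul, Finset.sum_sub_distrib, Finset.sum_add_distrib]
      rw [h, sub_self]
    intro i
    linarith [Fintype.linearIndependent_iff.1 hs _ h0 i]
  -- The common part of `a` and `b` is their coordinatewise minimum.
  refine ⟨∑ i, min (c i) (d i) • (i : Fin n → ℝ),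
    mem_hull_range.2 ⟨_, fun i => le_min (hc i) (hd i), rfl⟩,
    mem_hull_range.2 ⟨fun i => c i - min (c i) (d i), fun i => sub_nonneg.2 (min_le_left _ _), ?_⟩,
    mem_hull_range.2 ⟨fun i => d i - min (c i) (d i), fun i => sub_nonneg.2 (min_le_right _ _), ?_⟩,
    mem_hull_range.2 ⟨fun i => d' i - (c i - min (c i) (d i)), fun i => ?_, ?_⟩⟩
  · simp only [sub_smul, Finset.sum_sub_distrib]
  · simp only [sub_smul, Finset.sum_sub_distrib]
  · dsimp only
    rcases min_cases (c i) (d i) with ⟨h1, h2⟩ | ⟨h1, h2⟩ <;> rw [h1] <;>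
      linarith [hsum i, hc' i, hd' i]
  · simp only [sub_smul, Finset.sum_sub_distrib]

/-- The fan of (ℙ¹)ⁿ, an iterated suspension of the zero-dimensional fan. -/
theorem exists_projective_simplicial (n : ℕ) : ∃ R S : Set (PointedCone ℝ (Fin n → ℝ)),
    R.Finite ∧ (∀ ρ ∈ R, IsRay ρ) ∧ IsFan S ∧ fanRays S ⊆ R ∧ IsComplete S ∧ IsProjective S ∧
      IsSimplicial S := by
  induction n with
  | zero =>
    have hall : ∀ σ : PointedCone ℝ (Fin 0 → ℝ), σ = PointedCone.hull ℝ (intVec '' ∅) :=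
      fun σ => SetLike.ext fun x => by
        rw [Subsingleton.elim x 0]; exact iff_of_true (zero_mem _) (zero_mem _)
    have hsal : ∀ σ : PointedCone ℝ (Fin 0 → ℝ), (σ : ConvexCone ℝ (Fin 0 → ℝ)).Salient :=
      fun σ x _ hx => (hx (Subsingleton.elim _ _)).elim
    have hfin : (ratVec '' ({0} : Set (Fin 0 → ℚ))).Finite := (Set.finite_singleton _).image _
    have hne : (ratVec '' ({0} : Set (Fin 0 → ℚ))).Nonempty := (Set.singleton_nonempty _).image _
    refine ⟨∅, pointFan (ratVec '' {0}), Set.finite_empty, by simp,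
      isFan_pointFan hfin hne (fun p _ => ⟨∅, Set.finite_empty, hall _⟩) (fun p _ => hsal _),
      fanRays_pointFan_subset hfin hne (fun p _ => hsal _) fun p _ => ⟨_, hall _, by simp⟩,
      isComplete_pointFan _, isProjective_pointFan (Set.finite_singleton _)
        (Set.singleton_nonempty _), fun σ _ => ⟨∅, Set.finite_empty, by simp, ?_⟩⟩
    rw [hall σ, Set.image_empty]
  | succ n ih =>
    obtain ⟨R, S, h1, h2, h3, h4, h5, h6, h7⟩ := ih
    exact ⟨suspRays R, susp S, finite_suspRays h1, isRay_suspRays h2, h3.susp,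
      fanRays_susp_subset h3 h4, isComplete_susp h5, isProjective_susp h6 h3.nonempty,
      isSimplicial_susp h7⟩

theorem sSup_eq_top (hS : IsFan S) (hR : fanRays S ⊆ R) (hc : IsComplete S) : sSup R = ⊤ := by
  refine eq_top_iff.2 fun x _ => ?_
  have hx : x ∈ ⋃ σ ∈ S, (σ : Set (Fin n → ℝ)) := hc ▸ Set.mem_univ x
  obtain ⟨σ, hσ, hxσ⟩ := Set.mem_iUnion₂.1 hx
  have hle : σ ≤ sSup R := by
    rw [hS.eq_sSup hR hσ]
    exact sSup_le_sSup fun _ h => h.1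
  exact hle hxσ

end FaceFans

/-! ### The projective non-simplicial example. -/

section Pyramid

/-- The vertices of a square pyramid with rational coordinates. -/
def pyramid : Set (Fin 3 → ℚ) :=
  {![0, 0, -1], ![2, 2, 0], ![2, -2, 0], ![-2, 2, 0], ![-2, -2, 0]}

/-- Generators of the rays of the normal fan of `pyramid`. -/
def pyramidRays : Set (Fin 3 → ℤ) :=
  {![1, 0, 2], ![-1, 0, 2], ![0, 1, 2], ![0, -1, 2], ![0, 0, -1]}

/-- The cone over the square with vertices `±e₀ + 2e₂`, `±e₁ + 2e₂`. -/
def squareCone : PointedCone ℝ (Fin 3 → ℝ) :=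
  PointedCone.hull ℝ (intVec '' {![1, 0, 2], ![-1, 0, 2], ![0, 1, 2], ![0, -1, 2]})

theorem finite_pyramid : (ratVec '' pyramid).Finite := by
  refine Set.Finite.image _ ?_
  simp [pyramid]

theorem dotProduct_ratVec {a b c : ℚ} {u : Fin 3 → ℝ} :
    ratVec ![a, b, c] ⬝ᵥ u = a * u 0 + b * u 1 + c * u 2 := by
  simp [dotProduct, Fin.sum_univ_three, ratVec]

theorem mem_normalCone_pyramid {a b c : ℚ} {u : Fin 3 → ℝ} :
    u ∈ normalCone (ratVec '' pyramid) {ratVec ![a, b, c]} ↔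
      a * u 0 + b * u 1 + c * u 2 ≤ -u 2 ∧ a * u 0 + b * u 1 + c * u 2 ≤ 2 * u 0 + 2 * u 1 ∧
      a * u 0 + b * u 1 + c * u 2 ≤ 2 * u 0 + -2 * u 1 ∧
      a * u 0 + b * u 1 + c * u 2 ≤ -2 * u 0 + 2 * u 1 ∧
      a * u 0 + b * u 1 + c * u 2 ≤ -2 * u 0 + -2 * u 1 := by
  rw [mem_normalCone]
  simp only [pyramid, Set.image_insert_eq, Set.image_singleton, Set.mem_insert_iff,
    Set.mem_singleton_iff, forall_eq, forall_eq_or_imp, dotProduct_ratVec]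
  simp

theorem smul_intVec_add_mem_hull {n : ℕ} {G : Set (Fin n → ℤ)} {g : Fin n → ℤ} (hg : g ∈ G)
    {x : Fin n → ℝ} {a : ℝ} (ha : 0 ≤ a) (hx : x ∈ PointedCone.hull ℝ (intVec '' G)) :
    a • intVec g + x ∈ PointedCone.hull ℝ (intVec '' G) :=
  add_mem (PointedCone.smul_mem _ ha (PointedCone.subset_hull ⟨g, hg, rfl⟩)) hx

theorem mem_squareCone {u : Fin 3 → ℝ} : u ∈ squareCone ↔ -u 2 ≤ 2 * u 0 + 2 * u 1 ∧
    -u 2 ≤ 2 * u 0 + -2 * u 1 ∧ -u 2 ≤ -2 * u 0 + 2 * u 1 ∧ -u 2 ≤ -2 * u 0 + -2 * u 1 := by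
  have h0 := mem_normalCone_pyramid (a := 0) (b := 0) (c := -1) (u := u)
  constructor
  · intro hu
    have hle : squareCone ≤ normalCone (ratVec '' pyramid) {ratVec ![0, 0, -1]} := by
      refine Submodule.span_le.2 ?_
      rintro _ ⟨g, hg, rfl⟩
      rw [SetLike.mem_coe, mem_normalCone_pyramid]
      rcases hg with rfl | rfl | rfl | rfl <;> simp [intVec]
    simpa using h0.1 (hle hu)
  · rintro ⟨h1, h2, h3, h4⟩
    have ha : |u 0| + |u 1| ≤ u 2 / 2 := by
      rcases abs_cases (u 0) with h | h <;> rcases abs_cases (u 1) with h' | h' <;> linarith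
    -- Positive and negative parts of `u 0` and `u 1` go to the matching generators; the remaining
    -- height is spread evenly over all four.
    have key : u = ((|u 0| + u 0) / 2 + (u 2 / 2 - |u 0| - |u 1|) / 4) • intVec ![1, 0, 2] +
        (((|u 0| - u 0) / 2 + (u 2 / 2 - |u 0| - |u 1|) / 4) • intVec ![-1, 0, 2] +
        (((|u 1| + u 1) / 2 + (u 2 / 2 - |u 0| - |u 1|) / 4) • intVec ![0, 1, 2] +
        (((|u 1| - u 1) / 2 + (u 2 / 2 - |u 0| - |u 1|) / 4) • intVec ![0, -1, 2] + 0))) := by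
      ext i
      fin_cases i <;> simp [intVec] <;> ring
    have a0 := neg_le_abs (u 0)
    have a1 := le_abs_self (u 0)
    have a2 := neg_le_abs (u 1)
    have a3 := le_abs_self (u 1)
    rw [key]
    refine smul_intVec_add_mem_hull (by simp) (by linarith) <|
      smul_intVec_add_mem_hull (by simp) (by linarith) <|
      smul_intVec_add_mem_hull (by simp) (by linarith) <|
      smul_intVec_add_mem_hull (by simp) (by linarith) (zero_mem _)

theorem squareCone_eq : squareCone = normalCone (ratVec '' pyramid) {ratVec ![0, 0, -1]} :=
  SetLike.ext fun u => by rw [mem_squareCone, mem_normalCone_pyramid]; simp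

theorem normalCone_pyramid_eq {a b : ℤ} (ha : a = 1 ∨ a = -1) (hb : b = 1 ∨ b = -1) :
    normalCone (ratVec '' pyramid) {ratVec ![2 * a, 2 * b, 0]} =
      PointedCone.hull ℝ (intVec '' {![-a, 0, 2], ![0, -b, 2], ![0, 0, -1]}) := by
  apply le_antisymm
  · intro u hu
    obtain ⟨h1, h2, h3, h4, h5⟩ := mem_normalCone_pyramid.1 hu
    have key : u = (-(a : ℝ) * u 0) • intVec ![-a, 0, 2] + ((-(b : ℝ) * u 1) • intVec ![0, -b, 2] +
        ((-2 * a * u 0 - 2 * b * u 1 - u 2) • intVec ![0, 0, -1] + 0)) := by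
      ext i
      rcases ha with rfl | rfl <;> rcases hb with rfl | rfl <;>
      fin_cases i <;> simp [intVec] <;> ring
    rw [key]
    refine smul_intVec_add_mem_hull (by simp) ?_ <|
      smul_intVec_add_mem_hull (by simp) ?_ <|
      smul_intVec_add_mem_hull (by simp) ?_ (zero_mem _) <;>
    rcases ha with rfl | rfl <;> rcases hb with rfl | rfl <;>
    norm_num at h1 h2 h3 h4 h5 ⊢ <;> linarith
  · refine Submodule.span_le.2 ?_
    rintro _ ⟨g, hg, rfl⟩
    rw [SetLike.mem_coe, mem_normalCone_pyramid]
    rcases ha with rfl | rfl <;> rcases hb with rfl | rfl <;>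
    rcases hg with rfl | rfl | rfl <;> simp [intVec]

theorem exists_normalCone_pyramid_eq {p : Fin 3 → ℝ} (hp : p ∈ ratVec '' pyramid) :
    ∃ G ⊆ pyramidRays, normalCone (ratVec '' pyramid) {p} = PointedCone.hull ℝ (intVec '' G) := by
  obtain ⟨p, hp, rfl⟩ := hp
  rcases hp with rfl | rfl | rfl | rfl | rfl
  · exact ⟨_, by simp [pyramidRays, Set.insert_subset_iff], squareCone_eq.symm⟩
  · refine ⟨_, ?_, by simpa using normalCone_pyramid_eq (.inl rfl) (.inl rfl)⟩
    simp [pyramidRays, Set.insert_subset_iff]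
  · refine ⟨_, ?_, by simpa using normalCone_pyramid_eq (.inl rfl) (.inr rfl)⟩
    simp [pyramidRays, Set.insert_subset_iff]
  · refine ⟨_, ?_, by simpa using normalCone_pyramid_eq (.inr rfl) (.inl rfl)⟩
    simp [pyramidRays, Set.insert_subset_iff]
  · refine ⟨_, ?_, by simpa using normalCone_pyramid_eq (.inr rfl) (.inr rfl)⟩
    simp [pyramidRays, Set.insert_subset_iff]

theorem salient_normalCone_pyramid {p : Fin 3 → ℝ} (hp : p ∈ ratVec '' pyramid) :
    (normalCone (ratVec '' pyramid) {p} : ConvexCone ℝ (Fin 3 → ℝ)).Salient := by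
  intro x hx hx0 hx'
  apply hx0
  replace hx : x ∈ normalCone (ratVec '' pyramid) {p} := hx
  replace hx' : -x ∈ normalCone (ratVec '' pyramid) {p} := hx'
  obtain ⟨p, -, rfl⟩ := hp
  have hp : p = ![p 0, p 1, p 2] := by ext i; fin_cases i <;> rfl
  rw [hp] at hx hx'
  obtain ⟨h1, h2, h3, h4, h5⟩ := mem_normalCone_pyramid.1 hx
  obtain ⟨k1, k2, k3, k4, k5⟩ := mem_normalCone_pyramid.1 hx'
  simp only [Pi.neg_apply] at k1 k2 k3 k4 k5
  ext i
  fin_cases i <;> simp <;> linarith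

theorem finite_pyramidRays : pyramidRays.Finite := by
  simp [pyramidRays]

theorem isFan_pointFan_pyramid : IsFan (pointFan (ratVec '' pyramid)) :=
  isFan_pointFan finite_pyramid (Set.Nonempty.image _ ⟨_, Or.inl rfl⟩) (fun p hp => by
    obtain ⟨G, hG, h⟩ := exists_normalCone_pyramid_eq hp
    exact ⟨G, finite_pyramidRays.subset hG, h⟩) fun p hp => salient_normalCone_pyramid hp

/-- The diagonals of the square have the same midpoint, and this relation between the four
generators has no Riesz refinement. -/
theorem not_isSimplicial_squareCone : ¬ squareCone.IsSimplicial := by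
  intro h
  obtain ⟨x, h1, h2, h3, h4⟩ := exists_riesz_of_isSimplicial h (a := intVec ![1, 0, 2])
    (a' := intVec ![-1, 0, 2]) (b := intVec ![0, 1, 2]) (b' := intVec ![0, -1, 2])
    (PointedCone.subset_hull ⟨_, by simp, rfl⟩) (PointedCone.subset_hull ⟨_, by simp, rfl⟩)
    (PointedCone.subset_hull ⟨_, by simp, rfl⟩) (PointedCone.subset_hull ⟨_, by simp, rfl⟩)
    (by ext i; fin_cases i <;> simp [intVec])
  rw [mem_squareCone] at h1 h2 h3 h4
  simp [intVec] at h1 h2 h3 h4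
  linarith

theorem squareCone_mem_pointFan : squareCone ∈ pointFan (ratVec '' pyramid) := by
  refine ⟨![0, 0, 1], ?_⟩
  have : argmin (ratVec '' pyramid) ![0, 0, 1] = {ratVec ![0, 0, -1]} := by
    ext p
    constructor
    · rintro ⟨⟨p, hp, rfl⟩, h⟩
      have := h _ ⟨![0, 0, -1], Or.inl rfl, rfl⟩
      rcases hp with rfl | rfl | rfl | rfl | rfl
      · rfl
      all_goals
        exfalso
        simp only [dotProduct_ratVec] at this
        simp at this
        linarith
    · rintro rfl
      refine ⟨⟨_, Or.inl rfl, rfl⟩, ?_⟩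
      rintro _ ⟨p, hp, rfl⟩
      rcases hp with rfl | rfl | rfl | rfl | rfl <;>
        simp only [dotProduct_ratVec] <;> simp
  dsimp only
  rw [this, squareCone_eq]

end Pyramid

/-! ### Cones over the diagonals of a triangular prism. -/

section Prism

/-- The top vertices of a triangular prism. -/
def prismTop : Fin 3 → Fin 3 → ℤ := ![![1, 0, 1], ![0, 1, 1], ![-1, -1, 1]]

/-- The bottom vertices of a triangular prism. -/
def prismBot : Fin 3 → Fin 3 → ℤ := ![![1, 0, -1], ![0, 1, -1], ![-1, -1, -1]]

/-- Diagonals of the three sides of the prism. -/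
def prismDiagonal (i : Fin 3) : PointedCone ℝ (Fin 3 → ℝ) :=
  PointedCone.hull ℝ {intVec (prismTop (i + 1)), intVec (prismBot i)}

theorem mem_prismDiagonal_zero {x : Fin 3 → ℝ} : x ∈ prismDiagonal 0 ↔
    0 ≤ x 0 ∧ 0 ≤ x 1 ∧ x 2 = x 1 - x 0 := by
  rw [prismDiagonal, mem_hull_pair]
  constructor
  · rintro ⟨α, β, hα, hβ, rfl⟩
    simp [prismTop, prismBot, intVec, hα, hβ]
    ring
  · rintro ⟨h0, h1, h2⟩
    refine ⟨x 1, x 0, h1, h0, ?_⟩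
    ext i
    fin_cases i <;> simp [prismTop, prismBot, intVec, h2]
    ring

theorem mem_prismDiagonal_one {x : Fin 3 → ℝ} : x ∈ prismDiagonal 1 ↔
    x 0 ≤ 0 ∧ x 0 ≤ x 1 ∧ x 2 = -x 1 := by
  rw [prismDiagonal, mem_hull_pair]
  constructor
  · rintro ⟨α, β, hα, hβ, rfl⟩
    simp [prismTop, prismBot, intVec, hα, hβ]
    ring
  · rintro ⟨h0, h1, h2⟩
    refine ⟨-x 0, x 1 - x 0, by linarith, by linarith, ?_⟩
    ext i
    fin_cases i <;> simp [prismTop, prismBot, intVec, h2]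
    ring

theorem mem_prismDiagonal_two {x : Fin 3 → ℝ} : x ∈ prismDiagonal 2 ↔
    x 1 ≤ 0 ∧ x 1 ≤ x 0 ∧ x 2 = x 0 := by
  rw [prismDiagonal, mem_hull_pair]
  constructor
  · rintro ⟨α, β, hα, hβ, rfl⟩
    simp [prismTop, prismBot, intVec, hα, hβ]
  · rintro ⟨h0, h1, h2⟩
    refine ⟨x 0 - x 1, -x 1, by linarith, by linarith, ?_⟩
    ext i
    fin_cases i <;> simp [prismTop, prismBot, intVec, h2]

/-- The cones project onto three sectors of the plane of the first two coordinates. Over a boundary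
ray shared by two sectors the heights `x 2` are opposite. -/
theorem prismDiagonal_inf_eq_bot {i j : Fin 3} (h : i ≠ j) :
    prismDiagonal i ⊓ prismDiagonal j = ⊥ := by
  wlog hij : i < j generalizing i j
  · rw [inf_comm]
    exact this h.symm (lt_of_le_of_ne (not_lt.1 hij) h.symm)
  refine (Submodule.eq_bot_iff _).2 ?_
  rintro x ⟨hx, hy⟩
  replace hx : x ∈ prismDiagonal i := hx
  replace hy : x ∈ prismDiagonal j := hy
  ext k
  fin_cases i <;> fin_cases j <;> simp at hij <;>
  simp [mem_prismDiagonal_zero, mem_prismDiagonal_one, mem_prismDiagonal_two] at hx hy <;>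
  fin_cases k <;> simp <;> linarith

/-- The square cone is steep: there `2 * (|x 0| + |x 1|) ≤ x 2`, while `|x 2| ≤ |x 0| + |x 1|` on
each diagonal. -/
theorem squareCone_inf_prismDiagonal (i : Fin 3) : squareCone ⊓ prismDiagonal i = ⊥ := by
  refine (Submodule.eq_bot_iff _).2 ?_
  rintro x ⟨hx, hy⟩
  replace hx : x ∈ squareCone := hx
  replace hy : x ∈ prismDiagonal i := hy
  obtain ⟨h1, h2, h3, h4⟩ := mem_squareCone.1 hx
  ext k
  fin_cases i <;>
  simp [mem_prismDiagonal_zero, mem_prismDiagonal_one, mem_prismDiagonal_two] at hy <;>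
  fin_cases k <;> simp <;> linarith

end Prism

/-! ### Fans generated by the diagonals and the square cone. -/

section Prism

theorem linearIndependent_prismDiagonal (i : Fin 3) :
    LinearIndependent ℝ ![intVec (prismTop (i + 1)), intVec (prismBot i)] := by
  refine LinearIndependent.pair_iff.2 fun s t h => ?_
  have h0 := congrFun h 0
  have h1 := congrFun h 1
  have h2 := congrFun h 2
  fin_cases i <;> simp [prismTop, prismBot, intVec] at h0 h1 h2 <;>
    constructor <;> linarith

theorem prismDiagonal_eq_range (i : Fin 3) : prismDiagonal i =
    PointedCone.hull ℝ (Set.range ![intVec (prismTop (i + 1)), intVec (prismBot i)]) := by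
  rw [Matrix.range_cons_cons_empty, prismDiagonal]

theorem prismDiagonal_eq_image (i : Fin 3) : prismDiagonal i =
    PointedCone.hull ℝ (intVec '' {prismTop (i + 1), prismBot i}) := by
  rw [Set.image_pair, prismDiagonal]

theorem salient_prismDiagonal (i : Fin 3) :
    (prismDiagonal i : ConvexCone ℝ (Fin 3 → ℝ)).Salient := by
  rw [prismDiagonal_eq_range]
  exact salient_hull_range (linearIndependent_prismDiagonal i)

theorem isSimplicial_range_prismDiagonal : IsSimplicial (Set.range prismDiagonal) := by
  rintro _ ⟨i, rfl⟩
  rw [prismDiagonal_eq_range]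
  exact isSimplicial_hull_range (linearIndependent_prismDiagonal i)

theorem salient_squareCone : (squareCone : ConvexCone ℝ (Fin 3 → ℝ)).Salient := by
  rw [squareCone_eq]
  exact salient_normalCone_pyramid ⟨_, Or.inl rfl, rfl⟩

theorem isTwisted_of_prismDiagonal_mem {S : Set (PointedCone ℝ (Fin 3 → ℝ))}
    (h : ∀ i, prismDiagonal i ∈ S) : IsTwisted S := by
  refine ⟨fun i => intVec (prismTop i), fun i => intVec (prismBot i), fun i => ?_,
    fun i => ⟨h i, fun hi => ?_⟩⟩
  · ext k
    fin_cases i <;> fin_cases k <;> simp [prismTop, prismBot, intVec]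
  · replace hi : intVec (prismTop i) ∈ prismDiagonal i := hi
    fin_cases i <;>
    simp [mem_prismDiagonal_zero, mem_prismDiagonal_one, mem_prismDiagonal_two, prismTop,
      intVec] at hi
    all_goals linarith

/-- The diagonals of the sides of the prism, together with the cone over the square. -/
def squareAndDiagonals : Set (PointedCone ℝ (Fin 3 → ℝ)) := insert squareCone (Set.range prismDiagonal)

/-- Generators of the rays that occur in the explicit three-dimensional fans. -/
def explicitRays : Set (Fin 3 → ℤ) := pyramidRays ∪ (Set.range prismTop ∪ Set.range prismBot)

theorem finite_explicitRays : explicitRays.Finite :=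
  finite_pyramidRays.union ((Set.finite_range _).union (Set.finite_range _))

theorem exists_eq_hull_of_mem_squareAndDiagonals {σ : PointedCone ℝ (Fin 3 → ℝ)}
    (hσ : σ ∈ squareAndDiagonals) : ∃ G ⊆ explicitRays, σ = PointedCone.hull ℝ (intVec '' G) := by
  rcases hσ with rfl | ⟨i, rfl⟩
  · refine ⟨_, ?_, rfl⟩
    simp [explicitRays, pyramidRays, Set.insert_subset_iff]
  · refine ⟨_, ?_, prismDiagonal_eq_image i⟩
    rintro g (rfl | rfl)
    exacts [Or.inr (Or.inl ⟨_, rfl⟩), Or.inr (Or.inr ⟨_, rfl⟩)]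

theorem isRationalPolyhedral_of_mem_squareAndDiagonals {σ : PointedCone ℝ (Fin 3 → ℝ)}
    (hσ : σ ∈ squareAndDiagonals) : IsRationalPolyhedral σ := by
  obtain ⟨G, hG, h⟩ := exists_eq_hull_of_mem_squareAndDiagonals hσ
  exact ⟨G, finite_explicitRays.subset hG, h⟩

theorem salient_of_mem_squareAndDiagonals {σ : PointedCone ℝ (Fin 3 → ℝ)}
    (hσ : σ ∈ squareAndDiagonals) : (σ : ConvexCone ℝ (Fin 3 → ℝ)).Salient := by
  rcases hσ with rfl | ⟨i, rfl⟩
  exacts [salient_squareCone, salient_prismDiagonal i]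

theorem pairwise_squareAndDiagonals :
    squareAndDiagonals.Pairwise fun σ τ => σ ⊓ τ = ⊥ := by
  rintro _ (rfl | ⟨i, rfl⟩) _ (rfl | ⟨j, rfl⟩) hne
  · exact (hne rfl).elim
  · exact squareCone_inf_prismDiagonal j
  · rw [inf_comm]
    exact squareCone_inf_prismDiagonal i
  · exact prismDiagonal_inf_eq_bot fun h => hne (h ▸ rfl)

theorem isFan_faces_of_subset {C : Set (PointedCone ℝ (Fin 3 → ℝ))} (hC : C ⊆ squareAndDiagonals)
    (hne : C.Nonempty) : IsFan (faces C) :=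
  isFan_faces (((Set.finite_range _).insert _).subset hC) hne
    (fun _ h => isRationalPolyhedral_of_mem_squareAndDiagonals (hC h))
    (fun _ h => salient_of_mem_squareAndDiagonals (hC h)) (pairwise_squareAndDiagonals.mono hC)

end Prism

/-! ### The four kinds of fans, and induction on the dimension. -/

section Main

/-- A finite set of rays all of whose maximal fans are complete, with maximal fans of all four
kinds, non-projectivity being witnessed by twistedness. -/
def HasAllKinds {n : ℕ} (R : Set (PointedCone ℝ (Fin n → ℝ))) : Prop :=
  R.Finite ∧ (∀ ρ ∈ R, IsRay ρ) ∧ (∀ S, IsMaximalFan R S → IsComplete S) ∧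
    (∃ S, IsMaximalFan R S ∧ IsProjective S ∧ IsSimplicial S) ∧
    (∃ S, IsMaximalFan R S ∧ IsProjective S ∧ ¬ IsSimplicial S) ∧
    (∃ S, IsMaximalFan R S ∧ IsTwisted S ∧ IsSimplicial S) ∧
    (∃ S, IsMaximalFan R S ∧ IsTwisted S ∧ ¬ IsSimplicial S)

theorem exists_hasAllKinds_three : ∃ R : Set (PointedCone ℝ (Fin 3 → ℝ)), HasAllKinds R := by
  obtain ⟨R₀, S₀, hfin, hray, hS, hSR, hc, hp, hs⟩ := exists_projective_simplicial 3
  -- The rays `R₀` of a complete fan ensure that `R` positively spans ℝ³.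
  set R := R₀ ∪ (fun g => PointedCone.hull ℝ {intVec g}) '' explicitRays with hRdef
  have hR : R.Finite := hfin.union (finite_explicitRays.image _)
  have hne0 : (0 : Fin 3 → ℤ) ∉ explicitRays := by
    rintro (h | ⟨i, h⟩ | ⟨i, h⟩)
    · rcases h with h | h | h | h | h <;> simpa using congrFun h 2
    · have := congrFun h 2
      fin_cases i <;> simp [prismTop] at this
    · have := congrFun h 2
      fin_cases i <;> simp [prismBot] at this
  have hrayR : ∀ ρ ∈ R, IsRay ρ := by
    rintro ρ (hρ | ⟨g, hg, rfl⟩)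
    exacts [hray ρ hρ, ⟨g, fun h => hne0 (h ▸ hg), rfl⟩]
  have hgen : ∀ G ⊆ explicitRays, ∀ g ∈ intVec '' G, PointedCone.hull ℝ {g} ∈ R := by
    rintro G hG _ ⟨g, hg, rfl⟩
    exact Or.inr ⟨g, hG hg, rfl⟩
  have hspan : sSup R = ⊤ :=
    sSup_eq_top hS (hSR.trans Set.subset_union_left) hc
  have hfaces : ∀ C ⊆ squareAndDiagonals, fanRays (faces C) ⊆ R := fun C hC =>
    fanRays_faces_subset (fun _ h => salient_of_mem_squareAndDiagonals (hC h)) fun σ hσ => by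
      obtain ⟨G, hG, h⟩ := exists_eq_hull_of_mem_squareAndDiagonals (hC hσ)
      exact ⟨_, h, hgen G hG⟩
  refine ⟨R, hR, hrayR, fun S h => h.isSaturated.isComplete hrayR hspan, ?_, ?_, ?_, ?_⟩
  · exact ⟨S₀, hS.isMaximalFan_of_isComplete (hSR.trans Set.subset_union_left) hc, hp, hs⟩
  · have hrays : fanRays (pointFan (ratVec '' pyramid)) ⊆ R :=
      fanRays_pointFan_subset finite_pyramid (Set.Nonempty.image _ ⟨_, Or.inl rfl⟩)
        (fun _ h => salient_normalCone_pyramid h) fun p hp => by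
          obtain ⟨G, hG, h⟩ := exists_normalCone_pyramid_eq hp
          exact ⟨_, h, hgen G (hG.trans Set.subset_union_left)⟩
    refine ⟨_, isFan_pointFan_pyramid.isMaximalFan_of_isComplete hrays (isComplete_pointFan _),
      isProjective_pointFan (by simp [pyramid]) ⟨_, Or.inl rfl⟩, fun h => ?_⟩
    exact not_isSimplicial_squareCone (h _ squareCone_mem_pointFan)
  · have hsub : Set.range prismDiagonal ⊆ squareAndDiagonals := Set.subset_insert _ _
    -- Maximality is imposed only among simplicial fans; completeness then upgrades it to maximality
    -- among all fans.
    obtain ⟨S, hle, hmax⟩ := (isFan_faces_of_subset hsub (Set.range_nonempty _)).exists_maximal hR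
      (hfaces _ hsub) IsSimplicial (isSimplicial_faces isSimplicial_range_prismDiagonal)
    exact ⟨S, hmax.prop.1.1.isMaximalFan_of_isComplete hmax.prop.1.2
      ((isSaturated_of_maximal_isSimplicial hmax).isComplete hrayR hspan),
      isTwisted_of_prismDiagonal_mem fun i => hle (subset_faces ⟨i, rfl⟩), hmax.prop.2⟩
  -- No side condition is needed here: any extension keeps both the square cone and the diagonals.
  · obtain ⟨S, hle, hmax⟩ := (isFan_faces_of_subset subset_rfl ⟨_, Or.inl rfl⟩).exists_maximal hR
      (hfaces _ subset_rfl) (fun _ => True) trivial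
    simp only [and_true] at hmax
    refine ⟨S, hmax, isTwisted_of_prismDiagonal_mem fun i => hle (subset_faces (Or.inr ⟨i, rfl⟩)),
      fun h => ?_⟩
    exact not_isSimplicial_squareCone (h _ (hle (subset_faces (Or.inl rfl))))

theorem HasAllKinds.suspRays {n : ℕ} {R : Set (PointedCone ℝ (Fin n → ℝ))} (h : HasAllKinds R) :
    HasAllKinds (suspRays R) := by
  obtain ⟨hfin, hray, hc, ⟨S₁, m₁, p₁, s₁⟩, ⟨S₂, m₂, p₂, s₂⟩, ⟨S₃, m₃, p₃, s₃⟩, ⟨S₄, m₄, p₄, s₄⟩⟩ := h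
  have hmax : ∀ S, IsMaximalFan R S → IsMaximalFan (ToricFan.suspRays R) (susp S) := fun S hS =>
    hS.prop.1.susp.isMaximalFan_of_isComplete (fanRays_susp_subset hS.prop.1 hS.prop.2)
      (isComplete_susp (hc S hS))
  exact ⟨finite_suspRays hfin, isRay_suspRays hray,
    fun S hS => isComplete_of_isMaximalFan_suspRays hc hS,
    ⟨_, hmax _ m₁, isProjective_susp p₁ m₁.prop.1.nonempty, isSimplicial_susp s₁⟩,
    ⟨_, hmax _ m₂, isProjective_susp p₂ m₂.prop.1.nonempty, not_isSimplicial_susp s₂⟩,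
    ⟨_, hmax _ m₃, p₃.susp, isSimplicial_susp s₃⟩,
    ⟨_, hmax _ m₄, p₄.susp, not_isSimplicial_susp s₄⟩⟩

theorem exists_hasAllKinds {n : ℕ} (hn : 3 ≤ n) :
    ∃ R : Set (PointedCone ℝ (Fin n → ℝ)), HasAllKinds R := by
  induction n, hn using Nat.le_induction with
  | base => exact exists_hasAllKinds_three
  | succ n _ ih =>
    obtain ⟨R, hR⟩ := ih
    exact ⟨_, hR.suspRays⟩

end Main

end ToricFan

theorem mainTheorem1 (n : ℕ) (hn : 3 ≤ n) :
    ∃ R : Set (PointedCone ℝ (Fin n → ℝ)),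
      R.Finite ∧ (∀ ρ ∈ R, ToricFan.IsRay ρ) ∧
      (∀ S, ToricFan.IsMaximalFan R S → ToricFan.IsComplete S) ∧
      (∃ S, ToricFan.IsMaximalFan R S ∧ ToricFan.IsProjective S ∧ ToricFan.IsSimplicial S) ∧
      (∃ S, ToricFan.IsMaximalFan R S ∧ ToricFan.IsProjective S ∧ ¬ ToricFan.IsSimplicial S) ∧
      (∃ S, ToricFan.IsMaximalFan R S ∧ ¬ ToricFan.IsProjective S ∧ ToricFan.IsSimplicial S) ∧
      (∃ S, ToricFan.IsMaximalFan R S ∧ ¬ ToricFan.IsProjective S ∧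
        ¬ ToricFan.IsSimplicial S) := by
  obtain ⟨R, h1, h2, h3, h4, h5, ⟨S₃, m₃, p₃, s₃⟩, ⟨S₄, m₄, p₄, s₄⟩⟩ := ToricFan.exists_hasAllKinds hn
  exact ⟨R, h1, h2, h3, h4, h5, ⟨S₃, m₃, p₃.not_isProjective, s₃⟩, ⟨S₄, m₄, p₄.not_isProjective, s₄⟩⟩
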